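/- **Theorem 4.3.** Let $0<\nu<1$ and $0<a\le\infty$. Let $f$ be a complex-valued function that on the real interval $[-a,a]$ (on $\mathbb R$ if $a=\infty$) is the restriction of a function $f(z)$ of a complex variable that is analytic at every point of this interval ("$f$ is complex analytic in $[-a,a]$"). Let $\rho_0\in(0,\infty]$ be the distance from the origin to the singularity of $f(z)$ nearest to the origin, that is, the radius of the largest disc about $0$ to which the germ of $f$ at $0$ extends analytically ($\rho_0=\infty$ if $f(z)$ is entire). For real $x<0$ put $x^{-\nu}=e^{-i\pi\nu}|x|^{-\nu}$. *Conventions.* For $a<\infty$, $\operatorname{PV}\!\int_{-a}^{a}h(x)\,dx=\lim_{\delta\to0^+}\big(\int_{-a}^{\omega-\delta}h+\int_{\omega+\delta}^{a}h\big)$, where $\omega$ is the singular point, and the finite part $\operatorname{FP}\!\int_0^a\varphi(x)\,dx$ is $\lim_{\varepsilon\to0^+}C_\varepsilon$, where $\int_\varepsilon^a\varphi(x)\,dx=C_\varepsilon+D_\varepsilon$, $C_\varepsilon$ converges and $D_\varepsilon$ is a finite linear combination of diverging powers $\varepsilon^{-p}$ $(p>0)$ and $\ln\varepsilon$. For $a=\infty$,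 principal values over $(-\infty,\infty)$, finite parts $\operatorname{FP}\!\int_0^\infty$ and convergent integrals $\int_0^\infty$ are the limits as $A\to\infty$ of those over $[-A,A]$, respectively $[0,A]$. If $a=\infty$, suppose in addition that $\operatorname{PV}\!\int_{-\infty}^{\infty}\frac{f(x)}{x^{\nu}(\omega-x)}dx$ exists for every real $\omega\ne0$ with $|\omega|<\rho_0$. Then the following hold for all real $\omega$ with $|\omega|<\min(a,\rho_0)$, where moreover $\omega\neq0$ in (1) and (2). In each of them the finite parts and the other integrals on the right exist, the series converge, and the principal value exists. (1) If $f(0)\ne0$, then $$\operatorname{PV}\!\!\int_{-a}^a\frac{f(x)}{x^{\nu}(\omega-x)}dx=\sum_{k=0}^\infty\omega^k\,\operatorname{FP}\!\!\int_0^a\frac{e^{-i\pi\nu}(-1)^kf(-x)-f(x)}{x^{k+\nu+1}}dx-i\pi\frac{f(\omega)}{\omega^{\nu}}.$$ (2) If $f$ is even on $[-a,a]$ and $f(0)\neq0$, then $$\operatorname{PV}\!\!\int_{-a}^a\frac{f(x)}{x^{\nu}(\omega-x)}dx=-2i\sin\tfrac{\pi\nu}2\,e^{-i\pi\nu/2}\sum_{k=0}^\infty\omega^{2k}\,\operatorname{FP}\!\!\int_0^a\frac{f(x)}{x^{2k+\nu+1}}dx-2\cos\tfrac{\pi\nu}2\,e^{-i\pi\nu/2}\sum_{k=0}^\infty\omega^{2k+1}\,\operatorname{FP}\!\!\int_0^a\frac{f(x)}{x^{2k+\nu+2}}dx-i\pi\frac{f(\omega)}{\omega^{\nu}}.$$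 (3) If $f(x)=x^mg(x)$ on $[-a,a]$ with an integer $m\ge1$ and $g$ complex analytic in $[-a,a]$, $g(0)\ne0$, then, with $\omega^{m-\nu}=\omega^m\omega^{-\nu}$ (which is $0$ for $\omega=0$), $$\operatorname{PV}\!\!\int_{-a}^a\frac{f(x)}{x^{\nu}(\omega-x)}dx=\sum_{k=0}^{m-1}\omega^k\int_0^a\frac{(-1)^{k+m}e^{-i\pi\nu}g(-x)-g(x)}{x^{k-m+\nu+1}}dx+\sum_{k=0}^\infty\omega^{k+m}\,\operatorname{FP}\!\!\int_0^a\frac{(-1)^ke^{-i\pi\nu}g(-x)-g(x)}{x^{k+\nu+1}}dx-i\pi\,\omega^{m-\nu}g(\omega).$$ (4) If in (3) $g$ is moreover even on $[-a,a]$, then $$\begin{aligned}\operatorname{PV}\!\!\int_{-a}^a\frac{f(x)}{x^{\nu}(\omega-x)}dx={}&-i\pi\,\omega^{m-\nu}g(\omega)-2ie^{-i\pi\nu/2}\sin\tfrac{\pi\nu}2\sum_{k=0}^\infty\omega^{2k+m}\,\operatorname{FP}\!\!\int_0^a\frac{g(x)}{x^{2k+\nu+1}}dx-2e^{-i\pi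\nu/2}\cos\tfrac{\pi\nu}2\sum_{k=0}^\infty\omega^{2k+m+1}\,\operatorname{FP}\!\!\int_0^a\frac{g(x)}{x^{2k+\nu+2}}dx\\&-2ie^{-i\pi\nu/2}\sin\tfrac{\pi\nu}2\sum_{k=0}^{\lfloor(m-2)/2\rfloor}\omega^{2k+2\lfloor(m+1)/2\rfloor-m}\int_0^a\frac{g(x)\,dx}{x^{2k+\nu-1-2\lfloor(m-2)/2\rfloor}}\\&-2e^{-i\pi\nu/2}\cos\tfrac{\pi\nu}2\sum_{k=0}^{\lfloor(m-1)/2\rfloor}\omega^{2k+1+2\lfloor m/2\rfloor-m}\int_0^a\frac{g(x)\,dx}{x^{2k+\nu-2\lfloor(m-1)/2\rfloor}}.\end{aligned}$$ -/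

import Mathlib

open Filter Topology MeasureTheory

open scoped ENNReal

noncomputable section

/-- The points of the real interval `[-a, a]`, where `0 < a ≤ ∞` (the whole line if `a = ∞`). -/
def symInterval (a : WithTop ℝ) : Set ℝ := {x : ℝ | ((|x| : ℝ) : WithTop ℝ) ≤ a}

/-- `f` is complex analytic in the real set `s`: on `s` it is the restriction of a function of a
complex variable that is analytic at every point of `s`. -/
def IsComplexAnalyticOn (f : ℝ → ℂ) (s : Set ℝ) : Prop :=
  ∃ F : ℂ → ℂ, (∀ x ∈ s, AnalyticAt ℂ F (x : ℂ)) ∧ ∀ x ∈ s, F (x : ℂ) = f x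

/-- The distance `ρ₀` from the origin to the nearest singularity of the complex extension of `f`:
the radius of the largest disc about `0` to which the germ of `f` at `0` extends analytically
(`∞` if the extension is entire). -/
def singularityDist (f : ℝ → ℂ) : ℝ≥0∞ :=
  sSup {r : ℝ≥0∞ | ∃ F : ℂ → ℂ, AnalyticOnNhd ℂ F (Metric.eball 0 r) ∧
    ∀ᶠ x : ℝ in 𝓝 0, F (x : ℂ) = f x}

/-- `x ↦ x ^ (-ν)` on the real line, with `x ^ (-ν) = e ^ (-iπν) |x| ^ (-ν)` for `x < 0`. -/
def negPow (ν x : ℝ) : ℂ :=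
  if x < 0 then Complex.exp (-(Complex.I * Real.pi * ν)) * ((|x| ^ (-ν) : ℝ) : ℂ)
  else ((x ^ (-ν) : ℝ) : ℂ)

/-- For a real upper limit `a`: the finite part of `∫₀ᵃ φ` exists and equals `L`. That is,
`∫_ε^a φ = C(ε) + D(ε)` where `D` is a combination of diverging powers `ε ^ (-p)`, `p > 0`, and of
`ln ε`, and where `C(ε) → L` as `ε → 0+`. -/
def HasFinitePartReal (φ : ℝ → ℂ) (a : ℝ) (L : ℂ) : Prop :=
  (∀ ε : ℝ, 0 < ε → ε < a → IntervalIntegrable φ volume ε a) ∧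
  ∃ (S : Finset ℝ) (d : ℝ → ℂ) (b : ℂ), (∀ p ∈ S, 0 < p) ∧
    Tendsto (fun ε : ℝ => (∫ x in ε..a, φ x) -
        ((∑ p ∈ S, d p * ((ε ^ (-p) : ℝ) : ℂ)) + b * (Real.log ε : ℂ)))
      (𝓝[>] 0) (𝓝 L)

/-- The finite part of `∫₀ᵃ φ`, `0 < a ≤ ∞`, exists and equals `L`; for `a = ∞` it is the limit of
the finite parts of `∫₀ᴬ φ` as `A → ∞`. -/
def HasFinitePart (φ : ℝ → ℂ) : WithTop ℝ → ℂ → Prop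
  | (a : ℝ), L => HasFinitePartReal φ a L
  | ⊤, L => ∃ F : ℝ → ℂ, (∀ A : ℝ, 0 < A → HasFinitePartReal φ A (F A)) ∧
      Tendsto F atTop (𝓝 L)

/-- The integral `∫₀ᵃ φ`, `0 < a ≤ ∞`, converges and equals `L`; for `a = ∞` it is the limit of
`∫₀ᴬ φ` as `A → ∞`. -/
def HasConvIntegral (φ : ℝ → ℂ) : WithTop ℝ → ℂ → Prop
  | (a : ℝ), L => IntervalIntegrable φ volume 0 a ∧ ∫ x in (0 : ℝ)..a, φ x = L
  | ⊤, L => (∀ A : ℝ, 0 < A → IntervalIntegrable φ volume 0 A) ∧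
      Tendsto (fun A : ℝ => ∫ x in (0 : ℝ)..A, φ x) atTop (𝓝 L)

/-- For real `a > |ω|`: the Cauchy principal value of `∫_{-a}^a h`, where `h` is singular at `ω`,
exists and equals `V`. -/
def HasPVReal (h : ℝ → ℂ) (ω a : ℝ) (V : ℂ) : Prop :=
  (∀ᶠ δ : ℝ in 𝓝[>] 0, IntervalIntegrable h volume (-a) (ω - δ) ∧
    IntervalIntegrable h volume (ω + δ) a) ∧
  Tendsto (fun δ : ℝ => (∫ x in (-a)..(ω - δ), h x) + ∫ x in (ω + δ)..a, h x)
    (𝓝[>] 0) (𝓝 V)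

/-- The Cauchy principal value of `∫_{-a}^a h`, `|ω| < a ≤ ∞`, where `h` is singular at `ω`, exists
and equals `V`; for `a = ∞` it is the limit of the principal values over `[-A, A]` as `A → ∞`. -/
def HasPV (h : ℝ → ℂ) (ω : ℝ) : WithTop ℝ → ℂ → Prop
  | (a : ℝ), V => HasPVReal h ω a V
  | ⊤, V => ∃ F : ℝ → ℂ, (∀ A : ℝ, |ω| < A → HasPVReal h ω A (F A)) ∧
      Tendsto F atTop (𝓝 V)

/-- The integrand `f(x) / (x ^ ν (ω - x))` of the Hilbert transform of `x ^ (-ν) f(x)`. -/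
def hilbertIntegrand (f : ℝ → ℂ) (ν ω : ℝ) (x : ℝ) : ℂ :=
  f x * negPow ν x / ((ω : ℂ) - (x : ℂ))

/-- A combination of diverging powers and of the logarithm that converges at `0+` tends to `0`. -/
theorem diverging_part_limit (S : Finset ℝ) (d : ℝ → ℂ) (b L : ℂ) (hS : ∀ p ∈ S, 0 < p)
    (h : Tendsto (fun ε : ℝ => (∑ p ∈ S, d p * ((ε ^ (-p) : ℝ) : ℂ)) + b * (Real.log ε : ℂ))
      (𝓝[>] 0) (𝓝 L)) : L = 0 := by
  have hpow : ∀ q : ℝ, 0 < q →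
      Tendsto (fun ε : ℝ => ((ε ^ q : ℝ) : ℂ)) (𝓝[>] 0) (𝓝 0) := by
    intro q hq
    have h1 : Tendsto (fun ε : ℝ => ε ^ q) (𝓝[>] 0) (𝓝 0) := by
      have := (Real.continuousAt_rpow_const 0 q (Or.inr hq.le)).tendsto
      rw [Real.zero_rpow hq.ne'] at this
      exact this.mono_left nhdsWithin_le_nhds
    have h2 := (Complex.continuous_ofReal.tendsto 0).comp h1
    rw [Complex.ofReal_zero] at h2
    exact h2
  have hlog : ∀ q : ℝ, 0 < q →
      Tendsto (fun ε : ℝ => ((ε ^ q : ℝ) : ℂ) * (Real.log ε : ℂ)) (𝓝[>] 0) (𝓝 0) := by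
    intro q hq
    have h1 := tendsto_log_mul_rpow_nhdsGT_zero hq
    have h2 := (Complex.continuous_ofReal.tendsto 0).comp h1
    simp only [Complex.ofReal_zero] at h2
    refine h2.congr fun ε => ?_
    simp [mul_comm]
  induction S using Finset.induction_on_max generalizing L with
  | empty =>
    simp only [Finset.sum_empty, zero_add] at h
    by_cases hb : b = 0
    · subst hb
      simp only [zero_mul] at h
      exact (tendsto_nhds_unique h tendsto_const_nhds)
    · exfalso
      have h1 : Tendsto (fun ε : ℝ => b⁻¹ * (b * (Real.log ε : ℂ))) (𝓝[>] 0) (𝓝 (b⁻¹ * L)) :=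
        h.const_mul _
      have h2 : Tendsto (fun ε : ℝ => Real.log ε) (𝓝[>] 0) (𝓝 (b⁻¹ * L).re) := by
        refine ((Complex.continuous_re.tendsto _).comp h1).congr fun ε => ?_
        simp [inv_mul_cancel_left₀ hb]
      exact not_tendsto_nhds_of_tendsto_atBot Real.tendsto_log_nhdsGT_zero _ h2
  | insert q T hmax ih =>
    have hq : 0 < q := hS q (Finset.mem_insert_self _ _)
    have hqT : q ∉ T := fun hh => lt_irrefl _ (hmax q hh)
    have hT : ∀ p ∈ T, 0 < p := fun p hp => hS p (Finset.mem_insert_of_mem hp)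
    have hd : d q = 0 := by
      have h1 := (hpow q hq).mul h
      rw [zero_mul] at h1
      have h2 : Tendsto (fun ε : ℝ => d q + ((∑ p ∈ T, d p * ((ε ^ (q - p) : ℝ) : ℂ)) +
          b * (((ε ^ q : ℝ) : ℂ) * (Real.log ε : ℂ)))) (𝓝[>] 0)
          (𝓝 (d q + ((∑ p ∈ T, d p * 0) + b * 0))) := by
        refine tendsto_const_nhds.add ((tendsto_finsetSum _ fun p hp => ?_).add
          ((hlog q hq).const_mul _))
        exact (hpow (q - p) (sub_pos.2 (hmax p hp))).const_mul _
      have h3 := tendsto_nhds_unique (h1.congr' ?_) h2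
      · simpa using h3.symm
      · filter_upwards [self_mem_nhdsWithin] with ε hε
        have hε' : (0 : ℝ) < ε := hε
        have key : ∀ p : ℝ, ((ε ^ q : ℝ) : ℂ) * ((ε ^ (-p) : ℝ) : ℂ) = ((ε ^ (q - p) : ℝ) : ℂ) := by
          intro p
          rw [sub_eq_add_neg, Real.rpow_add hε', Complex.ofReal_mul]
        rw [Finset.sum_insert hqT, mul_add, mul_add, Finset.mul_sum]
        have e1 : ((ε ^ q : ℝ) : ℂ) * (d q * ((ε ^ (-q) : ℝ) : ℂ)) = d q := by
          rw [mul_left_comm, key q, sub_self, Real.rpow_zero]; simp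
        rw [e1, add_assoc]
        congr 2
        · refine Finset.sum_congr rfl fun p _ => ?_
          rw [mul_left_comm, key p]
        · ring
    refine ih L hT (h.congr fun ε => ?_)
    rw [Finset.sum_insert hqT, hd, zero_mul, zero_add]

/-- The finite part is uniquely determined. -/
theorem HasFinitePartReal.unique {φ : ℝ → ℂ} {a : ℝ} {L M : ℂ}
    (hL : HasFinitePartReal φ a L) (hM : HasFinitePartReal φ a M) : L = M := by
  obtain ⟨-, S, d, b, hS, h1⟩ := hL
  obtain ⟨-, T, e, c, hT, h2⟩ := hM
  refine sub_eq_zero.1 (diverging_part_limit (S ∪ T)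
    (fun p => (if p ∈ T then e p else 0) - (if p ∈ S then d p else 0)) (c - b) _
    (fun p hp => (Finset.mem_union.1 hp).elim (hS p) (hT p)) ((h1.sub h2).congr fun ε => ?_))
  have hs : ∑ p ∈ S ∪ T, (if p ∈ S then d p else 0) * ((ε ^ (-p) : ℝ) : ℂ) =
      ∑ p ∈ S, d p * ((ε ^ (-p) : ℝ) : ℂ) := by
    rw [← Finset.sum_subset (Finset.subset_union_left : S ⊆ S ∪ T)]
    · exact Finset.sum_congr rfl fun p hp => by rw [if_pos hp]
    · intro p _ hp
      rw [if_neg hp, zero_mul]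
  have ht : ∑ p ∈ S ∪ T, (if p ∈ T then e p else 0) * ((ε ^ (-p) : ℝ) : ℂ) =
      ∑ p ∈ T, e p * ((ε ^ (-p) : ℝ) : ℂ) := by
    rw [← Finset.sum_subset (Finset.subset_union_right : T ⊆ S ∪ T)]
    · exact Finset.sum_congr rfl fun p hp => by rw [if_pos hp]
    · intro p _ hp
      rw [if_neg hp, zero_mul]
  simp only [sub_mul, Finset.sum_sub_distrib]
  rw [hs, ht]
  ring

/-- The finite part is uniquely determined, also for an infinite upper limit. -/
theorem HasFinitePart.unique {φ : ℝ → ℂ} {a : WithTop ℝ} {L M : ℂ}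
    (hL : HasFinitePart φ a L) (hM : HasFinitePart φ a M) : L = M := by
  induction a with
  | coe a => exact HasFinitePartReal.unique hL hM
  | top =>
    obtain ⟨F, hF, hF'⟩ := hL
    obtain ⟨G, hG, hG'⟩ := hM
    refine tendsto_nhds_unique (hF'.congr' ?_) hG'
    filter_upwards [eventually_gt_atTop 0] with A hA
    exact (hF A hA).unique (hG A hA)

end

/-! Expanding `1/(ω - x)` formally as `-∑ ω^k / x^(k+1)` and integrating term by term over the
folded interval gives divergent integrals. Their finite parts are the coefficients of the series,
and the formal computation misses exactly the term `-iπ f(ω) ω^(-ν)`. The missing term is found by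
removing the value at `ω`: write `f(x) = f(ω) + (x - ω) q(x)`, with `q` as regular as `f`.

For the constant `f(ω)` everything is explicit. Geometric series for `x < |ω|` and for `x > |ω|`
reduce the integrals of `x^(-ν)/(ω ∓ x)` over the half-line to the partial fraction series of `π cot
πν` and `π / sin πν`. With the phase `e^(-iπν)` on the negative axis these combine to `-iπ`; this is
`hasPVReal_negPow`.

For the rest, the kernel cancels and leaves the ordinary integral `-∫ q x^(-ν)`. On the coefficient
side, the factor `x - ω` turns the `k`-th finite part into `d_(k-1) - ω d_k`, where `d_k` are the
finite parts belonging to `q`. The series therefore telescopes to the same integral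
(`tsum_pow_mul_folded`). Convergence needs a bound `M r^(-k)` on the finite parts for some `r >
|ω|`: subtract the Taylor polynomial of degree `k` and estimate both pieces
(`exists_hasFinitePartReal_near_zero`).

For `a = ∞` the formula on `[-A, A]` is passed to the limit. Existence of the principal value at two
opposite points gives convergence at infinity of the folded integrals with `k = 0, 1`. Abel's test
(`abel_test`) then gives convergence for every `k`, with geometric bounds uniform in `A`, so
dominated convergence applies to the series.

The formulas for even `f` and for `f = x^m g` are the same expansion, re-indexed by parity and by
the shift `m`. -/

noncomputable section

/-! ### Abel limits of the cotangent and cosecant partial fraction series -/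

section CotangentSeries

/-- For `s ≤ t` the difference `y^s/s - y^t/t` is nonnegative on `(0, 1]` and largest at `y = 1`;
Bernoulli's inequality with exponent `t/s` gives this without derivatives. It serves as a majorant
uniform in `y`: at `y = 1` each half of the series diverges, and only the difference is summable. -/
theorem abs_rpow_div_sub_rpow_div_le {y s t : ℝ} (hy : 0 < y) (hy1 : y ≤ 1) (hs : 0 < s)
    (ht : 0 < t) : |y ^ s / s - y ^ t / t| ≤ |1 / s - 1 / t| := by
  have key : ∀ s t : ℝ, 0 < s → s ≤ t → |y ^ s / s - y ^ t / t| ≤ |1 / s - 1 / t| := by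
    intro s t hs hst
    have ht : 0 < t := hs.trans_le hst
    have h1 : y ^ t ≤ y ^ s := Real.rpow_le_rpow_of_exponent_ge hy hy1 hst
    have h2 : y ^ t / t ≤ y ^ s / s :=
      div_le_div₀ (Real.rpow_nonneg hy.le _) h1 hs hst
    have h3 : 1 + t / s * (y ^ s - 1) ≤ y ^ t := by
      have := one_add_mul_self_le_rpow_one_add (s := y ^ s - 1) (p := t / s)
        (by linarith [Real.rpow_nonneg hy.le s]) ((one_le_div hs).2 hst)
      rwa [add_sub_cancel, ← Real.rpow_mul hy.le, mul_div_cancel₀ _ hs.ne'] at this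
    have h4 : y ^ s / s - y ^ t / t ≤ 1 / s - 1 / t := by
      have h5 := div_le_div_of_nonneg_right h3 ht.le
      have h6 : (1 + t / s * (y ^ s - 1)) / t = 1 / t + y ^ s / s - 1 / s := by
        field_simp
        ring
      linarith
    rw [abs_of_nonneg (by linarith)]
    exact h4.trans (le_abs_self _)
  rcases le_total s t with h | h
  · exact key s t hs h
  · rw [abs_sub_comm, abs_sub_comm (1 / s)]
    exact key t s ht h

theorem summable_abs_cot_terms {ν : ℝ} (h0 : 0 < ν) (h1 : ν < 1) :
    Summable fun n : ℕ => |1 / ((n : ℝ) + 1 - ν) - 1 / ((n : ℝ) + ν)| := by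
  have hs : Summable fun n : ℕ => (1 / (ν * (1 - ν))) * (1 / ((n : ℝ) + 1) ^ 2) := by
    refine Summable.mul_left _ ?_
    have := (summable_nat_add_iff 1).2 (Real.summable_one_div_nat_pow.2 (one_lt_two))
    simpa using this
  refine Summable.of_nonneg_of_le (fun _ => abs_nonneg _) (fun n => ?_) hs
  have hn : (0 : ℝ) ≤ n := n.cast_nonneg
  have hν : 0 < 1 - ν := by linarith
  have p1 : 0 < (n : ℝ) + 1 - ν := by linarith
  have p2 : 0 < (n : ℝ) + ν := by linarith
  rw [div_sub_div _ _ p1.ne' p2.ne', abs_div, abs_of_pos (mul_pos p1 p2), one_div_mul_one_div]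
  have hq : (1 - ν) * ((n : ℝ) + 1) ≤ n + 1 - ν := by nlinarith
  have hq' : ν * ((n : ℝ) + 1) ≤ n + ν := by nlinarith
  refine div_le_div₀ zero_le_one ?_ (by positivity) ?_
  · rw [abs_le]; constructor <;> linarith
  · calc _ = ((1 - ν) * ((n : ℝ) + 1)) * (ν * ((n : ℝ) + 1)) := by ring
      _ ≤ _ := mul_le_mul hq hq' (by positivity) p1.le

/-- This is Euler's expansion `π cot πν - 1/ν = ∑ (1/(ν - n - 1) + 1/(ν + n + 1))` with the terms
paired differently. -/
theorem hasSum_cot_terms {ν : ℝ} (h0 : 0 < ν) (h1 : ν < 1) :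
    HasSum (fun n : ℕ => 1 / ((n : ℝ) + 1 - ν) - 1 / ((n : ℝ) + ν))
      (-(Real.pi * (Real.cos (Real.pi * ν) / Real.sin (Real.pi * ν)))) := by
  have hsum := (summable_abs_cot_terms h0 h1).of_abs
  have hint : (ν : ℂ) ∈ Complex.integerComplement := by
    rintro ⟨m, hm⟩
    have hm' : (m : ℝ) = ν := by exact_mod_cast hm
    have a1 : (0 : ℝ) < (m : ℤ) := by rw [hm']; exact h0
    have a2 : ((m : ℤ) : ℝ) < 1 := by rw [hm']; exact h1
    have a1' : 0 < m := by exact_mod_cast a1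
    have a2' : m < 1 := by exact_mod_cast a2
    omega
  have hcot := tendsto_logDeriv_euler_cot_sub hint
  have e : (Real.pi * Complex.cot (Real.pi * ν) - 1 / ν : ℂ) =
      ((Real.pi * (Real.cos (Real.pi * ν) / Real.sin (Real.pi * ν)) - 1 / ν : ℝ) : ℂ) := by
    rw [Complex.cot_eq_cos_div_sin]; push_cast; rfl
  rw [e] at hcot
  have hre := (Complex.continuous_re.tendsto _).comp hcot
  rw [Complex.ofReal_re] at hre
  have hT : Tendsto (fun N : ℕ => ∑ n ∈ Finset.range (N + 1),
      (1 / ((n : ℝ) + 1 - ν) - 1 / ((n : ℝ) + ν))) atTop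
      (𝓝 (-(Real.pi * (Real.cos (Real.pi * ν) / Real.sin (Real.pi * ν))))) := by
    have hz : Tendsto (fun N : ℕ => 1 / ((N : ℝ) + 1 - ν)) atTop (𝓝 0) := by
      refine Tendsto.div_atTop tendsto_const_nhds ?_
      have := tendsto_natCast_atTop_atTop (R := ℝ)
      exact (tendsto_atTop_add_const_right _ (1 - ν) this).congr fun N => by ring
    have h2 := (hz.sub hre).sub_const (1 / ν)
    refine (h2.congr fun N => ?_).trans_eq (by ring_nf)
    -- Pairing `1/(n+1-ν)` with `1/(n+ν)` instead of `1/(n+1+ν)` shifts one family by an index. The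
    -- price is the boundary terms `1/ν` and `1/(N+1-ν)`, the second of which tends to `0`.
    have hid : ∀ N : ℕ, ∑ n ∈ Finset.range (N + 1),
        (1 / ((n : ℝ) + 1 - ν) - 1 / ((n : ℝ) + ν)) = 1 / ((N : ℝ) + 1 - ν) -
        ∑ n ∈ Finset.range N, (1 / (ν - ((n : ℝ) + 1)) + 1 / (ν + ((n : ℝ) + 1))) - 1 / ν := by
      intro N
      induction N with
      | zero => simp
      | succ N ih =>
        rw [Finset.sum_range_succ, ih, Finset.sum_range_succ]
        have : (1 : ℝ) / (ν - ((N : ℝ) + 1)) = -(1 / ((N : ℝ) + 1 - ν)) := by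
          rw [← one_div_neg_eq_neg_one_div]; ring_nf
        rw [this]
        push_cast
        ring
    rw [hid]
    congr 2
    simp only [Function.comp_apply, cotTerm, Complex.re_sum]
    refine Finset.sum_congr rfl fun n _ => ?_
    rw [← Complex.ofReal_re (1 / (ν - ((n : ℝ) + 1)) + 1 / (ν + ((n : ℝ) + 1)))]
    push_cast
    rfl
  have := hsum.hasSum.tendsto_sum_nat.comp (tendsto_add_atTop_nat 1)
  rw [← tendsto_nhds_unique this hT]
  exact hsum.hasSum

theorem tendsto_cot_series {ν : ℝ} (h0 : 0 < ν) (h1 : ν < 1) :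
    Tendsto (fun y : ℝ => ∑' n : ℕ,
      (y ^ ((n : ℝ) + 1 - ν) / ((n : ℝ) + 1 - ν) - y ^ ((n : ℝ) + ν) / ((n : ℝ) + ν)))
      (𝓝[<] 1) (𝓝 (-(Real.pi * (Real.cos (Real.pi * ν) / Real.sin (Real.pi * ν))))) := by
  rw [← (hasSum_cot_terms h0 h1).tsum_eq]
  refine tendsto_tsum_of_dominated_convergence (summable_abs_cot_terms h0 h1) (fun n => ?_) ?_
  · have hc : ∀ s : ℝ, Tendsto (fun y : ℝ => y ^ s / s) (𝓝[<] 1) (𝓝 (1 / s)) := by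
      intro s
      have := ((Real.continuousAt_rpow_const 1 s (Or.inl one_ne_zero)).tendsto).mono_left
        (nhdsWithin_le_nhds (s := Set.Iio 1))
      rw [Real.one_rpow] at this
      exact this.div_const s
    exact (hc _).sub (hc _)
  · filter_upwards [Ioo_mem_nhdsLT (zero_lt_one' ℝ)] with y hy n
    have hn : (0 : ℝ) ≤ n := n.cast_nonneg
    exact abs_rpow_div_sub_rpow_div_le hy.1 hy.2.le (by linarith) (by linarith)

theorem summable_rpow_nat_add_div {y c : ℝ} (hy : 0 < y) (hy1 : y < 1) (hc : 0 < c) :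
    Summable fun n : ℕ => y ^ ((n : ℝ) + c) / ((n : ℝ) + c) := by
  have hs : Summable fun n : ℕ => y ^ n * (y ^ c / c) :=
    (summable_geometric_of_lt_one hy.le hy1).mul_right _
  refine Summable.of_nonneg_of_le (fun n => by positivity) (fun n => ?_) hs
  rw [Real.rpow_add hy, Real.rpow_natCast, mul_div_assoc]
  have hn : (0 : ℝ) ≤ n := n.cast_nonneg
  gcongr
  linarith

theorem tsum_eq_tsum_even_add_odd {E : Type*} [NormedAddCommGroup E] [CompleteSpace E]
    {u : ℕ → E} (hu : Summable u) : ∑' n, u n = ∑' j : ℕ, (u (2 * j) + u (2 * j + 1)) := by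
  have he : Summable fun k => u (2 * k) := hu.comp_injective fun a b h => by simpa using h
  have ho : Summable fun k => u (2 * k + 1) := hu.comp_injective fun a b h => by simpa using h
  rw [← tsum_even_add_odd he ho, Summable.tsum_add he ho]

/-- Adding the cotangent series for `ν` to the alternating one leaves twice the first power for even
`n` and minus twice the second power for odd `n`. That is the cotangent series for `(1+ν)/2` in the
variable `y²`. In the limit, `tan(πν/2) + cot(πν) = 1/sin(πν)`. -/
theorem tendsto_csc_series {ν : ℝ} (h0 : 0 < ν) (h1 : ν < 1) :
    Tendsto (fun y : ℝ => ∑' n : ℕ, (-1 : ℝ) ^ n *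
      (y ^ ((n : ℝ) + 1 - ν) / ((n : ℝ) + 1 - ν) + y ^ ((n : ℝ) + ν) / ((n : ℝ) + ν)))
      (𝓝[<] 1) (𝓝 (Real.pi / Real.sin (Real.pi * ν))) := by
  have hA := tendsto_cot_series h0 h1
  have hsq : Tendsto (fun y : ℝ => y ^ 2) (𝓝[<] 1) (𝓝[<] 1) := by
    refine tendsto_nhdsWithin_iff.2 ⟨?_, ?_⟩
    · have : Tendsto (fun y : ℝ => y ^ 2) (𝓝 1) (𝓝 (1 ^ 2)) := (continuous_pow 2).tendsto 1
      rw [one_pow] at this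
      exact this.mono_left nhdsWithin_le_nhds
    · filter_upwards [Ioo_mem_nhdsLT (zero_lt_one' ℝ)] with y hy
      exact pow_lt_one₀ hy.1.le hy.2 two_ne_zero
  have hB := (tendsto_cot_series (ν := (1 + ν) / 2) (by linarith) (by linarith)).comp hsq
  refine ((hB.sub hA).congr' ?_).trans_eq ?_
  · filter_upwards [Ioo_mem_nhdsLT (zero_lt_one' ℝ)] with y hy
    have hP : Summable fun n : ℕ => y ^ ((n : ℝ) + 1 - ν) / ((n : ℝ) + 1 - ν) := by
      refine (summable_rpow_nat_add_div (c := 1 - ν) hy.1 hy.2 (by linarith)).congr fun n => ?_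
      rw [add_sub_assoc]
    have hQ := summable_rpow_nat_add_div hy.1 hy.2 h0
    have hsg : ∀ u : ℕ → ℝ, Summable u → Summable fun n => (-1 : ℝ) ^ n * u n := by
      intro u hu
      refine Summable.of_abs (hu.abs.congr fun n => ?_)
      rw [abs_mul, abs_pow, abs_neg, abs_one, one_pow, one_mul]
    have hM := hsg _ (hP.add hQ)
    rw [Function.comp_apply, sub_eq_iff_eq_add, ← hM.tsum_add (hP.sub hQ),
      tsum_eq_tsum_even_add_odd (hM.add (hP.sub hQ))]
    refine tsum_congr fun j => ?_
    have hj : (0 : ℝ) ≤ j := j.cast_nonneg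
    simp only [pow_add, pow_mul, neg_one_sq, one_pow, pow_one]
    have e1 : (y ^ 2) ^ ((j : ℝ) + 1 - (1 + ν) / 2) = y ^ (((2 * j : ℕ) : ℝ) + 1 - ν) := by
      rw [← Real.rpow_natCast y 2, ← Real.rpow_mul hy.1.le]; congr 1; push_cast; ring
    have e2 : (y ^ 2) ^ ((j : ℝ) + (1 + ν) / 2) = y ^ (((2 * j + 1 : ℕ) : ℝ) + ν) := by
      rw [← Real.rpow_natCast y 2, ← Real.rpow_mul hy.1.le]; congr 1; push_cast; ring
    rw [e1, e2]
    have q1 : (j : ℝ) + 1 - (1 + ν) / 2 = (((2 * j : ℕ) : ℝ) + 1 - ν) / 2 := by push_cast; ring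
    have q2 : (j : ℝ) + (1 + ν) / 2 = (((2 * j + 1 : ℕ) : ℝ) + ν) / 2 := by push_cast; ring
    rw [q1, q2]
    simp only [div_div_eq_mul_div]
    ring
  · have hx : Real.pi * ((1 + ν) / 2) = Real.pi * ν / 2 + Real.pi / 2 := by ring
    have hd : Real.pi * ν = 2 * (Real.pi * ν / 2) := by ring
    have s0 : 0 < Real.sin (Real.pi * ν / 2) := by
      apply Real.sin_pos_of_pos_of_lt_pi <;> nlinarith [Real.pi_pos]
    have c0 : 0 < Real.cos (Real.pi * ν / 2) := by
      apply Real.cos_pos_of_mem_Ioo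
      constructor <;> nlinarith [Real.pi_pos]
    rw [hx, Real.cos_add_pi_div_two, Real.sin_add_pi_div_two, hd, Real.cos_two_mul,
      Real.sin_two_mul, ← hd]
    congr 1
    field_simp
    rw [Real.sin_sq]
    ring

end CotangentSeries

/-! ### Integrals of `x^(-ν)/(ω ∓ x)` over the positive half-line -/

section CauchyKernel

theorem sub_mul_ne_zero_of_ne {σ ω x : ℝ} (hσ : |σ| = 1) (hω : 0 < ω) (hx : 0 < x)
    (h : x ≠ ω) : ω - σ * x ≠ 0 := by
  intro h0
  have h1 : |σ * x| = |ω| := by rw [show σ * x = ω by linarith]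
  rw [abs_mul, hσ, one_mul, abs_of_pos hx, abs_of_pos hω] at h1
  exact h h1

/-- Integrate the geometric series in `σx/ω`, whose ratio is at most `y < 1` in absolute value on
the interval. The sign `σ = ±1` treats the singular kernel and the regular one together. -/
theorem hasSum_integral_rpow_div_sub_inner {ν σ ω y : ℝ} (hν : ν < 1) (hσ : |σ| = 1)
    (hω : 0 < ω) (hy : 0 < y) (hy1 : y < 1) :
    HasSum (fun n : ℕ => σ ^ n * ω ^ (-ν) * (y ^ ((n : ℝ) + 1 - ν) / ((n : ℝ) + 1 - ν)))
      (∫ x in (0 : ℝ)..ω * y, x ^ (-ν) / (ω - σ * x)) := by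
  have hωy : 0 < ω * y := mul_pos hω hy
  have h := intervalIntegral.hasSum_integral_of_dominated_convergence (μ := volume)
    (a := 0) (b := ω * y)
    (F := fun (n : ℕ) (x : ℝ) => x ^ (-ν) * (σ ^ n * x ^ n / ω ^ (n + 1)))
    (f := fun x : ℝ => x ^ (-ν) / (ω - σ * x))
    (fun (n : ℕ) (x : ℝ) => x ^ (-ν) * (y ^ n / ω)) (fun n => ?_) (fun n => ?_) ?_ ?_ ?_
  · refine h.congr_fun fun n => ?_
    have hn : (0 : ℝ) ≤ n := n.cast_nonneg
    have e : ∫ x in (0 : ℝ)..ω * y, x ^ (-ν) * (σ ^ n * x ^ n / ω ^ (n + 1)) =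
        ∫ x in (0 : ℝ)..ω * y, σ ^ n / ω ^ (n + 1) * x ^ ((n : ℝ) - ν) := by
      refine intervalIntegral.integral_congr_Ioo_of_le hωy.le fun x hx => ?_
      rw [sub_eq_add_neg, Real.rpow_add hx.1, Real.rpow_natCast]
      ring
    rw [e, intervalIntegral.integral_const_mul, integral_rpow (Or.inl (by linarith)),
      Real.zero_rpow (by linarith), sub_zero, Real.mul_rpow hω.le hy.le,
      show (n : ℝ) - ν + 1 = (n + 1 : ℕ) + -ν by push_cast; ring, Real.rpow_add hω,
      Real.rpow_natCast, show ((n + 1 : ℕ) : ℝ) + -ν = (n : ℝ) + 1 - ν by push_cast; ring]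
    have : ω ^ (n + 1) ≠ 0 := (pow_pos hω _).ne'
    field_simp
  · refine Measurable.aestronglyMeasurable ?_
    fun_prop
  · refine Eventually.of_forall fun x hx => ?_
    rw [Set.uIoc_of_le hωy.le] at hx
    rw [Real.norm_eq_abs, abs_mul, abs_of_nonneg (Real.rpow_nonneg hx.1.le _), abs_div, abs_mul,
      abs_pow, hσ, one_pow, one_mul, abs_of_nonneg (pow_nonneg hx.1.le _),
      abs_of_pos (pow_pos hω _), pow_succ, ← div_div, ← div_pow]
    have : x / ω ≤ y := by rw [div_le_iff₀ hω]; linarith [hx.2]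
    have h0 := hx.1
    gcongr
  · refine Eventually.of_forall fun x hx => ?_
    exact ((summable_geometric_of_lt_one hy.le hy1).div_const ω).mul_left _
  · simp only [tsum_mul_left]
    exact (intervalIntegral.intervalIntegrable_rpow' (by linarith)).mul_const _
  · refine Eventually.of_forall fun x hx => ?_
    rw [Set.uIoc_of_le hωy.le] at hx
    have hxω : x < ω := by nlinarith [hx.2]
    have hlt : |σ * x / ω| < 1 := by
      rwa [abs_div, abs_mul, hσ, one_mul, abs_of_pos hx.1, abs_of_pos hω, div_lt_one hω]
    have hne := sub_mul_ne_zero_of_ne hσ hω hx.1 hxω.ne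
    have := ((hasSum_geometric_of_abs_lt_one hlt).div_const ω).mul_left (x ^ (-ν))
    have e : x ^ (-ν) * ((1 - σ * x / ω)⁻¹ / ω) = x ^ (-ν) / (ω - σ * x) := by
      rw [one_sub_div hω.ne', inv_div]
      field_simp
    rw [e] at this
    refine this.congr_fun fun n => ?_
    rw [pow_succ, ← div_div, div_pow, mul_pow]

/-- Since `σ² = 1`, the kernel equals `-σ/(x - σω)`, which is expanded in powers of `σω/x`; beyond
`ω/y` the ratio is again at most `y` in absolute value. -/
theorem hasSum_integral_rpow_div_sub_outer {ν σ ω y A : ℝ} (hν0 : 0 < ν) (hν : ν < 1)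
    (hσ : |σ| = 1) (hω : 0 < ω) (hy : 0 < y) (hy1 : y < 1) (hA : ω / y ≤ A) :
    HasSum (fun n : ℕ => σ * σ ^ n * (ω ^ n * (A ^ (-((n : ℝ) + ν)) / ((n : ℝ) + ν)) -
        ω ^ (-ν) * (y ^ ((n : ℝ) + ν) / ((n : ℝ) + ν))))
      (∫ x in (ω / y)..A, x ^ (-ν) / (ω - σ * x)) := by
  have hωy : 0 < ω / y := div_pos hω hy
  have hA0 : 0 < A := hωy.trans_le hA
  have hω1 : ω < ω / y := by rw [lt_div_iff₀ hy]; nlinarith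
  have hσ2 : σ * σ = 1 := by rw [← sq, ← sq_abs, hσ, one_pow]
  have h := intervalIntegral.hasSum_integral_of_dominated_convergence (μ := volume)
    (a := ω / y) (b := A)
    (F := fun (n : ℕ) (x : ℝ) => x ^ (-ν) * (-(σ * (σ ^ n * ω ^ n / x ^ (n + 1)))))
    (f := fun x : ℝ => x ^ (-ν) / (ω - σ * x))
    (fun (n : ℕ) (x : ℝ) => x ^ (-ν) * (y ^ n * (y / ω))) (fun n => ?_) (fun n => ?_) ?_ ?_ ?_
  · refine h.congr_fun fun n => ?_
    have hn : (0 : ℝ) ≤ n := n.cast_nonneg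
    have e : ∫ x in (ω / y)..A, x ^ (-ν) * (-(σ * (σ ^ n * ω ^ n / x ^ (n + 1)))) =
        ∫ x in (ω / y)..A, -(σ * σ ^ n * ω ^ n) * x ^ (-((n : ℝ) + ν) - 1) := by
      refine intervalIntegral.integral_congr_Ioo_of_le hA fun x hx => ?_
      have hx0 : 0 < x := hωy.trans hx.1
      rw [show -((n : ℝ) + ν) - 1 = -ν - (n + 1 : ℕ) by push_cast; ring, Real.rpow_sub hx0,
        Real.rpow_natCast]
      ring
    rw [e, intervalIntegral.integral_const_mul, integral_rpow
      (Or.inr ⟨by linarith, Set.notMem_uIcc_of_lt hωy hA0⟩), sub_add_cancel,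
      Real.div_rpow hω.le hy.le, Real.rpow_neg hy.le, div_inv_eq_mul,
      show ω ^ (-((n : ℝ) + ν)) = ω ^ (-ν) / ω ^ n by
        rw [← Real.rpow_natCast, ← Real.rpow_sub hω]; ring_nf]
    have : ω ^ n ≠ 0 := (pow_pos hω _).ne'
    have : (n : ℝ) + ν ≠ 0 := by linarith
    field_simp
  · refine Measurable.aestronglyMeasurable ?_
    fun_prop
  · refine Eventually.of_forall fun x hx => ?_
    rw [Set.uIoc_of_le hA] at hx
    have hx0 : 0 < x := hωy.trans hx.1
    have h1 : ω / x ≤ y := by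
      rw [div_le_iff₀ hx0]; have := hx.1; rw [div_lt_iff₀ hy] at this; linarith
    have h2 : 1 / x ≤ y / ω := by
      rw [div_le_div_iff₀ hx0 hω]; have := hx.1; rw [div_lt_iff₀ hy] at this; linarith
    rw [Real.norm_eq_abs, abs_mul, abs_of_nonneg (Real.rpow_nonneg hx0.le _), abs_neg, abs_mul,
      abs_div, abs_mul, abs_pow, hσ, one_pow, one_mul, one_mul, abs_of_nonneg (pow_nonneg hω.le _),
      abs_of_pos (pow_pos hx0 _), pow_succ, ← div_div, ← div_pow, div_eq_mul_one_div _ x]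
    gcongr
  · refine Eventually.of_forall fun x hx => ?_
    exact ((summable_geometric_of_lt_one hy.le hy1).mul_right _).mul_left _
  · simp only [tsum_mul_left]
    exact (intervalIntegral.intervalIntegrable_rpow' (by linarith)).mul_const _
  · refine Eventually.of_forall fun x hx => ?_
    rw [Set.uIoc_of_le hA] at hx
    have hx0 : 0 < x := hωy.trans hx.1
    have hxω : ω < x := hω1.trans hx.1
    have hlt : |σ * ω / x| < 1 := by
      rwa [abs_div, abs_mul, hσ, one_mul, abs_of_pos hx0, abs_of_pos hω, div_lt_one hx0]
    have hne := sub_mul_ne_zero_of_ne hσ hω hx0 hxω.ne'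
    have hne' : x - σ * ω ≠ 0 := by
      intro h0; apply hne; rw [show x = σ * ω by linarith, ← mul_assoc, hσ2]; ring
    have := (((hasSum_geometric_of_abs_lt_one hlt).div_const x).mul_left σ).neg.mul_left (x ^ (-ν))
    have e : x ^ (-ν) * -(σ * ((1 - σ * ω / x)⁻¹ / x)) = x ^ (-ν) / (ω - σ * x) := by
      rw [one_sub_div hx0.ne', inv_div, div_eq_mul_inv (x ^ (-ν))]
      congr 1
      field_simp
      linear_combination x * hσ2
    rw [e] at this
    refine this.congr_fun fun n => ?_
    rw [pow_succ x, ← div_div, div_pow, mul_pow]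

theorem summable_pow_mul_rpow_neg_div {ν σ ω A : ℝ} (hν : 0 < ν) (hσ : |σ| = 1) (hω : 0 ≤ ω)
    (hA : ω < A) :
    Summable fun n : ℕ => σ ^ n * (ω ^ n * (A ^ (-((n : ℝ) + ν)) / ((n : ℝ) + ν))) := by
  have hA0 : 0 < A := hω.trans_lt hA
  have hs : Summable fun n : ℕ => (ω / A) ^ n * (A ^ (-ν) / ν) :=
    (summable_geometric_of_lt_one (by positivity) ((div_lt_one hA0).2 hA)).mul_right _
  refine Summable.of_norm_bounded hs fun n => ?_
  have hn : (0 : ℝ) ≤ n := n.cast_nonneg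
  rw [Real.norm_eq_abs, abs_mul, abs_pow, hσ, one_pow, one_mul, abs_of_nonneg (by positivity),
    neg_add, Real.rpow_add hA0, Real.rpow_neg hA0.le, Real.rpow_natCast, div_pow,
    mul_div_assoc, ← mul_assoc, ← div_eq_mul_inv]
  gcongr
  linarith

/-- Excising `(ωy, ω/y)`, which is symmetric under `x ↦ ω²/x`, makes the inner endpoints contribute
only powers of `y`. These form the cotangent series for `σ = 1` and the cosecant series for `σ =
-1`; all dependence on `A` sits in the other series. -/
theorem integral_inner_add_outer {ν σ ω y A : ℝ} (hν0 : 0 < ν) (hν : ν < 1)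
    (hσ : |σ| = 1) (hω : 0 < ω) (hy : 0 < y) (hy1 : y < 1) (hA : ω / y ≤ A) :
    (∫ x in (0 : ℝ)..ω * y, x ^ (-ν) / (ω - σ * x)) +
      (∫ x in (ω / y)..A, x ^ (-ν) / (ω - σ * x)) =
    σ * (∑' n : ℕ, σ ^ n * (ω ^ n * (A ^ (-((n : ℝ) + ν)) / ((n : ℝ) + ν)))) +
    ω ^ (-ν) * ∑' n : ℕ, σ ^ n * (y ^ ((n : ℝ) + 1 - ν) / ((n : ℝ) + 1 - ν) -
      σ * (y ^ ((n : ℝ) + ν) / ((n : ℝ) + ν))) := by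
  have hω1 : ω < ω / y := by rw [lt_div_iff₀ hy]; nlinarith
  have h1 := (hasSum_integral_rpow_div_sub_inner hν hσ hω hy hy1).add
    (hasSum_integral_rpow_div_sub_outer hν0 hν hσ hω hy hy1 hA)
  have h2 := (summable_pow_mul_rpow_neg_div hν0 hσ hω.le (hω1.trans_le hA)).hasSum.mul_left σ
  have h3 := h1.sub h2
  rw [← sub_eq_iff_eq_add', ← h3.tsum_eq, ← tsum_mul_left]
  refine tsum_congr fun n => ?_
  ring

/-- With `y = 1 - δ/ω` the left cut is `ω - δ`, as a principal value requires, while the right cut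
`ω/y` differs from `ω + δ` by `δ²/(ω - δ)`. The integrand there is at most `ω^(-ν)/δ` in absolute
value, so the two ways of excising agree in the limit. -/
theorem tendsto_pv_integral_rpow_div_sub {ν ω A : ℝ} (hν0 : 0 < ν) (hν : ν < 1) (hω : 0 < ω)
    (hA : ω < A) :
    Tendsto (fun δ : ℝ => (∫ x in (0 : ℝ)..(ω - δ), x ^ (-ν) / (ω - x)) +
        ∫ x in (ω + δ)..A, x ^ (-ν) / (ω - x)) (𝓝[>] 0)
      (𝓝 ((∑' n : ℕ, ω ^ n * (A ^ (-((n : ℝ) + ν)) / ((n : ℝ) + ν))) -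
        Real.pi * (Real.cos (Real.pi * ν) / Real.sin (Real.pi * ν)) * ω ^ (-ν))) := by
  have hyt : Tendsto (fun δ : ℝ => 1 - δ / ω) (𝓝[>] 0) (𝓝[<] 1) := by
    refine tendsto_nhdsWithin_iff.2 ⟨?_, ?_⟩
    · have : Tendsto (fun δ : ℝ => 1 - δ / ω) (𝓝 0) (𝓝 (1 - 0 / ω)) :=
        Continuous.tendsto (by fun_prop) 0
      rw [zero_div, sub_zero] at this
      exact this.mono_left nhdsWithin_le_nhds
    · filter_upwards [self_mem_nhdsWithin] with δ hδ
      have : 0 < δ / ω := div_pos hδ hω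
      simpa using this
  have hmain := ((tendsto_cot_series hν0 hν).comp hyt).const_mul (ω ^ (-ν))
  have hsmall : Tendsto (fun δ : ℝ => ∫ x in (ω + δ)..(ω / (1 - δ / ω)), x ^ (-ν) / (ω - x))
      (𝓝[>] 0) (𝓝 0) := by
    have hb : Tendsto (fun δ : ℝ => ω ^ (-ν) * (δ / (ω * (1 - δ / ω)))) (𝓝[>] 0) (𝓝 0) := by
      have : ContinuousAt (fun δ : ℝ => ω ^ (-ν) * (δ / (ω * (1 - δ / ω)))) 0 := by
        refine continuousAt_const.mul (continuousAt_id.div (by fun_prop) ?_)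
        simp [hω.ne']
      have h2 := this.tendsto
      simp only [zero_div, mul_zero] at h2
      exact h2.mono_left nhdsWithin_le_nhds
    refine squeeze_zero_norm' ?_ hb
    filter_upwards [Ioo_mem_nhdsGT hω] with δ hδ
    have hδω : δ / ω < 1 := (div_lt_one hω).2 hδ.2
    have hden : 0 < 1 - δ / ω := by linarith
    have hgap : ω / (1 - δ / ω) - (ω + δ) = δ ^ 2 / (ω * (1 - δ / ω)) := by
      have : ω - δ ≠ 0 := by linarith [hδ.2]
      field_simp
      ring
    have hle : ω + δ ≤ ω / (1 - δ / ω) := by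
      have : 0 ≤ δ ^ 2 / (ω * (1 - δ / ω)) := by positivity
      linarith
    have := intervalIntegral.norm_integral_le_of_norm_le_const (a := ω + δ)
      (b := ω / (1 - δ / ω)) (f := fun x => x ^ (-ν) / (ω - x)) (C := ω ^ (-ν) / δ) ?_
    · refine this.trans_eq ?_
      rw [abs_of_nonneg (by linarith), hgap]
      have := hδ.1.ne'
      field_simp
    · intro x hx
      rw [Set.uIoc_of_le hle] at hx
      have hx0 : ω + δ < x := hx.1
      have hδ0 := hδ.1
      rw [Real.norm_eq_abs, abs_div, abs_of_nonneg (Real.rpow_nonneg (by linarith) _),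
        abs_of_neg (by linarith)]
      refine div_le_div₀ (by positivity) ?_ hδ0 (by linarith)
      exact Real.rpow_le_rpow_of_nonpos hω (by linarith) (by linarith)
  have hev : ∀ᶠ δ : ℝ in 𝓝[>] 0, ω / (1 - δ / ω) < A := by
    have : ContinuousAt (fun δ : ℝ => ω / (1 - δ / ω)) 0 := by
      refine continuousAt_const.div (by fun_prop) ?_
      simp
    refine nhdsWithin_le_nhds (this.eventually_lt continuousAt_const ?_)
    simpa using hA
  refine (((hmain.const_add (∑' n : ℕ, ω ^ n * (A ^ (-((n : ℝ) + ν)) / ((n : ℝ) + ν)))).add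
    hsmall).congr' ?_).trans_eq (by congr 1; ring)
  filter_upwards [Ioo_mem_nhdsGT hω, hev] with δ hδ hδA
  have hδ0 := hδ.1
  have hδω : δ / ω < 1 := (div_lt_one hω).2 hδ.2
  have hδω0 : 0 < δ / ω := div_pos hδ.1 hω
  have hden : 0 < 1 - δ / ω := by linarith
  have hgt : ω < ω / (1 - δ / ω) := by rw [lt_div_iff₀ hden]; nlinarith
  have key := integral_inner_add_outer (σ := 1) hν0 hν abs_one hω hden (by linarith) hδA.le
  have hmul : ω * (1 - δ / ω) = ω - δ := by field_simp
  simp only [one_mul, one_pow, hmul] at key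
  have hint : ∀ u v : ℝ, ω < u → ω < v →
      IntervalIntegrable (fun x : ℝ => x ^ (-ν) / (ω - x)) volume u v := by
    intro u v hu hv
    refine ContinuousOn.intervalIntegrable fun x hx => ContinuousAt.continuousWithinAt ?_
    have hxω : ω < x := (lt_min hu hv).trans_le hx.1
    exact (Real.continuousAt_rpow_const _ _ (Or.inl (by linarith))).div (by fun_prop)
      (by linarith)
  rw [← intervalIntegral.integral_add_adjacent_intervals
    (hint (ω + δ) (ω / (1 - δ / ω)) (by linarith) hgt) (hint (ω / (1 - δ / ω)) A hgt hA)]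
  simp only [Function.comp_apply]
  linarith

theorem intervalIntegrable_rpow_div_add {ν ω A : ℝ} (hν : ν < 1) (hω : 0 < ω) (hA : 0 ≤ A) :
    IntervalIntegrable (fun x : ℝ => x ^ (-ν) / (ω + x)) volume 0 A := by
  have h1 : IntervalIntegrable (fun x : ℝ => x ^ (-ν)) volume 0 A :=
    intervalIntegral.intervalIntegrable_rpow' (by linarith)
  simp only [div_eq_mul_inv]
  refine h1.mul_continuousOn fun x hx => ContinuousAt.continuousWithinAt ?_
  rw [Set.uIcc_of_le hA] at hx
  exact ContinuousAt.inv₀ (by fun_prop) (by linarith [hx.1])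

/-- The integrand is regular at `ω`, so the excised interval `(ωy, ω/y)` contributes nothing as `y →
1`. Cutting there only serves to have a convergent geometric series on each side. -/
theorem integral_rpow_div_add {ν ω A : ℝ} (hν0 : 0 < ν) (hν : ν < 1) (hω : 0 < ω)
    (hA : ω < A) :
    ∫ x in (0 : ℝ)..A, x ^ (-ν) / (ω + x) =
      Real.pi / Real.sin (Real.pi * ν) * ω ^ (-ν) -
        ∑' n : ℕ, (-ω) ^ n * (A ^ (-((n : ℝ) + ν)) / ((n : ℝ) + ν)) := by
  have hA0 : 0 < A := hω.trans hA
  have hmain := ((tendsto_csc_series hν0 hν).const_mul (ω ^ (-ν))).sub_const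
    (∑' n : ℕ, (-ω) ^ n * (A ^ (-((n : ℝ) + ν)) / ((n : ℝ) + ν)))
  have hint := intervalIntegrable_rpow_div_add hν hω hA0.le
  have hint' : ∀ u ∈ Set.Icc 0 A, ∀ v ∈ Set.Icc 0 A,
      IntervalIntegrable (fun x : ℝ => x ^ (-ν) / (ω + x)) volume u v := fun u hu v hv =>
    hint.mono_set (by
      rw [Set.uIcc_of_le hA0.le]
      exact (convex_Icc 0 A).ordConnected.uIcc_subset hu hv)
  have hev : ∀ᶠ y : ℝ in 𝓝[<] 1, ω / y < A := by
    have : ContinuousAt (fun y : ℝ => ω / y) 1 := continuousAt_const.div continuousAt_id one_ne_zero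
    refine nhdsWithin_le_nhds (this.eventually_lt continuousAt_const ?_)
    simpa using hA
  have hsmall : Tendsto (fun y : ℝ => ∫ x in (ω * y)..(ω / y), x ^ (-ν) / (ω + x))
      (𝓝[<] 1) (𝓝 0) := by
    have hb : Tendsto (fun y : ℝ => (ω * (1 / 2)) ^ (-ν) / ω * (ω / y - ω * y))
        (𝓝[<] 1) (𝓝 0) := by
      have : ContinuousAt (fun y : ℝ => (ω * (1 / 2)) ^ (-ν) / ω * (ω / y - ω * y)) 1 :=
        continuousAt_const.mul ((continuousAt_const.div continuousAt_id one_ne_zero).sub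
          (by fun_prop))
      have h2 := this.tendsto
      simp only [div_one, mul_one, sub_self, mul_zero] at h2
      exact h2.mono_left nhdsWithin_le_nhds
    refine squeeze_zero_norm' ?_ hb
    filter_upwards [Ioo_mem_nhdsLT (show (1 / 2 : ℝ) < 1 by norm_num)] with y hy
    have hy0 : 0 < y := by linarith [hy.1]
    have hle : ω * y ≤ ω / y := by
      rw [le_div_iff₀ hy0]; nlinarith [hy.2, mul_pos hω hy0]
    refine (intervalIntegral.norm_integral_le_of_norm_le_const (a := ω * y) (b := ω / y)
      (f := fun x => x ^ (-ν) / (ω + x)) (C := (ω * (1 / 2)) ^ (-ν) / ω) ?_).trans_eq ?_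
    · intro x hx
      rw [Set.uIoc_of_le hle] at hx
      have hx1 : ω * (1 / 2) < x := by nlinarith [hx.1, hy.1]
      have hx0 : 0 < x := by linarith
      rw [Real.norm_eq_abs, abs_of_nonneg (by positivity)]
      refine div_le_div₀ (by positivity) ?_ hω (by linarith)
      exact Real.rpow_le_rpow_of_nonpos (by positivity) hx1.le (by linarith)
    · rw [abs_of_nonneg (by linarith)]
  refine tendsto_nhds_unique (tendsto_const_nhds.congr' ?_) ((hmain.add hsmall).trans_eq ?_)
  · filter_upwards [hev, Ioo_mem_nhdsLT (zero_lt_one' ℝ)] with y hyA hy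
    have hy0 := hy.1
    have key := integral_inner_add_outer (σ := -1) hν0 hν (by simp) hω hy.1 hy.2 hyA.le
    have h1 : ω * y ∈ Set.Icc 0 A := ⟨by positivity, by nlinarith [hy.2]⟩
    have h2 : ω / y ∈ Set.Icc 0 A := ⟨by positivity, hyA.le⟩
    rw [← intervalIntegral.integral_add_adjacent_intervals (hint' 0 ⟨le_rfl, hA0.le⟩ _ h1)
      (hint' _ h1 A ⟨hA0.le, le_rfl⟩), ← intervalIntegral.integral_add_adjacent_intervals
      (hint' _ h1 _ h2) (hint' _ h2 A ⟨hA0.le, le_rfl⟩)]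
    simp only [neg_one_mul, sub_neg_eq_add, ← mul_assoc, ← mul_pow] at key ⊢
    linarith
  · rw [add_zero, mul_comm (ω ^ (-ν))]

end CauchyKernel

/-! ### The constant function: principal value of `x^(-ν)/(ω - x)` -/

section PrincipalValueOfNegPow

/-- The value of `x ^ (-ν) / |x| ^ (-ν)` for `x < 0`. -/
def branchPhase (ν : ℝ) : ℂ := Complex.exp (-(Complex.I * Real.pi * ν))

theorem branchPhase_eq (ν : ℝ) :
    branchPhase ν = Real.cos (Real.pi * ν) - Complex.I * Real.sin (Real.pi * ν) := by
  rw [branchPhase, show -(Complex.I * Real.pi * ν) = ((-(Real.pi * ν) : ℝ) : ℂ) * Complex.I by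
    push_cast; ring, Complex.exp_mul_I, ← Complex.ofReal_cos, ← Complex.ofReal_sin, Real.cos_neg,
    Real.sin_neg]
  push_cast
  ring

theorem norm_branchPhase (ν : ℝ) : ‖branchPhase ν‖ = 1 := by
  rw [branchPhase, show -(Complex.I * Real.pi * ν) = ((-(Real.pi * ν) : ℝ) : ℂ) * Complex.I by
    push_cast; ring, Complex.norm_exp_ofReal_mul_I]

theorem negPow_of_nonneg {ν x : ℝ} (hx : 0 ≤ x) : negPow ν x = ((x ^ (-ν) : ℝ) : ℂ) :=
  if_neg hx.not_gt

theorem negPow_neg {ν x : ℝ} (hx : 0 < x) :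
    negPow ν (-x) = branchPhase ν * ((x ^ (-ν) : ℝ) : ℂ) := by
  rw [negPow, if_pos (neg_lt_zero.2 hx), abs_neg, abs_of_pos hx, branchPhase]

theorem negPow_eq_cpow {ν : ℝ} (x : ℝ) : negPow ν x = (x : ℂ) ^ (-ν : ℂ) := by
  rcases le_or_gt 0 x with hx | hx
  · rw [negPow_of_nonneg hx, Complex.ofReal_cpow hx, Complex.ofReal_neg]
  · rw [negPow, if_pos hx, Complex.ofReal_cpow_of_nonpos hx.le, abs_of_neg hx,
      Complex.ofReal_cpow (by linarith), mul_comm]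
    push_cast
    congr 2
    ring

theorem intervalIntegrable_negPow {ν : ℝ} (hν : ν < 1) (u v : ℝ) :
    IntervalIntegrable (negPow ν) volume u v := by
  rw [show negPow ν = fun x : ℝ => (x : ℂ) ^ (-ν : ℂ) from funext negPow_eq_cpow]
  exact intervalIntegral.intervalIntegrable_cpow' (by simpa using hν)

theorem integral_negPow_div_of_nonneg {ν ω u v : ℝ} (hu : 0 ≤ u) (huv : u ≤ v) :
    ∫ x in u..v, negPow ν x / ((ω : ℂ) - x) = ((∫ x in u..v, x ^ (-ν) / (ω - x) : ℝ) : ℂ) := by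
  rw [← intervalIntegral.integral_ofReal]
  refine intervalIntegral.integral_congr_Ioo_of_le huv fun x hx => ?_
  rw [negPow_of_nonneg (hu.trans hx.1.le)]
  push_cast
  rfl

theorem integral_negPow_div_of_nonpos {ν ω u v : ℝ} (hu : 0 ≤ u) (huv : u ≤ v) :
    ∫ x in (-v)..(-u), negPow ν x / ((ω : ℂ) - x) =
      branchPhase ν * ((∫ x in u..v, x ^ (-ν) / (ω + x) : ℝ) : ℂ) := by
  rw [← intervalIntegral.integral_comp_neg, ← intervalIntegral.integral_ofReal,
    ← intervalIntegral.integral_const_mul]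
  refine intervalIntegral.integral_congr_Ioo_of_le huv fun x hx => ?_
  rw [negPow_neg (hu.trans_lt hx.1)]
  push_cast
  ring

theorem intervalIntegrable_negPow_div {ν ω u v : ℝ} (hν : ν < 1) (h : ω ∉ Set.uIcc u v) :
    IntervalIntegrable (fun x : ℝ => negPow ν x / ((ω : ℂ) - x)) volume u v := by
  simp only [div_eq_mul_inv]
  refine (intervalIntegrable_negPow hν u v).mul_continuousOn fun x hx =>
    ContinuousAt.continuousWithinAt ?_
  refine ContinuousAt.inv₀ (by fun_prop) ?_
  rw [sub_ne_zero]
  intro he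
  exact h ((Complex.ofReal_injective he) ▸ hx)

/-- The finite part of `∫₀ᴬ (e ^ (-iπν) (-1) ^ k - 1) / x ^ (k + ν + 1)`. -/
def unitCoef (ν A : ℝ) (k : ℕ) : ℂ :=
  (1 - branchPhase ν * (-1) ^ k) * ((A ^ (-((k : ℝ) + ν)) / ((k : ℝ) + ν) : ℝ) : ℂ)

theorem hasSum_unitCoef {ν ω A : ℝ} (hν0 : 0 < ν) (hA : |ω| < A) :
    HasSum (fun k : ℕ => (ω : ℂ) ^ k * unitCoef ν A k)
      (((∑' n : ℕ, ω ^ n * (A ^ (-((n : ℝ) + ν)) / ((n : ℝ) + ν)) : ℝ) : ℂ) -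
        branchPhase ν *
          ((∑' n : ℕ, (-ω) ^ n * (A ^ (-((n : ℝ) + ν)) / ((n : ℝ) + ν)) : ℝ) : ℂ)) := by
  have hs : ∀ t : ℝ, |t| < A →
      Summable fun n : ℕ => t ^ n * (A ^ (-((n : ℝ) + ν)) / ((n : ℝ) + ν)) := by
    intro t ht
    have := summable_pow_mul_rpow_neg_div (σ := 1) hν0 abs_one (abs_nonneg t) ht
    refine Summable.of_abs (this.abs.congr fun n => ?_)
    rw [one_pow, one_mul, abs_mul, abs_mul, abs_pow, abs_abs, abs_pow]
  have h1 := Complex.hasSum_ofReal.2 (hs ω hA).hasSum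
  have h2 := Complex.hasSum_ofReal.2 (hs (-ω) (by rwa [abs_neg])).hasSum
  refine (h1.sub (h2.mul_left (branchPhase ν))).congr_fun fun k => ?_
  rw [unitCoef, neg_eq_neg_one_mul ω, mul_pow]
  push_cast
  ring

/-- The half-line containing `ω` contributes a cotangent, the other a cosecant, and the phase turns
them into `-iπ`. For `ω > 0` this is `e^(-iπν) - cos πν = -i sin πν`. For `ω < 0` the two half-lines
exchange roles and it becomes `e^(-iπν) cos πν - 1 = -i e^(-iπν) sin πν`. -/
theorem hasPVReal_negPow {ν ω A : ℝ} (hν0 : 0 < ν) (hν : ν < 1) (hω : ω ≠ 0) (hA : |ω| < A) :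
    HasPVReal (fun x : ℝ => negPow ν x / ((ω : ℂ) - x)) ω A
      ((∑' k : ℕ, (ω : ℂ) ^ k * unitCoef ν A k) - Complex.I * Real.pi * negPow ν ω) := by
  have hAl := neg_lt_of_abs_lt hA
  have hAr := lt_of_abs_lt hA
  have hA0 : 0 < A := (abs_nonneg ω).trans_lt hA
  have hsin : 0 < Real.sin (Real.pi * ν) :=
    Real.sin_pos_of_pos_of_lt_pi (by positivity) (by nlinarith [Real.pi_pos])
  have hsin' : (Real.sin (Real.pi * ν) : ℂ) ≠ 0 := by exact_mod_cast hsin.ne'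
  have hsc : (Real.cos (Real.pi * ν) : ℂ) ^ 2 = 1 - (Real.sin (Real.pi * ν) : ℂ) ^ 2 := by
    have := Real.cos_sq' (Real.pi * ν)
    exact_mod_cast this
  have hI := Complex.I_sq
  refine ⟨?_, ?_⟩
  · filter_upwards [Ioo_mem_nhdsGT (show 0 < min (ω + A) (A - ω) from
      lt_min (by linarith) (by linarith))] with δ hδ
    have h0 := hδ.1
    have h1 := hδ.2.trans_le (min_le_left _ _)
    have h2 := hδ.2.trans_le (min_le_right _ _)
    refine ⟨intervalIntegrable_negPow_div hν ?_, intervalIntegrable_negPow_div hν ?_⟩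
    · exact Set.notMem_uIcc_of_gt (by linarith) (by linarith)
    · exact Set.notMem_uIcc_of_lt (by linarith) (by linarith)
  rw [(hasSum_unitCoef hν0 hA).tsum_eq]
  rcases lt_or_gt_of_ne hω with hneg | hpos
  · have ht : 0 < -ω := neg_pos.2 hneg
    have hpv := tendsto_pv_integral_rpow_div_sub hν0 hν ht (by linarith : -ω < A)
    have hq := integral_rpow_div_add hν0 hν ht (by linarith : -ω < A)
    have hlim := ((((Complex.continuous_ofReal.tendsto _).comp hpv).const_mul
      (-branchPhase ν))).sub_const ((∫ x in (0 : ℝ)..A, x ^ (-ν) / (-ω + x) : ℝ) : ℂ)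
    refine (hlim.congr' ?_).trans_eq ?_
    · filter_upwards [Ioo_mem_nhdsGT (show 0 < min (ω + A) (-ω) from
        lt_min (by linarith) ht)] with δ hδ
      have h0 := hδ.1
      have h1 := hδ.2.trans_le (min_le_left _ _)
      have h2 := hδ.2.trans_le (min_le_right _ _)
      have e1 := integral_negPow_div_of_nonpos (ν := ν) (ω := ω) (u := -ω + δ) (v := A)
        (by linarith) (by linarith)
      have e2 := integral_negPow_div_of_nonpos (ν := ν) (ω := ω) (u := 0) (v := -ω - δ)
        le_rfl (by linarith)
      have e3 := integral_negPow_div_of_nonneg (ν := ν) (ω := ω) (u := 0) (v := A)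
        le_rfl hA0.le
      rw [show -(-ω + δ) = ω - δ by ring] at e1
      rw [show -(-ω - δ) = ω + δ by ring, neg_zero] at e2
      rw [← intervalIntegral.integral_add_adjacent_intervals (a := ω + δ) (b := 0) (c := A)
        (intervalIntegrable_negPow_div hν (Set.notMem_uIcc_of_lt (by linarith) hneg))
        (intervalIntegrable_negPow_div hν (Set.notMem_uIcc_of_lt hneg (by linarith))),
        e1, e2, e3]
      have s1 : ∀ u v : ℝ, ∫ x in u..v, x ^ (-ν) / (ω + x) =
          -∫ x in u..v, x ^ (-ν) / (-ω - x) := by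
        intro u v
        rw [← intervalIntegral.integral_neg]
        congr 1; funext x
        rw [← div_neg]; ring_nf
      have s2 : ∫ x in (0 : ℝ)..A, x ^ (-ν) / (ω - x) =
          -∫ x in (0 : ℝ)..A, x ^ (-ν) / (-ω + x) := by
        rw [← intervalIntegral.integral_neg]
        congr 1; funext x
        rw [← div_neg]; ring_nf
      rw [s1, s1, s2]
      simp only [Function.comp_apply]
      push_cast
      ring
    · rw [hq, neg_neg, show negPow ν ω = branchPhase ν * (((-ω) ^ (-ν) : ℝ) : ℂ) by
        rw [← negPow_neg ht, neg_neg]]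
      congr 1
      rw [branchPhase_eq]
      push_cast [-Complex.ofReal_cos, -Complex.ofReal_sin, -Complex.ofReal_tsum]
      field_simp
      ring_nf
      rw [hsc, hI]
      ring
  · have hpv := tendsto_pv_integral_rpow_div_sub hν0 hν hpos hAr
    have hq := integral_rpow_div_add hν0 hν hpos hAr
    have hlim := ((Complex.continuous_ofReal.tendsto _).comp hpv).const_add
      (branchPhase ν * ((∫ x in (0 : ℝ)..A, x ^ (-ν) / (ω + x) : ℝ) : ℂ))
    refine (hlim.congr' ?_).trans_eq ?_
    · filter_upwards [Ioo_mem_nhdsGT (show 0 < min (A - ω) ω from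
        lt_min (by linarith) hpos)] with δ hδ
      have h0 := hδ.1
      have h1 := hδ.2.trans_le (min_le_left _ _)
      have h2 := hδ.2.trans_le (min_le_right _ _)
      have e1 := integral_negPow_div_of_nonpos (ν := ν) (ω := ω) (u := 0) (v := A)
        le_rfl hA0.le
      rw [neg_zero] at e1
      rw [← intervalIntegral.integral_add_adjacent_intervals (a := -A) (b := 0) (c := ω - δ)
        (intervalIntegrable_negPow_div hν (Set.notMem_uIcc_of_gt (by linarith) hpos))
        (intervalIntegrable_negPow_div hν (Set.notMem_uIcc_of_gt hpos (by linarith))), e1,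
        integral_negPow_div_of_nonneg le_rfl (by linarith),
        integral_negPow_div_of_nonneg (by linarith) (by linarith)]
      simp only [Function.comp_apply]
      push_cast
      ring
    · rw [hq, negPow_of_nonneg hpos.le]
      congr 1
      rw [branchPhase_eq]
      push_cast [-Complex.ofReal_cos, -Complex.ofReal_sin, -Complex.ofReal_tsum]
      field_simp
      ring

end PrincipalValueOfNegPow

/-! ### Calculus of finite parts -/

section FinitePart

theorem HasFinitePartReal.congr {φ ψ : ℝ → ℂ} {a : ℝ} {L : ℂ} (h : HasFinitePartReal φ a L)
    (ha : 0 < a) (he : ∀ x, 0 < x → x ≤ a → φ x = ψ x) : HasFinitePartReal ψ a L := by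
  obtain ⟨hi, S, d, b, hS, ht⟩ := h
  have hEq : ∀ ε, 0 < ε → ε < a → Set.EqOn φ ψ (Set.uIoc ε a) := by
    intro ε h0 h1 x hx
    rw [Set.uIoc_of_le h1.le] at hx
    exact he x (h0.trans hx.1) hx.2
  refine ⟨fun ε h0 h1 => (hi ε h0 h1).congr (hEq ε h0 h1), S, d, b, hS, ht.congr' ?_⟩
  filter_upwards [Ioo_mem_nhdsGT ha] with ε hε
  congr 1
  exact intervalIntegral.integral_congr_ae (Eventually.of_forall fun x hx => hEq ε hε.1 hε.2 hx)

theorem HasFinitePartReal.const_mul {φ : ℝ → ℂ} {a : ℝ} {L : ℂ} (h : HasFinitePartReal φ a L)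
    (c : ℂ) : HasFinitePartReal (fun x => c * φ x) a (c * L) := by
  obtain ⟨hi, S, d, b, hS, ht⟩ := h
  refine ⟨fun ε h0 h1 => (hi ε h0 h1).const_mul c, S, fun p => c * d p, c * b, hS,
    (ht.const_mul c).congr fun ε => ?_⟩
  rw [intervalIntegral.integral_const_mul, mul_sub, mul_add, Finset.mul_sum]
  simp only [mul_assoc]

theorem HasFinitePartReal.add {φ ψ : ℝ → ℂ} {a : ℝ} {L M : ℂ} (ha : 0 < a)
    (h : HasFinitePartReal φ a L) (h' : HasFinitePartReal ψ a M) :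
    HasFinitePartReal (fun x => φ x + ψ x) a (L + M) := by
  obtain ⟨hi, S, d, b, hS, h1⟩ := h
  obtain ⟨hi', T, e, c, hT, h2⟩ := h'
  refine ⟨fun ε h0 h1 => (hi ε h0 h1).add (hi' ε h0 h1), S ∪ T,
    fun p => (if p ∈ S then d p else 0) + (if p ∈ T then e p else 0), b + c,
    fun p hp => (Finset.mem_union.1 hp).elim (hS p) (hT p), (h1.add h2).congr' ?_⟩
  filter_upwards [Ioo_mem_nhdsGT ha] with ε hε
  have hs : ∑ p ∈ S ∪ T, (if p ∈ S then d p else 0) * ((ε ^ (-p) : ℝ) : ℂ) =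
      ∑ p ∈ S, d p * ((ε ^ (-p) : ℝ) : ℂ) := by
    rw [← Finset.sum_subset (Finset.subset_union_left : S ⊆ S ∪ T)]
    · exact Finset.sum_congr rfl fun p hp => by rw [if_pos hp]
    · intro p _ hp
      rw [if_neg hp, zero_mul]
  have ht : ∑ p ∈ S ∪ T, (if p ∈ T then e p else 0) * ((ε ^ (-p) : ℝ) : ℂ) =
      ∑ p ∈ T, e p * ((ε ^ (-p) : ℝ) : ℂ) := by
    rw [← Finset.sum_subset (Finset.subset_union_right : T ⊆ S ∪ T)]
    · exact Finset.sum_congr rfl fun p hp => by rw [if_pos hp]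
    · intro p _ hp
      rw [if_neg hp, zero_mul]
  simp only [add_mul, Finset.sum_add_distrib]
  rw [hs, ht, intervalIntegral.integral_add (hi ε hε.1 hε.2) (hi' ε hε.1 hε.2)]
  ring

theorem IntervalIntegrable.hasFinitePartReal {φ : ℝ → ℂ} {a : ℝ} (ha : 0 < a)
    (h : IntervalIntegrable φ volume 0 a) : HasFinitePartReal φ a (∫ x in (0 : ℝ)..a, φ x) := by
  have hsub : ∀ ε, 0 < ε → ε < a → Set.uIcc ε a ⊆ Set.uIcc 0 a := by
    intro ε h0 h1
    rw [Set.uIcc_of_le h1.le, Set.uIcc_of_le ha.le]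
    exact Set.Icc_subset_Icc_left h0.le
  refine ⟨fun ε h0 h1 => h.mono_set (hsub ε h0 h1), ∅, 0, 0, by simp, ?_⟩
  simp only [Finset.sum_empty, zero_mul, add_zero, sub_zero]
  have hc := intervalIntegral.continuousOn_primitive_interval_left
    ((intervalIntegrable_iff').1 h : IntegrableOn φ (Set.uIcc 0 a) volume)
  have h0 := hc 0 Set.left_mem_uIcc
  refine h0.tendsto.mono_left ?_
  rw [Set.uIcc_of_le ha.le]
  exact nhdsWithin_le_of_mem (mem_of_superset (Ioo_mem_nhdsGT ha) Set.Ioo_subset_Icc_self)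

theorem hasFinitePartReal_rpow {p a : ℝ} (hp : 0 < p) (ha : 0 < a) :
    HasFinitePartReal (fun x : ℝ => ((x ^ (-p - 1) : ℝ) : ℂ)) a ((a ^ (-p) / (-p) : ℝ) : ℂ) := by
  -- The diverging part is `ε^(-p)/p`, from the primitive at the lower limit; what remains does not
  -- depend on `ε`.
  refine ⟨fun ε h0 h1 => ?_, {p}, fun _ => ((1 / p : ℝ) : ℂ), 0, by simpa using hp, ?_⟩
  · have hi : IntervalIntegrable (fun x : ℝ => x ^ (-p - 1)) volume ε a :=
      intervalIntegral.intervalIntegrable_rpow (Or.inr (Set.notMem_uIcc_of_lt h0 (h0.trans h1)))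
    exact ⟨hi.1.ofReal, hi.2.ofReal⟩
  · refine tendsto_const_nhds.congr' ?_
    filter_upwards [Ioo_mem_nhdsGT ha] with ε hε
    rw [intervalIntegral.integral_ofReal, integral_rpow
      (Or.inr ⟨by linarith, Set.notMem_uIcc_of_lt hε.1 ha⟩), sub_add_cancel, Finset.sum_singleton,
      zero_mul, add_zero, ← Complex.ofReal_mul, ← Complex.ofReal_sub]
    congr 1
    field_simp
    ring

theorem HasFinitePartReal.extend {φ : ℝ → ℂ} {r a : ℝ} {L : ℂ} (h : HasFinitePartReal φ r L)
    (hr : 0 < r) (hra : r ≤ a) (hi : IntervalIntegrable φ volume r a) :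
    HasFinitePartReal φ a (L + ∫ x in r..a, φ x) := by
  obtain ⟨hφ, S, d, b, hS, ht⟩ := h
  refine ⟨fun ε h0 h1 => ?_, S, d, b, hS, (ht.add_const (∫ x in r..a, φ x)).congr' ?_⟩
  · rcases lt_or_ge ε r with h | h
    · exact (hφ ε h0 h).trans hi
    · refine hi.mono_set ?_
      rw [Set.uIcc_of_le h1.le, Set.uIcc_of_le hra]
      exact Set.Icc_subset_Icc_left h
  · filter_upwards [Ioo_mem_nhdsGT hr] with ε hε
    rw [← intervalIntegral.integral_add_adjacent_intervals (hφ ε hε.1 hε.2) hi]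
    ring

theorem HasFinitePartReal.sum {ι : Type*} {φ : ι → ℝ → ℂ} {a : ℝ} {L : ι → ℂ} (s : Finset ι)
    (ha : 0 < a) (h : ∀ i ∈ s, HasFinitePartReal (φ i) a (L i)) :
    HasFinitePartReal (fun x => ∑ i ∈ s, φ i x) a (∑ i ∈ s, L i) := by
  classical
  induction s using Finset.induction_on with
  | empty =>
    have := IntervalIntegrable.hasFinitePartReal ha
      (intervalIntegrable_const (c := (0 : ℂ)) (μ := volume))
    simpa using this
  | insert i s hi ih =>
    simp only [Finset.sum_insert hi]
    exact (h i (Finset.mem_insert_self _ _)).add ha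
      (ih fun j hj => h j (Finset.mem_insert_of_mem hj))

end FinitePart

/-! ### Existence and geometric bounds of finite parts -/

section PowerSeries

/-- On `[-r, r]` the function `f` is the sum of a power series that converges absolutely at `r`. -/
def HasTaylorExpansion (f : ℝ → ℂ) (r : ℝ) : Prop :=
  ∃ p : ℕ → ℂ, Summable (fun n => ‖p n‖ * r ^ n) ∧
    ∀ x : ℝ, |x| ≤ r → HasSum (fun n => p n * (x : ℂ) ^ n) (f x)

theorem HasTaylorExpansion.comp_neg {f : ℝ → ℂ} {r : ℝ} (h : HasTaylorExpansion f r) :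
    HasTaylorExpansion (fun x => f (-x)) r := by
  obtain ⟨p, hp, hs⟩ := h
  refine ⟨fun n => p n * (-1) ^ n, ?_, fun x hx => ?_⟩
  · simpa using hp
  · refine (hs (-x) (by rwa [abs_neg])).congr_fun fun n => ?_
    rw [Complex.ofReal_neg, neg_pow (x : ℂ)]
    ring

/-- Pull `(x/r)^N` out of the tail and compare the rest with the series at `r`. The constant is
independent of `N`, which makes the later bounds geometric in `k`. -/
theorem norm_sub_partialSum_le {p : ℕ → ℂ} {r x : ℝ} {y : ℂ} (hr : 0 < r)
    (hp : Summable fun n => ‖p n‖ * r ^ n) (hx0 : 0 ≤ x) (hxr : x ≤ r)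
    (hy : HasSum (fun n => p n * (x : ℂ) ^ n) y) (N : ℕ) :
    ‖y - ∑ n ∈ Finset.range N, p n * (x : ℂ) ^ n‖ ≤ (∑' n, ‖p n‖ * r ^ n) * (x / r) ^ N := by
  have h1 := (hasSum_nat_add_iff' N).2 hy
  rw [← h1.tsum_eq]
  have hpN := (summable_nat_add_iff N).2 hp
  have hxr' : x / r ≤ 1 := (div_le_one hr).2 hxr
  have hb : ∀ n, ‖p (n + N) * (x : ℂ) ^ (n + N)‖ ≤ ‖p (n + N)‖ * r ^ (n + N) * (x / r) ^ N := by
    intro n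
    rw [norm_mul, norm_pow, Complex.norm_real, Real.norm_eq_abs, abs_of_nonneg hx0, mul_assoc]
    gcongr
    calc x ^ (n + N) = r ^ (n + N) * (x / r) ^ (n + N) := by
          rw [← mul_pow, mul_div_cancel₀ _ hr.ne']
      _ ≤ r ^ (n + N) * (x / r) ^ N := by
          have : (x / r) ^ (n + N) ≤ (x / r) ^ N :=
            pow_le_pow_of_le_one (by positivity) hxr' (Nat.le_add_left _ _)
          gcongr
  refine (tsum_of_norm_bounded (hpN.hasSum.mul_right _) hb).trans ?_
  have : ∑' n, ‖p (n + N)‖ * r ^ (n + N) ≤ ∑' n, ‖p n‖ * r ^ n := by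
    rw [← hp.sum_add_tsum_nat_add N]
    have : 0 ≤ ∑ n ∈ Finset.range N, ‖p n‖ * r ^ n :=
      Finset.sum_nonneg fun n _ => by positivity
    linarith
  gcongr

/-- Split off the Taylor polynomial of degree `k`. Its terms are pure powers `x^(-p-1)` with `p = k
+ ν - n ≥ ν`, so their finite parts are explicit with denominators at least `ν`. The remainder is at
most `S r^(-k-1) x^(-ν)`, which is integrable at `0` because `ν < 1`. The two summands of `M` come
from these two pieces. -/
theorem exists_hasFinitePartReal_near_zero {ν r : ℝ} {f : ℝ → ℂ} (hν0 : 0 < ν) (hν : ν < 1)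
    (hr : 0 < r) (hf : ContinuousOn f (Set.Icc 0 r)) (hT : HasTaylorExpansion f r) :
    ∃ M : ℝ, ∀ k : ℕ, ∃ L : ℂ,
      HasFinitePartReal (fun x : ℝ => f x / ((x ^ ((k : ℝ) + ν + 1) : ℝ) : ℂ)) r L ∧
      ‖L‖ ≤ M * r⁻¹ ^ k := by
  obtain ⟨p, hp, hs⟩ := hT
  set S := ∑' n, ‖p n‖ * r ^ n with hS
  refine ⟨S * (r ^ (-ν) / ν) + S * (r ^ (-ν) / (1 - ν)), fun k => ?_⟩
  have hk : (0 : ℝ) ≤ k := k.cast_nonneg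
  have hmain : HasFinitePartReal (fun x : ℝ => ∑ n ∈ Finset.range (k + 1),
      p n * ((x ^ (-((k : ℝ) + ν - n) - 1) : ℝ) : ℂ)) r
      (∑ n ∈ Finset.range (k + 1),
        p n * ((r ^ (-((k : ℝ) + ν - n)) / (-((k : ℝ) + ν - n)) : ℝ) : ℂ)) := by
    refine HasFinitePartReal.sum _ hr fun n hn => ?_
    refine (hasFinitePartReal_rpow ?_ hr).const_mul _
    have : (n : ℝ) ≤ k := by exact_mod_cast Nat.lt_succ_iff.1 (Finset.mem_range.1 hn)
    linarith
  have hrem : ∀ x ∈ Set.Ioc 0 r, ‖(f x - ∑ n ∈ Finset.range (k + 1), p n * (x : ℂ) ^ n) /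
      ((x ^ ((k : ℝ) + ν + 1) : ℝ) : ℂ)‖ ≤ S * r⁻¹ ^ (k + 1) * x ^ (-ν) := by
    intro x hx
    have h1 := norm_sub_partialSum_le hr hp hx.1.le hx.2
      (hs x (by rw [abs_of_pos hx.1]; exact hx.2)) (k + 1)
    rw [norm_div, Complex.norm_real, Real.norm_of_nonneg (Real.rpow_nonneg hx.1.le _),
      div_le_iff₀ (Real.rpow_pos_of_pos hx.1 _)]
    refine h1.trans_eq ?_
    rw [mul_assoc _ (x ^ (-ν)), ← Real.rpow_add hx.1,
      show -ν + ((k : ℝ) + ν + 1) = (k + 1 : ℕ) by push_cast; ring, Real.rpow_natCast, div_pow,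
      inv_pow]
    ring
  have hbi : IntervalIntegrable (fun x : ℝ => S * r⁻¹ ^ (k + 1) * x ^ (-ν)) volume 0 r :=
    (intervalIntegral.intervalIntegrable_rpow' (by linarith)).const_mul _
  have hremi : IntervalIntegrable (fun x : ℝ =>
      (f x - ∑ n ∈ Finset.range (k + 1), p n * (x : ℂ) ^ n) /
      ((x ^ ((k : ℝ) + ν + 1) : ℝ) : ℂ)) volume 0 r := by
    refine hbi.mono_fun' ?_ ?_
    · rw [Set.uIoc_of_le hr.le]
      refine ContinuousOn.aestronglyMeasurable ?_ measurableSet_Ioc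
      refine ContinuousOn.div ((hf.mono Set.Ioc_subset_Icc_self).sub
        (by fun_prop)) ?_ fun x hx => ?_
      · refine Complex.continuous_ofReal.comp_continuousOn fun x hx => ?_
        exact (Real.continuousAt_rpow_const _ _ (Or.inl hx.1.ne')).continuousWithinAt
      · exact_mod_cast (Real.rpow_pos_of_pos hx.1 _).ne'
    · rw [Set.uIoc_of_le hr.le]
      exact (ae_restrict_iff' measurableSet_Ioc).2 (Eventually.of_forall hrem)
  have hFP := hmain.add hr (IntervalIntegrable.hasFinitePartReal hr hremi)
  refine ⟨_, hFP.congr hr fun x hx0 hxr => ?_, ?_⟩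
  · have hx' : ((x ^ ((k : ℝ) + ν + 1) : ℝ) : ℂ) ≠ 0 := by
      exact_mod_cast (Real.rpow_pos_of_pos hx0 _).ne'
    rw [sub_div, Finset.sum_div]
    have : ∀ n ∈ Finset.range (k + 1), p n * ((x ^ (-((k : ℝ) + ν - n) - 1) : ℝ) : ℂ) =
        p n * (x : ℂ) ^ n / ((x ^ ((k : ℝ) + ν + 1) : ℝ) : ℂ) := by
      intro n _
      rw [mul_div_assoc, show -((k : ℝ) + ν - n) - 1 = n - ((k : ℝ) + ν + 1) by ring,
        Real.rpow_sub hx0, Real.rpow_natCast]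
      push_cast
      rfl
    rw [Finset.sum_congr rfl this, add_sub_cancel]
  · rw [add_mul]
    refine (norm_add_le _ _).trans (add_le_add ?_ ?_)
    · have hb : ∀ n ∈ Finset.range (k + 1),
          ‖p n * ((r ^ (-((k : ℝ) + ν - n)) / (-((k : ℝ) + ν - n)) : ℝ) : ℂ)‖ ≤
          ‖p n‖ * r ^ n * (r ^ (-ν) / ν * r⁻¹ ^ k) := by
        intro n hn
        have hn' : (n : ℝ) ≤ k := by exact_mod_cast Nat.lt_succ_iff.1 (Finset.mem_range.1 hn)
        have hpos : 0 < (k : ℝ) + ν - n := by linarith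
        rw [norm_mul, Complex.norm_real, norm_div, norm_neg, Real.norm_of_nonneg hpos.le,
          Real.norm_of_nonneg (Real.rpow_nonneg hr.le _), mul_assoc]
        refine mul_le_mul_of_nonneg_left ?_ (norm_nonneg _)
        have e : r ^ (-((k : ℝ) + ν - n)) = r ^ n * r ^ (-ν) * r⁻¹ ^ k := by
          rw [show -((k : ℝ) + ν - n) = (n : ℝ) + -ν + -(k : ℝ) by ring, Real.rpow_add hr,
            Real.rpow_add hr, Real.rpow_natCast, Real.rpow_neg hr.le (k : ℝ), Real.rpow_natCast,
            inv_pow]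
        rw [e, show r ^ n * (r ^ (-ν) / ν * r⁻¹ ^ k) = r ^ n * r ^ (-ν) * r⁻¹ ^ k / ν by ring]
        have : ν ≤ (k : ℝ) + ν - n := by linarith
        gcongr
      refine (norm_sum_le_of_le _ hb).trans ?_
      rw [← Finset.sum_mul, mul_assoc]
      refine mul_le_mul_of_nonneg_right ?_ (by positivity)
      exact hp.sum_le_tsum _ fun n _ => by positivity
    · refine (intervalIntegral.norm_integral_le_of_norm_le hr.le
        (Eventually.of_forall hrem) hbi).trans_eq ?_
      rw [intervalIntegral.integral_const_mul, integral_rpow (Or.inl (by linarith)),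
        Real.zero_rpow (by linarith), sub_zero, Real.rpow_add hr, Real.rpow_one, pow_succ,
        show -ν + 1 = 1 - ν by ring]
      field_simp

/-- Beyond `r` nothing is singular, and `x^(k+ν+1) ≥ r^(ν+1) r^k` keeps the same geometric rate. -/
theorem exists_hasFinitePartReal_div_rpow {ν r a : ℝ} {f : ℝ → ℂ} (hν0 : 0 < ν) (hν : ν < 1)
    (hr : 0 < r) (hra : r ≤ a) (hf : ContinuousOn f (Set.Icc 0 a)) (hT : HasTaylorExpansion f r) :
    ∃ M : ℝ, ∀ k : ℕ, ∃ L : ℂ,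
      HasFinitePartReal (fun x : ℝ => f x / ((x ^ ((k : ℝ) + ν + 1) : ℝ) : ℂ)) a L ∧
      ‖L‖ ≤ M * r⁻¹ ^ k := by
  obtain ⟨M, hM⟩ := exists_hasFinitePartReal_near_zero hν0 hν hr
    (hf.mono (Set.Icc_subset_Icc_right hra)) hT
  obtain ⟨C, hC⟩ := isCompact_Icc.exists_bound_of_continuousOn hf
  have hC0 : 0 ≤ C := (norm_nonneg _).trans (hC 0 ⟨le_rfl, hr.le.trans hra⟩)
  refine ⟨M + C / r ^ (ν + 1) * (a - r), fun k => ?_⟩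
  obtain ⟨L, hL, hLM⟩ := hM k
  have hk : (0 : ℝ) ≤ k := k.cast_nonneg
  have hi : IntervalIntegrable (fun x : ℝ => f x / ((x ^ ((k : ℝ) + ν + 1) : ℝ) : ℂ))
      volume r a := by
    refine ContinuousOn.intervalIntegrable ?_
    rw [Set.uIcc_of_le hra]
    refine ContinuousOn.div (hf.mono (Set.Icc_subset_Icc_left hr.le)) ?_ fun x hx => ?_
    · refine Complex.continuous_ofReal.comp_continuousOn fun x hx => ?_
      exact (Real.continuousAt_rpow_const _ _
        (Or.inl (hr.trans_le hx.1).ne')).continuousWithinAt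
    · exact_mod_cast (Real.rpow_pos_of_pos (hr.trans_le hx.1) _).ne'
  refine ⟨_, hL.extend hr hra hi, ?_⟩
  rw [add_mul]
  refine (norm_add_le _ _).trans (add_le_add hLM ?_)
  refine (intervalIntegral.norm_integral_le_of_norm_le_const
    (C := C / r ^ (ν + 1) * r⁻¹ ^ k) ?_).trans_eq ?_
  · intro x hx
    rw [Set.uIoc_of_le hra] at hx
    have hx0 : 0 < x := hr.trans hx.1
    rw [norm_div, Complex.norm_real, Real.norm_of_nonneg (Real.rpow_nonneg hx0.le _), inv_pow,
      ← div_eq_mul_inv, div_div]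
    refine div_le_div₀ hC0 (hC x ⟨hx0.le, hx.2⟩) (by positivity) ?_
    rw [← Real.rpow_natCast, ← Real.rpow_add hr, show ν + 1 + (k : ℝ) = k + ν + 1 by ring]
    exact Real.rpow_le_rpow hr.le hx.1.le (by linarith)
  · rw [abs_of_nonneg (by linarith)]
    ring

end PowerSeries

/-! ### Calculus of principal values -/

section PrincipalValue

theorem HasPVReal.const_mul {h : ℝ → ℂ} {ω a : ℝ} {V : ℂ} (hV : HasPVReal h ω a V) (c : ℂ) :
    HasPVReal (fun x => c * h x) ω a (c * V) := by
  refine ⟨hV.1.mono fun δ hδ => ⟨hδ.1.const_mul c, hδ.2.const_mul c⟩,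
    (hV.2.const_mul c).congr fun δ => ?_⟩
  rw [intervalIntegral.integral_const_mul, intervalIntegral.integral_const_mul, mul_add]

theorem eventually_Icc_sub_add {ω a : ℝ} (hω : |ω| < a) :
    ∀ᶠ δ : ℝ in 𝓝[>] 0, 0 < δ ∧ -a ≤ ω - δ ∧ ω + δ ≤ a := by
  have h1 := neg_lt_of_abs_lt hω
  have h2 := lt_of_abs_lt hω
  filter_upwards [Ioo_mem_nhdsGT (show 0 < min (ω + a) (a - ω) from
    lt_min (by linarith) (by linarith))] with δ hδ
  have h3 := hδ.2.trans_le (min_le_left _ _)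
  have h4 := hδ.2.trans_le (min_le_right _ _)
  exact ⟨hδ.1, by linarith, by linarith⟩

theorem HasPVReal.congr {h g : ℝ → ℂ} {ω a : ℝ} {V : ℂ} (hV : HasPVReal h ω a V) (hω : |ω| < a)
    (he : ∀ x, |x| ≤ a → x ≠ ω → h x = g x) : HasPVReal g ω a V := by
  have hE : ∀ᶠ δ : ℝ in 𝓝[>] 0, Set.EqOn h g (Set.uIcc (-a) (ω - δ)) ∧
      Set.EqOn h g (Set.uIcc (ω + δ) a) := by
    filter_upwards [eventually_Icc_sub_add hω] with δ hδ
    rw [Set.uIcc_of_le hδ.2.1, Set.uIcc_of_le hδ.2.2]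
    have h1 := neg_lt_of_abs_lt hω
    have h2 := lt_of_abs_lt hω
    refine ⟨fun x hx => he x (abs_le.2 ⟨hx.1, ?_⟩) ?_, fun x hx => he x (abs_le.2 ⟨?_, hx.2⟩) ?_⟩
    · linarith [hx.2]
    · exact ne_of_lt (by linarith [hx.2])
    · linarith [hx.1]
    · exact ne_of_gt (by linarith [hx.1])
  refine ⟨?_, hV.2.congr' ?_⟩
  · filter_upwards [hE, hV.1] with δ hδ hi
    exact ⟨hi.1.congr (hδ.1.mono Set.uIoc_subset_uIcc),
      hi.2.congr (hδ.2.mono Set.uIoc_subset_uIcc)⟩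
  · filter_upwards [hE] with δ hδ
    rw [intervalIntegral.integral_congr hδ.1, intervalIntegral.integral_congr hδ.2]

/-- The primitive of an integrable function is continuous at `ω`, so cutting out `(ω - δ, ω + δ)`
has no effect in the limit. -/
theorem IntervalIntegrable.hasPVReal {g : ℝ → ℂ} {ω a : ℝ} (hω : |ω| < a)
    (hg : IntervalIntegrable g volume (-a) a) : HasPVReal g ω a (∫ x in (-a)..a, g x) := by
  have h1 := neg_lt_of_abs_lt hω
  have h2 := lt_of_abs_lt hω
  have hsub : ∀ u ∈ Set.Icc (-a) a, ∀ v ∈ Set.Icc (-a) a, IntervalIntegrable g volume u v :=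
    fun u hu v hv => hg.mono_set (by
      rw [Set.uIcc_of_le (by linarith : -a ≤ a)]
      exact (convex_Icc (-a) a).ordConnected.uIcc_subset hu hv)
  have hla : -a ∈ Set.Icc (-a) a := ⟨le_rfl, by linarith⟩
  have hra : a ∈ Set.Icc (-a) a := ⟨by linarith, le_rfl⟩
  have hev : ∀ᶠ δ : ℝ in 𝓝[>] 0, ω - δ ∈ Set.Icc (-a) a ∧ ω + δ ∈ Set.Icc (-a) a := by
    filter_upwards [eventually_Icc_sub_add hω] with δ hδ
    exact ⟨⟨hδ.2.1, by linarith [hδ.1]⟩, ⟨by linarith [hδ.1], hδ.2.2⟩⟩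
  refine ⟨hev.mono fun δ hδ => ⟨hsub _ hla _ hδ.1, hsub _ hδ.2 _ hra⟩, ?_⟩
  have hc : ContinuousAt (fun t => ∫ x in (-a)..t, g x) ω := by
    refine (intervalIntegral.continuousOn_primitive_interval' hg Set.left_mem_uIcc).continuousAt ?_
    rw [Set.uIcc_of_le (by linarith : -a ≤ a)]
    exact Icc_mem_nhds h1 h2
  have t1 : Tendsto (fun δ : ℝ => ω - δ) (𝓝[>] 0) (𝓝 ω) := by
    have : Tendsto (fun δ : ℝ => ω - δ) (𝓝 0) (𝓝 (ω - 0)) := Continuous.tendsto (by fun_prop) 0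
    rw [sub_zero] at this
    exact this.mono_left nhdsWithin_le_nhds
  have t2 : Tendsto (fun δ : ℝ => ω + δ) (𝓝[>] 0) (𝓝 ω) := by
    have : Tendsto (fun δ : ℝ => ω + δ) (𝓝 0) (𝓝 (ω + 0)) := Continuous.tendsto (by fun_prop) 0
    rw [add_zero] at this
    exact this.mono_left nhdsWithin_le_nhds
  have hlim := (hc.tendsto.comp t1).add ((hc.tendsto.comp t2).const_sub (∫ x in (-a)..a, g x))
  rw [add_sub_cancel] at hlim
  refine hlim.congr' ?_
  filter_upwards [hev] with δ hδ
  simp only [Function.comp_apply]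
  rw [intervalIntegral.integral_interval_sub_left hg (hsub _ hla _ hδ.2)]

theorem HasPVReal.sub {h g : ℝ → ℂ} {ω a : ℝ} {V W : ℂ} (hV : HasPVReal h ω a V)
    (hW : HasPVReal g ω a W) : HasPVReal (fun x => h x - g x) ω a (V - W) := by
  refine ⟨?_, (hV.2.sub hW.2).congr' ?_⟩
  · filter_upwards [hV.1, hW.1] with δ h1 h2
    exact ⟨h1.1.sub h2.1, h1.2.sub h2.2⟩
  · filter_upwards [hV.1, hW.1] with δ h1 h2
    rw [intervalIntegral.integral_sub h1.1 h2.1, intervalIntegral.integral_sub h1.2 h2.2]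
    ring

end PrincipalValue

/-! ### The expansion on a finite interval -/

section FiniteInterval

/-- The integrand of the `k`-th coefficient, obtained by folding `[-a, a]` onto `[0, a]`. -/
def foldedIntegrand (ν : ℝ) (f : ℝ → ℂ) (k : ℕ) (x : ℝ) : ℂ :=
  (Complex.exp (-(Complex.I * Real.pi * ν)) * (-1) ^ k * f (-x) - f x) /
    ((x ^ ((k : ℝ) + ν + 1) : ℝ) : ℂ)

theorem continuousOn_comp_neg_Icc {f : ℝ → ℂ} {a : ℝ} (hf : ContinuousOn f (Set.Icc (-a) a)) :
    ContinuousOn (fun x => f (-x)) (Set.Icc (-a) a) :=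
  hf.comp continuous_neg.continuousOn fun x hx => ⟨neg_le_neg hx.2, by linarith [hx.1]⟩

theorem exists_hasFinitePartReal_folded {ν r a : ℝ} {f : ℝ → ℂ} (hν0 : 0 < ν) (hν : ν < 1)
    (hr : 0 < r) (hra : r ≤ a) (hf : ContinuousOn f (Set.Icc (-a) a))
    (hT : HasTaylorExpansion f r) :
    ∃ (M : ℝ) (c : ℕ → ℂ), ∀ k, HasFinitePartReal (foldedIntegrand ν f k) a (c k) ∧
      ‖c k‖ ≤ M * r⁻¹ ^ k := by
  have ha : 0 < a := hr.trans_le hra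
  have hI : Set.Icc 0 a ⊆ Set.Icc (-a) a := Set.Icc_subset_Icc_left (by linarith)
  obtain ⟨M, hM⟩ := exists_hasFinitePartReal_div_rpow hν0 hν hr hra (hf.mono hI) hT
  obtain ⟨N, hN⟩ := exists_hasFinitePartReal_div_rpow hν0 hν hr hra
    ((continuousOn_comp_neg_Icc hf).mono hI) hT.comp_neg
  choose L hL hLM using hM
  choose K hK hKN using hN
  refine ⟨N + M, fun k => branchPhase ν * (-1) ^ k * K k + (-1) * L k, fun k => ⟨?_, ?_⟩⟩
  · refine (((hK k).const_mul _).add ha ((hL k).const_mul _)).congr ha fun x _ _ => ?_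
    rw [foldedIntegrand, branchPhase]
    ring
  · rw [add_mul]
    refine (norm_add_le _ _).trans (add_le_add ?_ ?_)
    · simpa [norm_branchPhase] using hKN k
    · simpa using hLM k

theorem hasFinitePartReal_unitCoef {ν a : ℝ} (hν : 0 < ν) (ha : 0 < a) (k : ℕ) :
    HasFinitePartReal (foldedIntegrand ν (fun _ => 1) k) a (unitCoef ν a k) := by
  have hk : (0 : ℝ) ≤ k := k.cast_nonneg
  have h := (hasFinitePartReal_rpow (p := (k : ℝ) + ν) (by linarith) ha).const_mul
    (branchPhase ν * (-1) ^ k - 1)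
  have e : (branchPhase ν * (-1) ^ k - 1) *
      ((a ^ (-((k : ℝ) + ν)) / (-((k : ℝ) + ν)) : ℝ) : ℂ) = unitCoef ν a k := by
    rw [unitCoef, div_neg]
    push_cast
    ring
  rw [e] at h
  refine h.congr ha fun x hx _ => ?_
  rw [foldedIntegrand, show -((k : ℝ) + ν) - 1 = -((k : ℝ) + ν + 1) by ring, Real.rpow_neg hx.le,
    branchPhase]
  push_cast
  ring

/-- Fold the negative half of the interval onto the positive half. The folded form is what the
factor `x` of `(x - ω) q` leaves in the coefficient `k = 0`, where the exponent has dropped to `ν`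
and no finite part is needed. -/
theorem integral_mul_negPow {ν a : ℝ} {q : ℝ → ℂ} (ha : 0 < a) (hν : ν < 1)
    (hq : ContinuousOn q (Set.Icc (-a) a)) :
    IntervalIntegrable (fun x => q x * negPow ν x) volume (-a) a ∧
    IntervalIntegrable (fun x => -(branchPhase ν * q (-x) + q x) * ((x ^ (-ν) : ℝ) : ℂ))
      volume 0 a ∧
    ∫ x in (0 : ℝ)..a, -(branchPhase ν * q (-x) + q x) * ((x ^ (-ν) : ℝ) : ℂ) =
      -∫ x in (-a)..a, q x * negPow ν x := by
  have hI : Set.uIcc 0 a ⊆ Set.Icc (-a) a := by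
    rw [Set.uIcc_of_le ha.le]; exact Set.Icc_subset_Icc_left (by linarith)
  have hI' : Set.uIcc (-a) 0 ⊆ Set.Icc (-a) a := by
    rw [Set.uIcc_of_le (by linarith)]; exact Set.Icc_subset_Icc_right ha.le
  have h1 : IntervalIntegrable (fun x => q x * negPow ν x) volume (-a) 0 :=
    (intervalIntegrable_negPow hν _ _).continuousOn_mul (hq.mono hI')
  have h2 : IntervalIntegrable (fun x => q x * negPow ν x) volume 0 a :=
    (intervalIntegrable_negPow hν _ _).continuousOn_mul (hq.mono hI)
  have h3 : IntervalIntegrable (fun x => q (-x) * negPow ν (-x)) volume 0 a := by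
    simpa using (h1.comp_mul_left (c := -1)).symm
  have hE : Set.EqOn (fun x => -(q (-x) * negPow ν (-x) + q x * negPow ν x))
      (fun x => -(branchPhase ν * q (-x) + q x) * ((x ^ (-ν) : ℝ) : ℂ)) (Set.uIoc 0 a) := by
    intro x hx
    rw [Set.uIoc_of_le ha.le] at hx
    simp only [negPow_neg hx.1, negPow_of_nonneg hx.1.le]
    ring
  refine ⟨h1.trans h2, (h3.add h2).neg.congr hE, ?_⟩
  rw [← intervalIntegral.integral_add_adjacent_intervals h1 h2,
    ← intervalIntegral.integral_congr_ae (Eventually.of_forall fun x hx => hE hx),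
    intervalIntegral.integral_neg, intervalIntegral.integral_add h3 h2,
    intervalIntegral.integral_comp_neg (fun x => q x * negPow ν x), neg_zero]

theorem summable_pow_mul_of_norm_le {ω r M : ℝ} {c : ℕ → ℂ} (hω : |ω| < r)
    (hc : ∀ k, ‖c k‖ ≤ M * r⁻¹ ^ k) : Summable fun k => (ω : ℂ) ^ k * c k := by
  have hr : 0 < r := (abs_nonneg ω).trans_lt hω
  refine Summable.of_norm_bounded (g := fun k => M * (|ω| / r) ^ k)
    ((summable_geometric_of_lt_one (by positivity) ((div_lt_one hr).2 hω)).mul_left M) fun k => ?_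
  rw [norm_mul, norm_pow, Complex.norm_real, Real.norm_eq_abs, div_eq_mul_inv, mul_pow]
  calc |ω| ^ k * ‖c k‖ ≤ |ω| ^ k * (M * r⁻¹ ^ k) := by gcongr; exact hc k
    _ = _ := by ring

/-- The factor `x` in `(x - ω) q` lowers the exponent and flips the sign on the negative half, thus
turning the `(k+1)`-st folded integrand of `x q` into the `k`-th of `q`. With the coefficients `d`
of `q`, the sum telescopes. -/
theorem tsum_pow_mul_folded {ν ω r a : ℝ} {f q : ℝ → ℂ} {c : ℕ → ℂ} (hν0 : 0 < ν) (hν : ν < 1)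
    (hω : |ω| < r) (hra : r ≤ a)
    (hq : ContinuousOn q (Set.Icc (-a) a)) (hTq : HasTaylorExpansion q r)
    (hfq : ∀ x, |x| ≤ a → f x = f ω + ((x : ℂ) - ω) * q x)
    (hc : ∀ k, HasFinitePartReal (foldedIntegrand ν f k) a (c k))
    (hsum : Summable fun k => (ω : ℂ) ^ k * c k) :
    ∑' k, (ω : ℂ) ^ k * c k =
      f ω * (∑' k, (ω : ℂ) ^ k * unitCoef ν a k) - ∫ x in (-a)..a, q x * negPow ν x := by
  have hr : 0 < r := (abs_nonneg ω).trans_lt hω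
  have ha : 0 < a := hr.trans_le hra
  obtain ⟨M, d, hd⟩ := exists_hasFinitePartReal_folded hν0 hν hr hra hq hTq
  obtain ⟨-, hB, hBe⟩ := integral_mul_negPow ha hν hq
  have hBF := IntervalIntegrable.hasFinitePartReal ha hB
  rw [hBe] at hBF
  set B := ∫ x in (-a)..a, q x * negPow ν x with hBdef
  have hfneg : ∀ x, 0 < x → x ≤ a → f (-x) = f ω - ((x : ℂ) + ω) * q (-x) := by
    intro x hx hxa
    rw [hfq (-x) (by rwa [abs_neg, abs_of_pos hx])]
    push_cast
    ring
  have hfpos : ∀ x, 0 < x → x ≤ a → f x = f ω + ((x : ℂ) - ω) * q x :=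
    fun x hx hxa => hfq x (by rwa [abs_of_pos hx])
  have hc0 : c 0 = f ω * unitCoef ν a 0 + -B + -ω * d 0 := by
    refine (hc 0).unique (((((hasFinitePartReal_unitCoef hν0 ha 0).const_mul (f ω)).add ha
      hBF).add ha ((hd 0).1.const_mul (-ω))).congr ha fun x hx hxa => ?_)
    have hx' : (x : ℂ) ≠ 0 := by exact_mod_cast hx.ne'
    have hx2 : ((x ^ ν : ℝ) : ℂ) ≠ 0 := by exact_mod_cast (Real.rpow_pos_of_pos hx ν).ne'
    simp only [foldedIntegrand, branchPhase, hfneg x hx hxa, hfpos x hx hxa]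
    rw [Real.rpow_neg hx.le, Nat.cast_zero, zero_add, Real.rpow_add hx, Real.rpow_one]
    push_cast
    field_simp
    ring
  have hcs : ∀ k, c (k + 1) = f ω * unitCoef ν a (k + 1) + d k + -ω * d (k + 1) := by
    intro k
    refine (hc (k + 1)).unique (((((hasFinitePartReal_unitCoef hν0 ha (k + 1)).const_mul
      (f ω)).add ha (hd k).1).add ha ((hd (k + 1)).1.const_mul (-ω))).congr ha fun x hx hxa => ?_)
    have hx' : (x : ℂ) ≠ 0 := by exact_mod_cast hx.ne'
    have hx2 : ((x ^ ((k : ℝ) + ν + 1) : ℝ) : ℂ) ≠ 0 := by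
      exact_mod_cast (Real.rpow_pos_of_pos hx _).ne'
    simp only [foldedIntegrand, hfneg x hx hxa, hfpos x hx hxa]
    rw [show ((k + 1 : ℕ) : ℝ) + ν + 1 = ((k : ℝ) + ν + 1) + 1 by push_cast; ring,
      Real.rpow_add hx _ 1, Real.rpow_one, pow_succ]
    push_cast
    field_simp
    ring
  -- After telescoping only `-ω^(K+1) d_K` is left over. It vanishes in the limit because `d_K` is
  -- at most `M r^(-K)` in norm and `|ω| < r`.
  have hpart : ∀ K : ℕ, ∑ k ∈ Finset.range (K + 1), (ω : ℂ) ^ k * c k =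
      f ω * (∑ k ∈ Finset.range (K + 1), (ω : ℂ) ^ k * unitCoef ν a k) - B -
        ω * ((ω : ℂ) ^ K * d K) := by
    intro K
    induction K with
    | zero => simp [hc0]; ring
    | succ K ih =>
      rw [Finset.sum_range_succ, ih, Finset.sum_range_succ _ (K + 1), hcs]
      ring
  have hu := (hasSum_unitCoef hν0 (hω.trans_le hra)).summable
  have t1 := hsum.hasSum.tendsto_sum_nat.comp (tendsto_add_atTop_nat 1)
  have t2 := hu.hasSum.tendsto_sum_nat.comp (tendsto_add_atTop_nat 1)
  have t3 := (summable_pow_mul_of_norm_le hω fun k => (hd k).2).tendsto_atTop_zero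
  have t4 := ((t2.const_mul (f ω)).sub_const B).sub (t3.const_mul (ω : ℂ))
  rw [mul_zero, sub_zero] at t4
  refine tendsto_nhds_unique t1 (t4.congr fun K => ?_)
  exact (hpart K).symm

/-- Off `ω` the integrand is `f(ω) x^(-ν)/(ω - x) - q(x) x^(-ν)`: the explicit constant case plus an
ordinary integral. At `ω = 0` the constant case is not available, hence the alternative `f ω = 0`.
-/
theorem hasPVReal_hilbertIntegrand {ν ω r a : ℝ} {f q : ℝ → ℂ} {c : ℕ → ℂ} (hν0 : 0 < ν)
    (hν : ν < 1) (hω : |ω| < r) (hra : r ≤ a) (hω0 : ω ≠ 0 ∨ f ω = 0)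
    (hf : ContinuousOn f (Set.Icc (-a) a)) (hTf : HasTaylorExpansion f r)
    (hq : ContinuousOn q (Set.Icc (-a) a)) (hTq : HasTaylorExpansion q r)
    (hfq : ∀ x, |x| ≤ a → f x = f ω + ((x : ℂ) - ω) * q x)
    (hc : ∀ k, HasFinitePartReal (foldedIntegrand ν f k) a (c k)) :
    (Summable fun k => (ω : ℂ) ^ k * c k) ∧
    HasPVReal (hilbertIntegrand f ν ω) ω a
      ((∑' k, (ω : ℂ) ^ k * c k) - Complex.I * Real.pi * (f ω * negPow ν ω)) := by
  have hr : 0 < r := (abs_nonneg ω).trans_lt hω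
  have ha : 0 < a := hr.trans_le hra
  have hωa := hω.trans_le hra
  obtain ⟨M, d, hd⟩ := exists_hasFinitePartReal_folded hν0 hν hr hra hf hTf
  -- Uniqueness of finite parts transfers the bound at radius `r` to the prescribed `c`, so the same
  -- coefficients serve every `ω`.
  have hsum : Summable fun k => (ω : ℂ) ^ k * c k :=
    summable_pow_mul_of_norm_le hω fun k => ((hc k).unique (hd k).1) ▸ (hd k).2
  refine ⟨hsum, ?_⟩
  rw [tsum_pow_mul_folded hν0 hν hω hra hq hTq hfq hc hsum]
  have hbase : HasPVReal (fun x : ℝ => f ω * (negPow ν x / ((ω : ℂ) - x))) ω a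
      (f ω * ((∑' k : ℕ, (ω : ℂ) ^ k * unitCoef ν a k) -
        Complex.I * Real.pi * negPow ν ω)) := by
    rcases hω0 with h | h
    · exact (hasPVReal_negPow hν0 hν h hωa).const_mul _
    · simp only [h, zero_mul]
      have := IntervalIntegrable.hasPVReal hωa
        (intervalIntegrable_const (c := (0 : ℂ)) (μ := volume))
      simpa using this
  have h := hbase.sub (IntervalIntegrable.hasPVReal hωa (integral_mul_negPow ha hν hq).1)
  have e : f ω * (∑' k, (ω : ℂ) ^ k * unitCoef ν a k) - (∫ x in (-a)..a, q x * negPow ν x) -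
      Complex.I * Real.pi * (f ω * negPow ν ω) = f ω * ((∑' k : ℕ, (ω : ℂ) ^ k * unitCoef ν a k) -
        Complex.I * Real.pi * negPow ν ω) - ∫ x in (-a)..a, q x * negPow ν x := by ring
  rw [e]
  refine h.congr hωa fun x hx hxω => ?_
  rw [hilbertIntegrand, hfq x hx]
  have : (ω : ℂ) - x ≠ 0 := sub_ne_zero.2 fun h => hxω (Complex.ofReal_injective h).symm
  field_simp
  ring

end FiniteInterval

/-! ### Taylor expansions and difference quotients of complex analytic functions -/

section ComplexAnalytic

theorem HasTaylorExpansion.congr {f g : ℝ → ℂ} {r : ℝ} (h : HasTaylorExpansion f r)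
    (he : ∀ x, |x| ≤ r → f x = g x) : HasTaylorExpansion g r := by
  obtain ⟨p, hp, hs⟩ := h
  exact ⟨p, hp, fun x hx => he x hx ▸ hs x hx⟩

theorem hasTaylorExpansion_of_differentiableOn {G : ℂ → ℂ} {r R : ℝ} (hr : 0 < r) (hrR : r < R)
    (hG : DifferentiableOn ℂ G (Metric.closedBall 0 R)) :
    HasTaylorExpansion (fun x : ℝ => G x) r := by
  lift R to NNReal using (hr.trans hrR).le
  lift r to NNReal using hr.le
  have hrR' : r < R := by exact_mod_cast hrR
  have h := hG.hasFPowerSeriesOnBall (lt_trans (by exact_mod_cast hr) hrR')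
  refine ⟨fun n => (cauchyPowerSeries G 0 R).coeff n, ?_, fun x hx => ?_⟩
  · have := (cauchyPowerSeries G 0 R).summable_norm_mul_pow (r := r)
      (lt_of_lt_of_le (by exact_mod_cast hrR') h.r_le)
    simpa [FormalMultilinearSeries.norm_apply_eq_norm_coef] using this
  · have hx' : (x : ℂ) ∈ Metric.eball (0 : ℂ) R := by
      rw [Metric.eball_coe, mem_ball_zero_iff, Complex.norm_real]
      exact lt_of_le_of_lt hx hrR
    have := h.hasSum hx'
    simp only [zero_add, FormalMultilinearSeries.apply_eq_pow_smul_coeff, smul_eq_mul] at this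
    exact this.congr_fun fun n => mul_comm _ _

theorem AnalyticAt.comp_ofReal_real {F : ℂ → ℂ} {x : ℝ} (h : AnalyticAt ℂ F x) :
    AnalyticAt ℝ (fun t : ℝ => F t) x :=
  AnalyticAt.comp (g := F) (f := fun t : ℝ => (t : ℂ)) h.restrictScalars
    (Complex.ofRealCLM.analyticAt x)

/-- `F` is known to be analytic only at the real points, so the identity theorem is applied on the
real interval, which is connected, to the restrictions as real analytic functions. -/
theorem eqOn_real_of_analytic {F G : ℂ → ℂ} {r : ℝ} (hr : 0 < r)
    (hF : ∀ x : ℝ, |x| < r → AnalyticAt ℂ F x) (hG : ∀ x : ℝ, |x| < r → AnalyticAt ℂ G x)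
    (h : ∀ᶠ x : ℝ in 𝓝 0, F x = G x) (x : ℝ) (hx : |x| < r) : F x = G x := by
  have hF' : AnalyticOnNhd ℝ (fun t : ℝ => F t) (Set.Ioo (-r) r) :=
    fun t ht => (hF t (abs_lt.2 ht)).comp_ofReal_real
  have hG' : AnalyticOnNhd ℝ (fun t : ℝ => G t) (Set.Ioo (-r) r) :=
    fun t ht => (hG t (abs_lt.2 ht)).comp_ofReal_real
  exact hF'.eqOn_of_preconnected_of_eventuallyEq hG' isPreconnected_Ioo
    (⟨by linarith, hr⟩ : (0 : ℝ) ∈ Set.Ioo (-r) r) h (abs_lt.1 hx)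

theorem IsComplexAnalyticOn.continuousOn {f : ℝ → ℂ} {s : Set ℝ} (h : IsComplexAnalyticOn f s) :
    ContinuousOn f s := by
  obtain ⟨F, hF, hFf⟩ := h
  refine ContinuousOn.congr (f := fun x : ℝ => F x) (fun x hx => ?_) fun x hx => (hFf x hx).symm
  exact (ContinuousAt.comp (hF x hx).continuousAt
    Complex.continuous_ofReal.continuousAt).continuousWithinAt

/-- `f` together with its difference quotient at `ω`, near `0` and on all of `[-A, A]`. -/
theorem exists_differenceQuotient {f : ℝ → ℂ} {A ω : ℝ} (hA : |ω| < A)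
    (hf : IsComplexAnalyticOn f (Set.Icc (-A) A)) (hω : ENNReal.ofReal |ω| < singularityDist f) :
    ∃ (r : ℝ) (q : ℝ → ℂ), |ω| < r ∧ r ≤ A ∧ HasTaylorExpansion f r ∧
      ContinuousOn q (Set.Icc (-A) A) ∧ HasTaylorExpansion q r ∧
      ∀ x, |x| ≤ A → f x = f ω + ((x : ℂ) - ω) * q x := by
  obtain ⟨F, hF, hFf⟩ := hf
  have hA0 : 0 < A := (abs_nonneg ω).trans_lt hA
  -- `G` extends the germ to a disc reaching beyond `|ω|`, while `F` lives near all of `[-A, A]`.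
  -- The radius `R` fits inside both, so `G` supplies the power series and `F` the continuity up to
  -- the ends.
  obtain ⟨R', ⟨G, hG, hGf⟩, hωR'⟩ := lt_sSup_iff.1 hω
  have hmin : ENNReal.ofReal |ω| < min (ENNReal.ofReal A) R' :=
    lt_min ((ENNReal.ofReal_lt_ofReal_iff hA0).2 hA) hωR'
  obtain ⟨R, hR1, hR2⟩ := ENNReal.lt_iff_exists_nnreal_btwn.1 hmin
  have hωR : |ω| < R := by
    have := (ENNReal.ofReal_lt_iff_lt_toReal (abs_nonneg ω) ENNReal.coe_ne_top).1 hR1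
    simpa using this
  have hRA : (R : ℝ) < A := by
    have h := hR2.trans_le (min_le_left _ _)
    rw [← ENNReal.ofReal_coe_nnreal] at h
    exact (ENNReal.ofReal_lt_ofReal_iff hA0).1 h
  have hsub : Metric.closedBall (0 : ℂ) R ⊆ Metric.eball 0 R' := by
    rw [← Metric.closedEBall_coe]
    intro z hz
    exact lt_of_le_of_lt hz (hR2.trans_le (min_le_right _ _))
  have hR0 : (0 : ℝ) < R := (abs_nonneg ω).trans_lt hωR
  have hmemA : ∀ x : ℝ, |x| < R → x ∈ Set.Icc (-A) A := fun x hx => abs_le.1 (hx.le.trans hRA.le)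
  have hGa : ∀ x : ℝ, |x| < R → AnalyticAt ℂ G x := fun x hx => hG _ (hsub (by
    rw [mem_closedBall_zero_iff, Complex.norm_real]; exact hx.le))
  have hFG : ∀ x : ℝ, |x| < R → F x = G x := by
    refine eqOn_real_of_analytic hR0 (fun x hx => hF x (hmemA x hx)) hGa ?_
    filter_upwards [hGf, Ioo_mem_nhds (neg_lt_zero.2 hR0) hR0] with x hx hx'
    rw [hx, hFf x (hmemA x (abs_lt.2 hx'))]
  have hGd : DifferentiableOn ℂ G (Metric.closedBall 0 R) :=
    fun z hz => (hG z (hsub hz)).differentiableAt.differentiableWithinAt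
  have hnhds : Metric.closedBall (0 : ℂ) R ∈ 𝓝 (ω : ℂ) :=
    Metric.closedBall_mem_nhds_of_mem (by rw [mem_ball_zero_iff, Complex.norm_real]; exact hωR)
  -- The singularity of the difference quotient at `ω` is removable, so its Taylor series at `0`
  -- converges on the same disc as that of `G`.
  have hdG : DifferentiableOn ℂ (dslope G ω) (Metric.closedBall 0 R) :=
    (Complex.differentiableOn_dslope hnhds).2 hGd
  have hωA : ω ∈ Set.Icc (-A) A := hmemA ω hωR
  obtain ⟨r, hr1, hr2⟩ := exists_between hωR
  have hr0 : 0 < r := (abs_nonneg ω).trans_lt hr1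
  refine ⟨r, fun x => dslope F ω x, hr1, (hr2.trans hRA).le, ?_, ?_, ?_, ?_⟩
  · refine (hasTaylorExpansion_of_differentiableOn hr0 hr2 hGd).congr fun x hx => ?_
    rw [← hFG x (hx.trans_lt hr2), hFf x (hmemA x (hx.trans_lt hr2))]
  · intro x hx
    refine (ContinuousAt.comp (g := dslope F ω) ?_
      Complex.continuous_ofReal.continuousAt).continuousWithinAt
    rcases eq_or_ne x ω with rfl | hne
    · exact continuousAt_dslope_same.2 (hF x hx).differentiableAt
    · exact (continuousAt_dslope_of_ne fun h => hne (Complex.ofReal_injective h)).2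
        (hF x hx).continuousAt
  · refine (hasTaylorExpansion_of_differentiableOn hr0 hr2 hdG).congr fun x hx => ?_
    rcases eq_or_ne x ω with rfl | hne
    · rw [dslope_same, dslope_same]
      -- At `x = ω` the quotients are the derivatives of `G` and `F`. Both are determined by the
      -- common restriction to the real line.
      have h1 := (hGa x hωR).differentiableAt.hasDerivAt.comp_ofReal
      have h2 := (hF x hωA).differentiableAt.hasDerivAt.comp_ofReal
      refine h1.unique (h2.congr_of_eventuallyEq ?_)
      filter_upwards [Ioo_mem_nhds (neg_lt_of_abs_lt hωR) (lt_of_abs_lt hωR)] with t ht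
      exact (hFG t (abs_lt.2 ht)).symm
    · have hne' : (x : ℂ) ≠ ω := fun h => hne (Complex.ofReal_injective h)
      rw [dslope_of_ne _ hne', dslope_of_ne _ hne', slope_def_field, slope_def_field,
        hFG x (hx.trans_lt hr2), hFG ω hωR]
  · intro x hx
    have := sub_smul_dslope F (ω : ℂ) (x : ℂ)
    rw [smul_eq_mul, hFf x (abs_le.1 hx), hFf ω hωA] at this
    rw [this, add_sub_cancel]

theorem singularityDist_pos {f : ℝ → ℂ} {A : ℝ} (hA : 0 < A)
    (hf : IsComplexAnalyticOn f (Set.Icc (-A) A)) : 0 < singularityDist f := by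
  obtain ⟨F, hF, hFf⟩ := hf
  obtain ⟨ε, hε, hball⟩ := Metric.eventually_nhds_iff_ball.1
    (hF 0 ⟨by linarith, hA.le⟩).eventually_analyticAt
  refine lt_sSup_iff.2 ⟨ENNReal.ofReal ε, ⟨F, ?_, ?_⟩, ENNReal.ofReal_pos.2 hε⟩
  · rw [Metric.eball_ofReal]
    intro z hz
    exact hball z (by simpa using hz)
  · filter_upwards [Ioo_mem_nhds (neg_lt_zero.2 hA) hA] with x hx
    exact hFf x ⟨hx.1.le, hx.2.le⟩

/-- The coefficients are fixed once, from the Taylor expansion at some small radius. For each `ω` a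
larger radius beyond `|ω|` is then used to bound and sum the same coefficients. -/
theorem exists_folded_coefficients_real {ν A : ℝ} {f : ℝ → ℂ} (hν0 : 0 < ν) (hν : ν < 1)
    (hA : 0 < A) (hf : IsComplexAnalyticOn f (Set.Icc (-A) A)) :
    ∃ c : ℕ → ℂ, (∀ k, HasFinitePartReal (foldedIntegrand ν f k) A (c k)) ∧
      ∀ ω : ℝ, (ω ≠ 0 ∨ f 0 = 0) → |ω| < A → ENNReal.ofReal |ω| < singularityDist f →
        (Summable fun k => (ω : ℂ) ^ k * c k) ∧
        HasPVReal (hilbertIntegrand f ν ω) ω A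
          ((∑' k, (ω : ℂ) ^ k * c k) - Complex.I * Real.pi * (f ω * negPow ν ω)) := by
  have hc := hf.continuousOn
  obtain ⟨r, q, hr1, hr2, hT, -⟩ := exists_differenceQuotient (ω := 0) (by simpa using hA) hf
    (by simpa using singularityDist_pos hA hf)
  obtain ⟨M, c, hcM⟩ := exists_hasFinitePartReal_folded hν0 hν (by simpa using hr1) hr2 hc hT
  refine ⟨c, fun k => (hcM k).1, fun ω hω0 hωA hωs => ?_⟩
  obtain ⟨r, q, hr1, hr2, hT, hq, hTq, hfq⟩ := exists_differenceQuotient hωA hf hωs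
  refine hasPVReal_hilbertIntegrand hν0 hν hr1 hr2 ?_ hc hT hq hTq hfq fun k => (hcM k).1
  rcases eq_or_ne ω 0 with rfl | h
  · exact Or.inr (hω0.resolve_left (by simp))
  · exact Or.inl h

end ComplexAnalytic

/-! ### Abel's test for convergence at infinity -/

section AbelTest

theorem exists_bound_of_continuous_of_tendsto {Φ : ℝ → ℂ} {b : ℝ} {L : ℂ} (hΦ : Continuous Φ)
    (hL : Tendsto Φ atTop (𝓝 L)) : ∃ M, 0 ≤ M ∧ ∀ x, b ≤ x → ‖Φ x‖ ≤ M := by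
  have h1 : ∀ᶠ x in atTop, ‖Φ x‖ < ‖L‖ + 1 := hL.norm.eventually_lt_const (by linarith)
  obtain ⟨B, hB⟩ := eventually_atTop.1 h1
  obtain ⟨C, hC⟩ := isCompact_Icc.exists_bound_of_continuousOn (hΦ.continuousOn (s := Set.Icc b B))
  refine ⟨max (‖L‖ + 1) C, le_max_of_le_left (by positivity), fun x hx => ?_⟩
  rcases le_total B x with h | h
  · exact le_max_of_le_left (hB x h).le
  · exact le_max_of_le_right (hC x ⟨hx, h⟩)

/-- Integrate by parts against the bounded primitive `Φ`: the boundary term is `Φ(A) A^(-k)` and the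
integral is `k ∫ Φ x^(-k-1)`, absolutely convergent for `k ≥ 1`. Each is at most `M b^(-k)` in norm
for a bound `M` of `Φ`, whence the constant `M + M`. -/
theorem abel_test_of_continuous {φ : ℝ → ℂ} {b : ℝ} {L : ℂ} (hb : 0 < b) (hφ : Continuous φ)
    (hL : Tendsto (fun A => ∫ x in b..A, φ x) atTop (𝓝 L)) :
    ∃ M, ∀ k : ℕ, (∃ L', Tendsto (fun A => ∫ x in b..A, φ x * ((x ^ k)⁻¹ : ℝ)) atTop (𝓝 L')) ∧
      ∀ A, b ≤ A → ‖∫ x in b..A, φ x * ((x ^ k)⁻¹ : ℝ)‖ ≤ M * b⁻¹ ^ k := by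
  set Φ : ℝ → ℂ := fun A => ∫ x in b..A, φ x with hΦ
  have hder : ∀ x, HasDerivAt Φ (φ x) x := fun x => hφ.integral_hasStrictDerivAt b x |>.hasDerivAt
  have hcont : Continuous Φ := continuous_iff_continuousAt.2 fun x => (hder x).continuousAt
  obtain ⟨M, hM0, hM⟩ := exists_bound_of_continuous_of_tendsto (b := b) hcont hL
  refine ⟨M + M, fun k => ?_⟩
  rcases Nat.eq_zero_or_pos k with rfl | hk
  · simp only [pow_zero, inv_one, Complex.ofReal_one, mul_one]
    exact ⟨⟨L, hL⟩, fun A hA => by linarith [hM A hA]⟩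
  obtain ⟨j, rfl⟩ : ∃ j, k = j + 1 := ⟨k - 1, by omega⟩
  set w : ℝ → ℝ := fun x => (j + 1 : ℕ) * (x ^ (j + 2))⁻¹ with hw
  have hvder : ∀ x : ℝ, 0 < x → HasDerivAt (fun t : ℝ => (t ^ (j + 1))⁻¹) (-w x) x := by
    intro x hx
    refine ((hasDerivAt_pow (j + 1) x).inv (pow_ne_zero _ hx.ne')).congr_deriv ?_
    rw [hw, Nat.add_sub_cancel]
    field_simp
    ring
  have hpos : ∀ A, b ≤ A → ∀ x ∈ Set.uIcc b A, 0 < x := by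
    intro A hA x hx
    rw [Set.uIcc_of_le hA] at hx
    exact hb.trans_le hx.1
  have hwc : ContinuousOn w (Set.Ici b) := by
    refine continuousOn_const.mul (ContinuousOn.inv₀ (by fun_prop) fun x hx => ?_)
    exact pow_ne_zero _ (hb.trans_le hx).ne'
  have hw0 : ∀ x, b ≤ x → 0 ≤ w x := fun x hx => by
    have := hb.trans_le hx
    simp only [hw]; positivity
  have hwi : ∀ A, b ≤ A → IntervalIntegrable w volume b A := fun A hA =>
    (hwc.mono (by rw [Set.uIcc_of_le hA]; exact Set.Icc_subset_Ici_self)).intervalIntegrable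
  have hwint : ∀ A, b ≤ A → ∫ x in b..A, w x = (b ^ (j + 1))⁻¹ - (A ^ (j + 1))⁻¹ := by
    intro A hA
    rw [intervalIntegral.integral_eq_sub_of_hasDerivAt (f := fun t => -(t ^ (j + 1))⁻¹)
      (fun x hx => by simpa using (hvder x (hpos A hA x hx)).fun_neg) (hwi A hA)]
    ring
  have hparts : ∀ A, b ≤ A → ∫ x in b..A, φ x * ((x ^ (j + 1))⁻¹ : ℝ) =
      Φ A * ((A ^ (j + 1))⁻¹ : ℝ) + ∫ x in b..A, Φ x * (w x : ℂ) := by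
    intro A hA
    have h := intervalIntegral.integral_deriv_mul_eq_sub (a := b) (b := A) (u := Φ)
      (v := fun t : ℝ => (((t ^ (j + 1))⁻¹ : ℝ) : ℂ)) (u' := φ) (v' := fun x => ((-w x : ℝ) : ℂ))
      (fun x _ => (hder x))
      (fun x hx => (hvder x (hpos A hA x hx)).ofReal_comp)
      (hφ.intervalIntegrable _ _) ⟨(hwi A hA).neg.1.ofReal, (hwi A hA).neg.2.ofReal⟩
    have hi1 : IntervalIntegrable (fun x => φ x * (((x ^ (j + 1))⁻¹ : ℝ) : ℂ)) volume b A := by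
      refine ContinuousOn.intervalIntegrable (hφ.continuousOn.mul
        (Complex.continuous_ofReal.comp_continuousOn (ContinuousOn.inv₀ (by fun_prop)
          fun x hx => pow_ne_zero _ (hpos A hA x hx).ne')))
    have hi2 : IntervalIntegrable (fun x => Φ x * ((-w x : ℝ) : ℂ)) volume b A := by
      refine ContinuousOn.intervalIntegrable (hcont.continuousOn.mul
        (Complex.continuous_ofReal.comp_continuousOn (hwc.mono ?_).neg))
      rw [Set.uIcc_of_le hA]; exact Set.Icc_subset_Ici_self
    rw [intervalIntegral.integral_add hi1 hi2] at h
    have hΦb : Φ b = 0 := intervalIntegral.integral_same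
    have h2 : ∫ x in b..A, Φ x * ((-w x : ℝ) : ℂ) = -∫ x in b..A, Φ x * (w x : ℂ) := by
      rw [← intervalIntegral.integral_neg]
      congr 1; funext x; push_cast; ring
    rw [h2, hΦb, zero_mul, sub_zero] at h
    linear_combination h
  have hinvle : ∀ A, b ≤ A → (A ^ (j + 1))⁻¹ ≤ b⁻¹ ^ (j + 1) := by
    intro A hA
    rw [inv_pow]
    gcongr
  have hinv0 : ∀ A, b ≤ A → 0 ≤ (A ^ (j + 1))⁻¹ := fun A hA => by
    have := hb.trans_le hA
    positivity
  refine ⟨?_, fun A hA => ?_⟩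
  · have hint : IntegrableOn (fun x => Φ x * (w x : ℂ)) (Set.Ioi b) := by
      have hwI : IntegrableOn w (Set.Ioi b) := by
        have h := (integrableOn_Ioi_rpow_of_lt (a := -((j + 2 : ℕ) : ℝ))
          (by push_cast; have : (0 : ℝ) ≤ j := j.cast_nonneg
              linarith) hb).const_mul ((j + 1 : ℕ) : ℝ)
        refine IntegrableOn.congr_fun h (fun x hx => ?_) measurableSet_Ioi
        simp only [hw]
        rw [Real.rpow_neg (hb.trans hx).le, Real.rpow_natCast]
      refine Integrable.mono' (hwI.const_mul M) ?_ ?_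
      · refine ContinuousOn.aestronglyMeasurable ?_ measurableSet_Ioi
        exact hcont.continuousOn.mul (Complex.continuous_ofReal.comp_continuousOn
          (hwc.mono Set.Ioi_subset_Ici_self))
      · refine (ae_restrict_iff' measurableSet_Ioi).2 (Eventually.of_forall fun x hx => ?_)
        have hx' : b ≤ x := le_of_lt hx
        rw [norm_mul, Complex.norm_real, Real.norm_of_nonneg (hw0 x hx')]
        exact mul_le_mul_of_nonneg_right (hM x hx') (hw0 x hx')
    have hlim0 : Tendsto (fun A : ℝ => (((A ^ (j + 1))⁻¹ : ℝ) : ℂ)) atTop (𝓝 0) := by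
      have := (tendsto_pow_atTop (α := ℝ) (Nat.succ_ne_zero j)).inv_tendsto_atTop
      have h2 := (Complex.continuous_ofReal.tendsto 0).comp this
      simpa [Function.comp_def] using h2
    refine ⟨_, ((hL.mul hlim0).add
      (intervalIntegral_tendsto_integral_Ioi b hint tendsto_id)).congr' ?_⟩
    filter_upwards [eventually_ge_atTop b] with A hA
    exact (hparts A hA).symm
  · rw [hparts A hA, add_mul]
    refine (norm_add_le _ _).trans (add_le_add ?_ ?_)
    · rw [norm_mul, Complex.norm_real, Real.norm_of_nonneg (hinv0 A hA)]
      exact mul_le_mul (hM A hA) (hinvle A hA) (hinv0 A hA) hM0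
    · refine (intervalIntegral.norm_integral_le_of_norm_le hA (g := fun x => M * w x)
        (Eventually.of_forall fun x hx => ?_) ((hwi A hA).const_mul M)).trans ?_
      · rw [norm_mul, Complex.norm_real, Real.norm_of_nonneg (hw0 x hx.1.le)]
        exact mul_le_mul_of_nonneg_right (hM x hx.1.le) (hw0 x hx.1.le)
      · rw [intervalIntegral.integral_const_mul, hwint A hA, inv_pow]
        refine mul_le_mul_of_nonneg_left ?_ hM0
        linarith [hinv0 A hA]

/-- Abel's test for the weights `x ^ (-k)`, with a bound that is uniform in the upper limit. -/
theorem abel_test {φ : ℝ → ℂ} {b : ℝ} {L : ℂ} (hb : 0 < b) (hφ : ContinuousOn φ (Set.Ici b))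
    (hL : Tendsto (fun A => ∫ x in b..A, φ x) atTop (𝓝 L)) :
    ∃ M, ∀ k : ℕ, (∃ L', Tendsto (fun A => ∫ x in b..A, φ x * ((x ^ k)⁻¹ : ℝ)) atTop (𝓝 L')) ∧
      ∀ A, b ≤ A → ‖∫ x in b..A, φ x * ((x ^ k)⁻¹ : ℝ)‖ ≤ M * b⁻¹ ^ k := by
  -- Freezing `φ` at its value `φ(b)` to the left of `b` gives a function continuous on the whole
  -- line with the same integrals, so its primitive is differentiable also at `b`.
  have hE : ∀ (w : ℝ → ℂ) (A : ℝ), b ≤ A →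
      ∫ x in b..A, φ (max b x) * w x = ∫ x in b..A, φ x * w x := by
    intro w A hA
    refine intervalIntegral.integral_congr fun x hx => ?_
    rw [Set.uIcc_of_le hA] at hx
    simp only [max_eq_right hx.1]
  have hL' : Tendsto (fun A => ∫ x in b..A, φ (max b x)) atTop (𝓝 L) := by
    refine hL.congr' ?_
    filter_upwards [eventually_ge_atTop b] with A hA
    simpa using (hE (fun _ => 1) A hA).symm
  obtain ⟨M, hM⟩ := abel_test_of_continuous hb
    (hφ.comp_continuous (by fun_prop) fun x => le_max_left b x) hL'
  refine ⟨M, fun k => ⟨?_, fun A hA => ?_⟩⟩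
  · obtain ⟨L', h⟩ := (hM k).1
    refine ⟨L', h.congr' ?_⟩
    filter_upwards [eventually_ge_atTop b] with A hA
    exact hE _ A hA
  · rw [← hE _ A hA]
    exact (hM k).2 A hA

end AbelTest

/-! ### Passage to the whole line -/

section InfiniteInterval

theorem HasPVReal.sub_eq {h : ℝ → ℂ} {ω b A : ℝ} {V W : ℂ} (hV : HasPVReal h ω A V) (hW : HasPVReal h ω b W)
    (h1 : IntervalIntegrable h volume (-A) (-b)) (h2 : IntervalIntegrable h volume b A) :
    V - W = (∫ x in b..A, h (-x)) + ∫ x in b..A, h x := by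
  refine tendsto_nhds_unique (hV.2.sub hW.2) (tendsto_const_nhds.congr' ?_)
  filter_upwards [hV.1, hW.1] with δ hA hB
  rw [← intervalIntegral.integral_add_adjacent_intervals h1 hB.1,
    ← intervalIntegral.integral_add_adjacent_intervals hB.2 h2,
    intervalIntegral.integral_comp_neg]
  ring

theorem continuousAt_ofReal_rpow {x : ℝ} (hx : 0 < x) (s : ℝ) :
    ContinuousAt (fun t : ℝ => ((t ^ s : ℝ) : ℂ)) x :=
  Complex.continuous_ofReal.continuousAt.comp (Real.continuousAt_rpow_const _ _ (Or.inl hx.ne'))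

theorem continuousOn_foldedIntegrand {ν b : ℝ} {f : ℝ → ℂ} (hf : Continuous f) (hb : 0 < b)
    (k : ℕ) : ContinuousOn (foldedIntegrand ν f k) (Set.Ici b) := by
  intro x hx
  have hx0 : 0 < x := hb.trans_le hx
  refine ContinuousAt.continuousWithinAt ?_
  refine ContinuousAt.div (by fun_prop) (continuousAt_ofReal_rpow hx0 _) ?_
  exact_mod_cast (Real.rpow_pos_of_pos hx0 _).ne'

/-- The sign `(-1)^k` depends only on the parity of `k`, so all convergence questions at infinity
reduce to `k = 0` and `k = 1` by Abel's test with weights `x^(-2j)`. -/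
theorem foldedIntegrand_add_two_mul {ν x : ℝ} (f : ℝ → ℂ) (hx : 0 < x) (i j : ℕ) :
    foldedIntegrand ν f (i + 2 * j) x = foldedIntegrand ν f i x * (((x ^ (2 * j))⁻¹ : ℝ) : ℂ) := by
  rw [foldedIntegrand, foldedIntegrand, pow_add, pow_mul (-1 : ℂ), neg_one_sq, one_pow, mul_one,
    show ((i + 2 * j : ℕ) : ℝ) + ν + 1 = ((i : ℝ) + ν + 1) + (2 * j : ℕ) by push_cast; ring,
    Real.rpow_add hx, Real.rpow_natCast]
  push_cast
  rw [← div_div, div_eq_mul_inv _ ((x : ℂ) ^ (2 * j))]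

/-- The Hilbert integrand, folded onto the positive half-line beyond its singularity. -/
theorem hilbertIntegrand_add_neg {ν ω x : ℝ} (f : ℝ → ℂ) (hx : |ω| < x) :
    hilbertIntegrand f ν ω (-x) + hilbertIntegrand f ν ω x =
      (foldedIntegrand ν f 0 x + ω * foldedIntegrand ν f 1 x) *
        ((x ^ 2 / (x ^ 2 - ω ^ 2) : ℝ) : ℂ) := by
  have hx0 : 0 < x := (abs_nonneg ω).trans_lt hx
  have h1 := neg_lt_of_abs_lt hx
  have h2 := lt_of_abs_lt hx
  have n1 : (ω : ℂ) - x ≠ 0 := by exact_mod_cast (sub_neg.2 h2).ne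
  have n2 : (ω : ℂ) + x ≠ 0 := by
    have : ω + x ≠ 0 := by linarith
    exact_mod_cast this
  have n3 : (x : ℂ) ^ 2 - (ω : ℂ) ^ 2 ≠ 0 := by
    have : (x : ℂ) ^ 2 - (ω : ℂ) ^ 2 = -((ω - x) * (ω + x)) := by ring
    rw [this]
    exact neg_ne_zero.2 (mul_ne_zero n1 n2)
  have hx' : (x : ℂ) ≠ 0 := by exact_mod_cast hx0.ne'
  have hxν : ((x ^ ν : ℝ) : ℂ) ≠ 0 := by exact_mod_cast (Real.rpow_pos_of_pos hx0 ν).ne'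
  rw [hilbertIntegrand, hilbertIntegrand, negPow_neg hx0, negPow_of_nonneg hx0.le, foldedIntegrand,
    foldedIntegrand, Real.rpow_neg hx0.le, Nat.cast_zero, zero_add, Nat.cast_one,
    Real.rpow_add hx0, Real.rpow_add hx0, Real.rpow_add hx0, Real.rpow_one, branchPhase]
  push_cast
  rw [sub_neg_eq_add, pow_zero, pow_one]
  field_simp
  ring

theorem continuousOn_hilbertIntegrand {ν ω : ℝ} {f : ℝ → ℂ} (hf : Continuous f) {s : Set ℝ}
    (h0 : 0 ∉ s) (hω : ω ∉ s) : ContinuousOn (hilbertIntegrand f ν ω) s := by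
  intro x hx
  have hx0 : x ≠ 0 := fun h => h0 (h ▸ hx)
  have hxω : (ω : ℂ) - x ≠ 0 := sub_ne_zero.2 fun h => hω ((Complex.ofReal_injective h) ▸ hx)
  refine ContinuousAt.continuousWithinAt (ContinuousAt.div (hf.continuousAt.mul ?_)
    (by fun_prop) hxω)
  rw [show negPow ν = fun x : ℝ => (x : ℂ) ^ (-ν : ℂ) from funext negPow_eq_cpow]
  rcases lt_or_gt_of_ne hx0 with h | h
  · have hE : (fun t : ℝ => (t : ℂ) ^ (-ν : ℂ)) =ᶠ[𝓝 x]
        fun t => branchPhase ν * (((-t) ^ (-ν) : ℝ) : ℂ) := by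
      filter_upwards [Iio_mem_nhds h] with t ht
      have ht' : 0 < -t := neg_pos.2 ht
      rw [← negPow_eq_cpow, ← negPow_neg ht', neg_neg]
    refine ContinuousAt.congr ?_ hE.symm
    exact continuousAt_const.mul (ContinuousAt.comp (f := fun t : ℝ => -t)
      (g := fun t : ℝ => ((t ^ (-ν) : ℝ) : ℂ)) (continuousAt_ofReal_rpow (neg_pos.2 h) _)
      (by fun_prop))
  · have hE : (fun t : ℝ => (t : ℂ) ^ (-ν : ℂ)) =ᶠ[𝓝 x] fun t => ((t ^ (-ν) : ℝ) : ℂ) := by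
      filter_upwards [Ioi_mem_nhds h] with t ht
      rw [← negPow_eq_cpow, negPow_of_nonneg (le_of_lt ht)]
    exact (continuousAt_ofReal_rpow h _).congr hE.symm

/-- Existence of the principal value over the line gives convergence of the folded integral. -/
theorem exists_tendsto_folded_of_hasPV {ν ω b : ℝ} {f : ℝ → ℂ} (hf : Continuous f)
    (hb : |ω| < b) {V : ℂ} (hV : HasPV (hilbertIntegrand f ν ω) ω ⊤ V) :
    ∃ L, Tendsto (fun A => ∫ x in b..A, (foldedIntegrand ν f 0 x + ω * foldedIntegrand ν f 1 x) *
        ((x ^ 2 / (x ^ 2 - ω ^ 2) : ℝ) : ℂ)) atTop (𝓝 L) := by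
  obtain ⟨F, hF, hFV⟩ := hV
  have hb0 : 0 < b := (abs_nonneg ω).trans_lt hb
  refine ⟨V - F b, (hFV.sub_const (F b)).congr' ?_⟩
  filter_upwards [eventually_ge_atTop b] with A hA
  have hi1 : IntervalIntegrable (hilbertIntegrand f ν ω) volume (-A) (-b) := by
    refine (continuousOn_hilbertIntegrand hf ?_ ?_).intervalIntegrable
    · exact Set.notMem_uIcc_of_gt (by linarith) (by linarith)
    · exact Set.notMem_uIcc_of_gt (by linarith [neg_lt_of_abs_lt hb])
        (by linarith [neg_lt_of_abs_lt hb])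
  have hi2 : IntervalIntegrable (hilbertIntegrand f ν ω) volume b A := by
    refine (continuousOn_hilbertIntegrand hf ?_ ?_).intervalIntegrable
    · exact Set.notMem_uIcc_of_lt (by linarith) (by linarith)
    · exact Set.notMem_uIcc_of_lt (by linarith [lt_of_abs_lt hb])
        (by linarith [lt_of_abs_lt hb])
  have hi3 : IntervalIntegrable (fun x => hilbertIntegrand f ν ω (-x)) volume b A := by
    simpa using (hi1.comp_mul_left (c := -1)).symm
  rw [HasPVReal.sub_eq (hF A (hb.trans_le hA)) (hF b hb) hi1 hi2,
    ← intervalIntegral.integral_add hi3 hi2]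
  refine intervalIntegral.integral_congr fun x hx => ?_
  rw [Set.uIcc_of_le hA] at hx
  exact hilbertIntegrand_add_neg f (hb.trans_le hx.1)

/-- If `ψ` is the weighted function then `φ = ψ - ω² ψ / x²`; the second term converges by Abel's
test. -/
theorem exists_tendsto_of_tendsto_mul_ratio {φ : ℝ → ℂ} {ω b : ℝ} {L : ℂ} (hb : |ω| < b)
    (hφ : ContinuousOn φ (Set.Ici b))
    (hL : Tendsto (fun A => ∫ x in b..A, φ x * ((x ^ 2 / (x ^ 2 - ω ^ 2) : ℝ) : ℂ)) atTop (𝓝 L)) :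
    ∃ L', Tendsto (fun A => ∫ x in b..A, φ x) atTop (𝓝 L') := by
  have hb0 : 0 < b := (abs_nonneg ω).trans_lt hb
  have hden : ∀ x ∈ Set.Ici b, x ^ 2 - ω ^ 2 ≠ 0 := by
    intro x hx
    have h1 := neg_lt_of_abs_lt (hb.trans_le hx)
    have h2 := lt_of_abs_lt (hb.trans_le hx)
    nlinarith
  have hψ : ContinuousOn (fun x => φ x * ((x ^ 2 / (x ^ 2 - ω ^ 2) : ℝ) : ℂ)) (Set.Ici b) :=
    hφ.mul (Complex.continuous_ofReal.comp_continuousOn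
      (ContinuousOn.div (by fun_prop) (by fun_prop) hden))
  obtain ⟨M, hM⟩ := abel_test hb0 hψ hL
  obtain ⟨L', hL'⟩ := (hM 2).1
  refine ⟨_, (hL.sub (hL'.const_mul ((ω : ℂ) ^ 2))).congr' ?_⟩
  filter_upwards [eventually_ge_atTop b] with A hA
  have hsub : Set.uIcc b A ⊆ Set.Ici b := by
    rw [Set.uIcc_of_le hA]; exact Set.Icc_subset_Ici_self
  have hinv : ContinuousOn (fun x : ℝ => (((x ^ 2)⁻¹ : ℝ) : ℂ)) (Set.uIcc b A) :=
    Complex.continuous_ofReal.comp_continuousOn (ContinuousOn.inv₀ (by fun_prop)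
      fun x hx => pow_ne_zero _ (hb0.trans_le (hsub hx)).ne')
  have hi : IntervalIntegrable (fun x => φ x * ((x ^ 2 / (x ^ 2 - ω ^ 2) : ℝ) : ℂ) *
      (((x ^ 2)⁻¹ : ℝ) : ℂ)) volume b A := ((hψ.mono hsub).mul hinv).intervalIntegrable
  rw [← intervalIntegral.integral_const_mul, ← intervalIntegral.integral_sub
    (hψ.mono hsub).intervalIntegrable (hi.const_mul _)]
  refine intervalIntegral.integral_congr fun x hx => ?_
  have hx0 : (x : ℂ) ≠ 0 := by exact_mod_cast (hb0.trans_le (hsub hx)).ne'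
  have hd : (x : ℂ) ^ 2 - (ω : ℂ) ^ 2 ≠ 0 := by exact_mod_cast hden x (hsub hx)
  push_cast
  field_simp

/-- Folding the principal values at `t` and `-t` gives the integrals of `φ₀ + t φ₁` and `φ₀ - t φ₁`
with the same weight `x²/(x² - t²)`, where `φ₀`, `φ₁` are the folded integrands for `k = 0, 1`.
Half-sum and half-difference separate them, and Abel's test handles the higher `k`. -/
theorem exists_folded_tail_bound {ν b : ℝ} {f : ℝ → ℂ} (hf : Continuous f) (hb : 0 < b)
    (hs : 0 < singularityDist f)
    (hPV : ∀ ω : ℝ, ω ≠ 0 → ENNReal.ofReal |ω| < singularityDist f →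
      ∃ V : ℂ, HasPV (hilbertIntegrand f ν ω) ω ⊤ V) :
    ∃ M, ∀ k : ℕ, (∃ L, Tendsto (fun A => ∫ x in b..A, foldedIntegrand ν f k x) atTop (𝓝 L)) ∧
      ∀ A, b ≤ A → ‖∫ x in b..A, foldedIntegrand ν f k x‖ ≤ M * b⁻¹ ^ k := by
  obtain ⟨t, ht0, ht⟩ : ∃ t : ℝ, 0 < t ∧ t < b ∧ ENNReal.ofReal t < singularityDist f := by
    obtain ⟨s, hs0, hs1⟩ := ENNReal.lt_iff_exists_nnreal_btwn.1
      (lt_min (ENNReal.ofReal_pos.2 hb) hs)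
    refine ⟨s, by exact_mod_cast hs0, ?_, ?_⟩
    · have h := hs1.trans_le (min_le_left _ _)
      rw [← ENNReal.ofReal_coe_nnreal] at h
      exact (ENNReal.ofReal_lt_ofReal_iff hb).1 h
    · rw [ENNReal.ofReal_coe_nnreal]
      exact hs1.trans_le (min_le_right _ _)
  have hta : |t| = t := abs_of_pos ht0
  obtain ⟨V1, hV1⟩ := hPV t ht0.ne' (by rw [hta]; exact ht.2)
  obtain ⟨V2, hV2⟩ := hPV (-t) (neg_ne_zero.2 ht0.ne') (by rw [abs_neg, hta]; exact ht.2)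
  have hbt : |t| < b := by rw [hta]; exact ht.1
  obtain ⟨L1, hL1⟩ := exists_tendsto_folded_of_hasPV hf hbt hV1
  obtain ⟨L2, hL2⟩ := exists_tendsto_folded_of_hasPV hf (by rwa [abs_neg]) hV2
  have hc := fun k => continuousOn_foldedIntegrand (ν := ν) hf hb k
  set ρ : ℝ → ℂ := fun x => ((x ^ 2 / (x ^ 2 - t ^ 2) : ℝ) : ℂ) with hρ
  have hρc : ContinuousOn ρ (Set.Ici b) := by
    refine Complex.continuous_ofReal.comp_continuousOn
      (ContinuousOn.div (by fun_prop) (by fun_prop) fun x hx => ?_)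
    have : t < x := ht.1.trans_le hx
    nlinarith
  have hii : ∀ k A, b ≤ A →
      IntervalIntegrable (fun x => foldedIntegrand ν f k x * ρ x) volume b A := by
    intro k A hA
    refine (((hc k).mul hρc).mono ?_).intervalIntegrable
    rw [Set.uIcc_of_le hA]; exact Set.Icc_subset_Ici_self
  have hsplit : ∀ (s : ℂ) (A : ℝ), b ≤ A →
      ∫ x in b..A, (foldedIntegrand ν f 0 x + s * foldedIntegrand ν f 1 x) * ρ x =
      (∫ x in b..A, foldedIntegrand ν f 0 x * ρ x) +
        s * ∫ x in b..A, foldedIntegrand ν f 1 x * ρ x := by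
    intro s A hA
    rw [← intervalIntegral.integral_const_mul, ← intervalIntegral.integral_add (hii 0 A hA)
      ((hii 1 A hA).const_mul s)]
    congr 1; funext x; ring
  have ht' : (t : ℂ) ≠ 0 := by exact_mod_cast ht0.ne'
  have hconv0 : ∃ L, Tendsto (fun A => ∫ x in b..A, foldedIntegrand ν f 0 x) atTop (𝓝 L) := by
    refine exists_tendsto_of_tendsto_mul_ratio hbt (hc 0)
      (((hL1.add hL2).const_mul (1 / 2 : ℂ)).congr' ?_)
    filter_upwards [eventually_ge_atTop b] with A hA
    simp only [neg_sq]
    rw [hsplit _ A hA, hsplit _ A hA, Complex.ofReal_neg]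
    simp only [hρ]
    ring
  have hconv1 : ∃ L, Tendsto (fun A => ∫ x in b..A, foldedIntegrand ν f 1 x) atTop (𝓝 L) := by
    refine exists_tendsto_of_tendsto_mul_ratio hbt (hc 1)
      (((hL1.sub hL2).const_mul (1 / (2 * t) : ℂ)).congr' ?_)
    filter_upwards [eventually_ge_atTop b] with A hA
    simp only [neg_sq]
    rw [hsplit _ A hA, hsplit _ A hA, Complex.ofReal_neg]
    simp only [hρ]
    field_simp
    ring
  obtain ⟨L0, h0⟩ := hconv0
  obtain ⟨L1, h1⟩ := hconv1
  obtain ⟨M0, hM0⟩ := abel_test hb (hc 0) h0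
  obtain ⟨M1, hM1⟩ := abel_test hb (hc 1) h1
  have hE : ∀ i j A, b ≤ A → ∫ x in b..A, foldedIntegrand ν f (i + 2 * j) x =
      ∫ x in b..A, foldedIntegrand ν f i x * (((x ^ (2 * j))⁻¹ : ℝ) : ℂ) := by
    intro i j A hA
    refine intervalIntegral.integral_congr fun x hx => ?_
    rw [Set.uIcc_of_le hA] at hx
    exact foldedIntegrand_add_two_mul f (hb.trans_le hx.1) i j
  -- For odd `k = 2j + 1` Abel's test supplies only `b^(-2j)`; the extra factor `b` restores
  -- `b^(-k)`.
  refine ⟨max M0 (M1 * b), fun k => ?_⟩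
  have hbk : 0 ≤ b⁻¹ ^ k := by positivity
  rcases Nat.even_or_odd' k with ⟨j, rfl | rfl⟩
  · obtain ⟨⟨L, hL⟩, hbd⟩ := hM0 (2 * j)
    refine ⟨⟨L, hL.congr' ?_⟩, fun A hA => ?_⟩
    · filter_upwards [eventually_ge_atTop b] with A hA
      rw [← hE 0 j A hA, zero_add]
    · have := hbd A hA
      rw [← hE 0 j A hA, zero_add] at this
      exact this.trans (mul_le_mul_of_nonneg_right (le_max_left _ _) hbk)
  · obtain ⟨⟨L, hL⟩, hbd⟩ := hM1 (2 * j)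
    refine ⟨⟨L, hL.congr' ?_⟩, fun A hA => ?_⟩
    · filter_upwards [eventually_ge_atTop b] with A hA
      rw [← hE 1 j A hA, add_comm 1]
    · have := hbd A hA
      rw [← hE 1 j A hA, add_comm 1] at this
      refine this.trans (le_trans (le_of_eq ?_)
        (mul_le_mul_of_nonneg_right (le_max_right _ _) hbk))
      rw [pow_succ]
      field_simp

/-- Apply the finite formula on `[-A, A]` and let `A → ∞`. The coefficients for `A` differ from
those for a fixed `b` by tails of size `M b^(-k)`, uniformly in `A`. With `b > |ω|` the tails are
dominated by a geometric series, and the coefficients for `b` are summable by the finite case. -/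
theorem exists_folded_coefficients_top {ν : ℝ} {f : ℝ → ℂ} (hν0 : 0 < ν) (hν : ν < 1)
    (hf : IsComplexAnalyticOn f Set.univ)
    (hPV : ∀ ω : ℝ, ω ≠ 0 → ENNReal.ofReal |ω| < singularityDist f →
      ∃ V : ℂ, HasPV (hilbertIntegrand f ν ω) ω ⊤ V) :
    ∃ c : ℕ → ℂ, (∀ k, HasFinitePart (foldedIntegrand ν f k) ⊤ (c k)) ∧
      ∀ ω : ℝ, (ω ≠ 0 ∨ f 0 = 0) → ENNReal.ofReal |ω| < singularityDist f →
        (Summable fun k => (ω : ℂ) ^ k * c k) ∧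
        HasPV (hilbertIntegrand f ν ω) ω ⊤
          ((∑' k, (ω : ℂ) ^ k * c k) - Complex.I * Real.pi * (f ω * negPow ν ω)) := by
  have hfc : Continuous f := continuousOn_univ.1 hf.continuousOn
  have hfI : ∀ A, IsComplexAnalyticOn f (Set.Icc (-A) A) := by
    intro A
    obtain ⟨F, h1, h2⟩ := hf
    exact ⟨F, fun x _ => h1 x trivial, fun x _ => h2 x trivial⟩
  have hs := singularityDist_pos one_pos (hfI 1)
  have hex : ∀ A : ℝ, ∃ c : ℕ → ℂ, 0 < A →
      (∀ k, HasFinitePartReal (foldedIntegrand ν f k) A (c k)) ∧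
      ∀ ω : ℝ, (ω ≠ 0 ∨ f 0 = 0) → |ω| < A → ENNReal.ofReal |ω| < singularityDist f →
        (Summable fun k => (ω : ℂ) ^ k * c k) ∧
        HasPVReal (hilbertIntegrand f ν ω) ω A
          ((∑' k, (ω : ℂ) ^ k * c k) - Complex.I * Real.pi * (f ω * negPow ν ω)) := by
    intro A
    by_cases hA : 0 < A
    · obtain ⟨c, hc⟩ := exists_folded_coefficients_real hν0 hν hA (hfI A)
      exact ⟨c, fun _ => hc⟩
    · exact ⟨0, fun h => absurd h hA⟩
  choose C hC using hex
  have hdiff : ∀ b A k, 0 < b → b ≤ A →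
      C A k = C b k + ∫ x in b..A, foldedIntegrand ν f k x := by
    intro b A k hb hA
    refine ((hC A (hb.trans_le hA)).1 k).unique (((hC b hb).1 k).extend hb hA ?_)
    refine ((continuousOn_foldedIntegrand hfc hb k).mono ?_).intervalIntegrable
    rw [Set.uIcc_of_le hA]; exact Set.Icc_subset_Ici_self
  have htail : ∀ b, 0 < b → ∃ M, ∀ k : ℕ, (∃ L, Tendsto (fun A => C A k) atTop (𝓝 L)) ∧
      ∀ A, b ≤ A → ‖C A k‖ ≤ ‖C b k‖ + M * b⁻¹ ^ k := by
    intro b hb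
    obtain ⟨M, hM⟩ := exists_folded_tail_bound hfc hb hs hPV
    refine ⟨M, fun k => ⟨?_, fun A hA => ?_⟩⟩
    · obtain ⟨L, hL⟩ := (hM k).1
      refine ⟨_, (hL.const_add (C b k)).congr' ?_⟩
      filter_upwards [eventually_ge_atTop b] with A hA
      exact (hdiff b A k hb hA).symm
    · rw [hdiff b A k hb hA]
      exact (norm_add_le _ _).trans (add_le_add_right ((hM k).2 A hA) _)
  obtain ⟨M1, hM1⟩ := htail 1 one_pos
  choose c hc using fun k => (hM1 k).1
  refine ⟨c, fun k => ⟨fun A => C A k, fun A hA => (hC A hA).1 k, hc k⟩, fun ω hω0 hωs => ?_⟩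
  -- The comparison point only has to exceed `|ω|`. It may lie beyond the radius of analyticity,
  -- since the finite formula is valid on every `[-A, A]` with `A > |ω|`.
  have hb : 0 < |ω| + 1 := by positivity
  obtain ⟨M, hM⟩ := htail (|ω| + 1) hb
  have hbsum : Summable fun k => |ω| ^ k * (‖C (|ω| + 1) k‖ + M * (|ω| + 1)⁻¹ ^ k) := by
    have h1 := ((hC (|ω| + 1) hb).2 ω hω0 (by linarith) hωs).1.norm
    have h2 : Summable fun k => M * (|ω| / (|ω| + 1)) ^ k :=
      (summable_geometric_of_lt_one (by positivity) ((div_lt_one hb).2 (by linarith))).mul_left M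
    refine (h1.add h2).congr fun k => ?_
    rw [norm_mul, norm_pow, Complex.norm_real, Real.norm_eq_abs, div_eq_mul_inv, mul_pow]
    ring
  have hbound : ∀ k A, |ω| + 1 ≤ A →
      ‖(ω : ℂ) ^ k * C A k‖ ≤ |ω| ^ k * (‖C (|ω| + 1) k‖ + M * (|ω| + 1)⁻¹ ^ k) := by
    intro k A hA
    rw [norm_mul, norm_pow, Complex.norm_real, Real.norm_eq_abs]
    exact mul_le_mul_of_nonneg_left ((hM k).2 A hA) (by positivity)
  refine ⟨Summable.of_norm_bounded hbsum fun k => ?_, fun A => (∑' k, (ω : ℂ) ^ k * C A k) -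
    Complex.I * Real.pi * (f ω * negPow ν ω), fun A hA => ?_, ?_⟩
  · refine le_of_tendsto ((hc k).const_mul ((ω : ℂ) ^ k)).norm ?_
    filter_upwards [eventually_ge_atTop (|ω| + 1)] with A hA
    exact hbound k A hA
  · exact ((hC A ((abs_nonneg ω).trans_lt hA)).2 ω hω0 hA hωs).2
  · refine Tendsto.sub_const ?_ _
    refine tendsto_tsum_of_dominated_convergence hbsum (fun k => (hc k).const_mul _) ?_
    filter_upwards [eventually_ge_atTop (|ω| + 1)] with A hA k
    exact hbound k A hA

theorem exists_folded_coefficients {ν : ℝ} {a : WithTop ℝ} {f : ℝ → ℂ} (hν0 : 0 < ν) (hν : ν < 1)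
    (ha : 0 < a) (hf : IsComplexAnalyticOn f (symInterval a))
    (hPV : a = ⊤ → ∀ ω : ℝ, ω ≠ 0 → ENNReal.ofReal |ω| < singularityDist f →
      ∃ V : ℂ, HasPV (hilbertIntegrand f ν ω) ω a V) :
    ∃ c : ℕ → ℂ, (∀ k, HasFinitePart (foldedIntegrand ν f k) a (c k)) ∧
      ∀ ω : ℝ, (ω ≠ 0 ∨ f 0 = 0) → ((|ω| : ℝ) : WithTop ℝ) < a →
        ENNReal.ofReal |ω| < singularityDist f →
        (Summable fun k => (ω : ℂ) ^ k * c k) ∧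
        HasPV (hilbertIntegrand f ν ω) ω a
          ((∑' k, (ω : ℂ) ^ k * c k) - Complex.I * Real.pi * (f ω * negPow ν ω)) := by
  induction a with
  | coe a =>
    have hI : symInterval (a : WithTop ℝ) = Set.Icc (-a) a := by
      ext x
      simp [symInterval, abs_le]
    rw [hI] at hf
    obtain ⟨c, hc, hcω⟩ := exists_folded_coefficients_real hν0 hν (by exact_mod_cast ha) hf
    exact ⟨c, hc, fun ω h0 hωa hωs => hcω ω h0 (by exact_mod_cast hωa) hωs⟩
  | top =>
    have hI : symInterval (⊤ : WithTop ℝ) = Set.univ := by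
      ext x
      simp [symInterval]
    rw [hI] at hf
    obtain ⟨c, hc, hcω⟩ := exists_folded_coefficients_top hν0 hν hf (hPV rfl)
    exact ⟨c, hc, fun ω h0 _ hωs => hcω ω h0 hωs⟩

end InfiniteInterval

/-! ### Even functions and re-indexing -/

section Parity

theorem HasFinitePart.congr {φ ψ : ℝ → ℂ} {a : WithTop ℝ} {L : ℂ} (h : HasFinitePart φ a L)
    (ha : 0 < a) (he : ∀ x : ℝ, 0 < x → (x : WithTop ℝ) ≤ a → φ x = ψ x) :
    HasFinitePart ψ a L := by
  induction a with
  | coe a =>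
    exact HasFinitePartReal.congr h (by exact_mod_cast ha)
      fun x h0 h1 => he x h0 (by exact_mod_cast h1)
  | top =>
    obtain ⟨F, hF, hFL⟩ := h
    exact ⟨F, fun A hA => (hF A hA).congr hA fun x h0 _ => he x h0 le_top, hFL⟩

theorem HasFinitePart.const_mul {φ : ℝ → ℂ} {a : WithTop ℝ} {L : ℂ} (h : HasFinitePart φ a L)
    (c : ℂ) : HasFinitePart (fun x => c * φ x) a (c * L) := by
  induction a with
  | coe a => exact HasFinitePartReal.const_mul h c
  | top =>
    obtain ⟨F, hF, hFL⟩ := h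
    exact ⟨fun A => c * F A, fun A hA => (hF A hA).const_mul c, hFL.const_mul c⟩

theorem HasFinitePart.hasConvIntegral {φ : ℝ → ℂ} {a : WithTop ℝ} {L : ℂ}
    (h : HasFinitePart φ a L) (ha : 0 < a)
    (hi : ∀ A : ℝ, 0 < A → (A : WithTop ℝ) ≤ a → IntervalIntegrable φ volume 0 A) :
    HasConvIntegral φ a L := by
  induction a with
  | coe a =>
    have ha' : 0 < a := by exact_mod_cast ha
    have hia := hi a ha' le_rfl
    exact ⟨hia, (IntervalIntegrable.hasFinitePartReal ha' hia).unique h⟩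
  | top =>
    obtain ⟨F, hF, hFL⟩ := h
    refine ⟨fun A hA => hi A hA le_top, hFL.congr' ?_⟩
    filter_upwards [eventually_gt_atTop 0] with A hA
    exact (hF A hA).unique (IntervalIntegrable.hasFinitePartReal hA (hi A hA le_top))

theorem mem_symInterval_of_pos {a : WithTop ℝ} {x : ℝ} (hx : 0 < x) (h : (x : WithTop ℝ) ≤ a) :
    x ∈ symInterval a ∧ -x ∈ symInterval a := by
  simp only [symInterval, Set.mem_ofPred_eq, abs_neg, abs_of_pos hx]
  exact ⟨h, h⟩

theorem Icc_subset_symInterval {a : WithTop ℝ} {A : ℝ} (h : (A : WithTop ℝ) ≤ a) :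
    Set.Icc (-A) A ⊆ symInterval a := fun _ hx =>
  (WithTop.coe_le_coe.2 (abs_le.2 hx)).trans h

theorem intervalIntegrable_div_rpow {s A : ℝ} {h : ℝ → ℂ} (hs : s < 1) (hA : 0 < A)
    (hh : ContinuousOn h (Set.Icc 0 A)) :
    IntervalIntegrable (fun x : ℝ => h x / ((x ^ s : ℝ) : ℂ)) volume 0 A := by
  have h1 : IntervalIntegrable (fun x : ℝ => x ^ (-s)) volume 0 A :=
    intervalIntegral.intervalIntegrable_rpow' (by linarith)
  have h2 : IntervalIntegrable (fun x : ℝ => ((x ^ (-s) : ℝ) : ℂ)) volume 0 A :=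
    ⟨h1.1.ofReal, h1.2.ofReal⟩
  refine (h2.continuousOn_mul (by rwa [Set.uIcc_of_le hA.le])).congr fun x hx => ?_
  rw [Set.uIoc_of_le hA.le] at hx
  simp only [Real.rpow_neg hx.1.le, Complex.ofReal_inv, div_eq_mul_inv]

/-- The factor `e ^ (-iπν) - 1` of the even coefficients of an even function. -/
def evenFactor (ν : ℝ) : ℂ :=
  -(2 * Complex.I * (Real.sin (Real.pi * ν / 2) : ℂ) * Complex.exp (-(Complex.I * Real.pi * ν / 2)))

/-- The factor `-(e ^ (-iπν) + 1)` of the odd coefficients of an even function. -/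
def oddFactor (ν : ℝ) : ℂ :=
  -(2 * (Real.cos (Real.pi * ν / 2) : ℂ) * Complex.exp (-(Complex.I * Real.pi * ν / 2)))

theorem exp_neg_half (ν : ℝ) : Complex.exp (-(Complex.I * Real.pi * ν / 2)) =
    Real.cos (Real.pi * ν / 2) - Complex.I * Real.sin (Real.pi * ν / 2) := by
  have h := branchPhase_eq (ν / 2)
  rw [branchPhase] at h
  rw [mul_div_assoc Real.pi, ← h]
  congr 1
  push_cast
  ring

theorem branchPhase_eq_sq (ν : ℝ) :
    branchPhase ν = Complex.exp (-(Complex.I * Real.pi * ν / 2)) ^ 2 := by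
  rw [branchPhase, ← Complex.exp_nat_mul]
  congr 1
  push_cast
  ring

theorem sin_sq_add_cos_sq_ofReal (x : ℝ) :
    (Real.sin x : ℂ) ^ 2 + (Real.cos x : ℂ) ^ 2 = 1 := by
  exact_mod_cast Real.sin_sq_add_cos_sq x

theorem branchPhase_sub_one (ν : ℝ) : branchPhase ν - 1 = evenFactor ν := by
  rw [branchPhase_eq_sq, evenFactor, exp_neg_half]
  linear_combination (Real.sin (Real.pi * ν / 2) : ℂ) ^ 2 * (-Complex.I_sq) +
    sin_sq_add_cos_sq_ofReal (Real.pi * ν / 2)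

theorem neg_branchPhase_sub_one (ν : ℝ) : -branchPhase ν - 1 = oddFactor ν := by
  rw [branchPhase_eq_sq, oddFactor, exp_neg_half]
  linear_combination (Real.sin (Real.pi * ν / 2) : ℂ) ^ 2 * (-Complex.I_sq) +
    sin_sq_add_cos_sq_ofReal (Real.pi * ν / 2)

theorem evenFactor_ne_zero {ν : ℝ} (h0 : 0 < ν) (h1 : ν < 1) : evenFactor ν ≠ 0 := by
  have : 0 < Real.sin (Real.pi * ν / 2) := by
    apply Real.sin_pos_of_pos_of_lt_pi <;> nlinarith [Real.pi_pos]
  have h : (Real.sin (Real.pi * ν / 2) : ℂ) ≠ 0 := by exact_mod_cast this.ne'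
  exact neg_ne_zero.2 (mul_ne_zero (mul_ne_zero (mul_ne_zero two_ne_zero Complex.I_ne_zero) h)
    (Complex.exp_ne_zero _))

theorem oddFactor_ne_zero {ν : ℝ} (h0 : 0 < ν) (h1 : ν < 1) : oddFactor ν ≠ 0 := by
  have : 0 < Real.cos (Real.pi * ν / 2) := by
    apply Real.cos_pos_of_mem_Ioo
    constructor <;> nlinarith [Real.pi_pos]
  have h : (Real.cos (Real.pi * ν / 2) : ℂ) ≠ 0 := by exact_mod_cast this.ne'
  exact neg_ne_zero.2 (mul_ne_zero (mul_ne_zero two_ne_zero h) (Complex.exp_ne_zero _))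

theorem foldedIntegrand_even {ν : ℝ} {g : ℝ → ℂ} {x : ℝ} (h : g (-x) = g x) (k : ℕ) :
    foldedIntegrand ν g (2 * k) x =
      evenFactor ν * (g x / ((x ^ (2 * (k : ℝ) + ν + 1) : ℝ) : ℂ)) := by
  rw [foldedIntegrand, h, ← branchPhase_sub_one, branchPhase, pow_mul, neg_one_sq, one_pow]
  push_cast
  ring

theorem foldedIntegrand_odd {ν : ℝ} {g : ℝ → ℂ} {x : ℝ} (h : g (-x) = g x) (k : ℕ) :
    foldedIntegrand ν g (2 * k + 1) x =
      oddFactor ν * (g x / ((x ^ (2 * (k : ℝ) + ν + 2) : ℝ) : ℂ)) := by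
  rw [foldedIntegrand, h, ← neg_branchPhase_sub_one, branchPhase, pow_succ, pow_mul, neg_one_sq,
    one_pow, show ((2 * k + 1 : ℕ) : ℝ) + ν + 1 = 2 * (k : ℝ) + ν + 2 by push_cast; ring]
  ring

/-- For even `g` each folded integrand is a nonzero multiple of `g(x)` over a power. Dividing by
that factor yields the existence of the unfolded finite parts, including for `a = ∞`, where it is
not evident otherwise. -/
theorem hasFinitePart_even {ν : ℝ} {a : WithTop ℝ} {g : ℝ → ℂ} {C : ℕ → ℂ} (h0 : 0 < ν)
    (h1 : ν < 1) (ha : 0 < a) (hg : ∀ x ∈ symInterval a, g (-x) = g x)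
    (hC : ∀ k, HasFinitePart (foldedIntegrand ν g k) a (C k)) (k : ℕ) :
    HasFinitePart (fun x : ℝ => g x / ((x ^ (2 * (k : ℝ) + ν + 1) : ℝ) : ℂ)) a
      ((evenFactor ν)⁻¹ * C (2 * k)) ∧
    HasFinitePart (fun x : ℝ => g x / ((x ^ (2 * (k : ℝ) + ν + 2) : ℝ) : ℂ)) a
      ((oddFactor ν)⁻¹ * C (2 * k + 1)) := by
  refine ⟨((hC (2 * k)).const_mul _).congr ha fun x hx hxa => ?_,
    ((hC (2 * k + 1)).const_mul _).congr ha fun x hx hxa => ?_⟩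
  · rw [foldedIntegrand_even (hg x (mem_symInterval_of_pos hx hxa).1),
      inv_mul_cancel_left₀ (evenFactor_ne_zero h0 h1)]
  · rw [foldedIntegrand_odd (hg x (mem_symInterval_of_pos hx hxa).1),
      inv_mul_cancel_left₀ (oddFactor_ne_zero h0 h1)]

/-- The sign `(-1)^m` coming from `(-x)^m` cancels that of `(-1)^(k+m)`, so the coefficients of `g`
are those of `f` shifted by `m`. -/
theorem foldedIntegrand_pow_mul_add {ν x : ℝ} {f g : ℝ → ℂ} {m : ℕ} (hx : 0 < x)
    (h : f x = (x : ℂ) ^ m * g x) (h' : f (-x) = ((-x : ℝ) : ℂ) ^ m * g (-x)) (k : ℕ) :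
    foldedIntegrand ν f (k + m) x = foldedIntegrand ν g k x := by
  have hx' : (x : ℂ) ≠ 0 := by exact_mod_cast hx.ne'
  rw [foldedIntegrand, foldedIntegrand, h, h',
    show ((k + m : ℕ) : ℝ) + ν + 1 = ((k : ℝ) + ν + 1) + m by push_cast; ring,
    Real.rpow_add hx, Real.rpow_natCast, Complex.ofReal_mul, Complex.ofReal_pow,
    Complex.ofReal_neg, neg_pow (x : ℂ), pow_add]
  refine Eq.trans ?_ (mul_div_mul_right _ _ (pow_ne_zero m hx'))
  congr 1
  have : (-1 : ℂ) ^ m * (-1) ^ m = 1 := by rw [← mul_pow]; norm_num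
  linear_combination Complex.exp (-(Complex.I * Real.pi * ν)) * (-1) ^ k * (x : ℂ) ^ m *
    g (-x) * this

theorem foldedIntegrand_pow_mul {ν x : ℝ} {f g : ℝ → ℂ} {m : ℕ} (hx : 0 < x)
    (h : f x = (x : ℂ) ^ m * g x) (h' : f (-x) = ((-x : ℝ) : ℂ) ^ m * g (-x)) (k : ℕ) :
    foldedIntegrand ν f k x =
      ((-1) ^ (k + m) * Complex.exp (-(Complex.I * Real.pi * ν)) * g (-x) - g x) /
        ((x ^ ((k : ℝ) - m + ν + 1) : ℝ) : ℂ) := by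
  have hx' : (x : ℂ) ≠ 0 := by exact_mod_cast hx.ne'
  rw [foldedIntegrand, h, h',
    show (k : ℝ) + ν + 1 = ((k : ℝ) - m + ν + 1) + m by ring,
    Real.rpow_add hx _ (m : ℝ), Real.rpow_natCast, Complex.ofReal_mul, Complex.ofReal_pow,
    Complex.ofReal_neg, neg_pow (x : ℂ), pow_add]
  refine Eq.trans ?_ (mul_div_mul_right _ _ (pow_ne_zero m hx'))
  congr 1
  ring

/-- The first sum runs over the indices `2k + (m mod 2)`, of the parity of `m`; the second over `2k
+ 1 - (m mod 2)`, of the opposite parity. The natural subtractions never truncate. -/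
theorem sum_range_eq_sum_parity {E : Type*} [AddCommMonoid E] (u : ℕ → E) (m : ℕ) :
    ∑ j ∈ Finset.range m, u j =
      ∑ k ∈ Finset.range (m / 2), u (2 * k + 2 * ((m + 1) / 2) - m) +
      ∑ k ∈ Finset.range ((m + 1) / 2), u (2 * k + 1 + 2 * (m / 2) - m) := by
  have key : ∀ n, ∑ j ∈ Finset.range (2 * n), u j =
      ∑ k ∈ Finset.range n, u (2 * k) + ∑ k ∈ Finset.range n, u (2 * k + 1) := by
    intro n
    induction n with
    | zero => simp
    | succ n ih =>
      rw [Nat.mul_succ, Finset.sum_range_succ, Finset.sum_range_succ, ih, Finset.sum_range_succ,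
        Finset.sum_range_succ]
      abel
  rcases Nat.even_or_odd' m with ⟨n, rfl | rfl⟩
  · rw [key, show 2 * n / 2 = n by omega, show (2 * n + 1) / 2 = n by omega]
    congr 1 <;> refine Finset.sum_congr rfl fun k _ => congrArg u ?_ <;> omega
  · rw [Finset.sum_range_succ, key, show (2 * n + 1) / 2 = n by omega,
      show (2 * n + 1 + 1) / 2 = n + 1 by omega, add_right_comm, ← Finset.sum_range_succ, add_comm]
    congr 1 <;> refine Finset.sum_congr rfl fun k _ => congrArg u ?_ <;> omega

end Parity

/-! ### Factoring out `x^m` -/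

section VanishingOrder

variable {ν : ℝ} {a : WithTop ℝ} {f g : ℝ → ℂ} {m : ℕ} {C : ℕ → ℂ}

theorem hasFinitePart_factor (ha : 0 < a)
    (hfg : ∀ x ∈ symInterval a, f x = (x : ℂ) ^ m * g x)
    (hC : ∀ k, HasFinitePart (foldedIntegrand ν f k) a (C k)) (k : ℕ) :
    HasFinitePart (foldedIntegrand ν g k) a (C (k + m)) :=
  (hC (k + m)).congr ha fun x hx hxa => foldedIntegrand_pow_mul_add hx
    (hfg x (mem_symInterval_of_pos hx hxa).1) (hfg (-x) (mem_symInterval_of_pos hx hxa).2) k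

/-- For `k < m` the exponent `k - m + ν + 1` is at most `ν < 1`, so the integrand is integrable at
`0` and its finite part is the integral. -/
theorem hasConvIntegral_factor (hν : ν < 1) (ha : 0 < a)
    (hg : ContinuousOn g (symInterval a))
    (hfg : ∀ x ∈ symInterval a, f x = (x : ℂ) ^ m * g x)
    (hC : ∀ k, HasFinitePart (foldedIntegrand ν f k) a (C k)) {k : ℕ} (hk : k < m) :
    HasConvIntegral (fun x : ℝ =>
      ((-1) ^ (k + m) * Complex.exp (-(Complex.I * Real.pi * ν)) * g (-x) - g x) /
        ((x ^ ((k : ℝ) - m + ν + 1) : ℝ) : ℂ)) a (C k) := by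
  refine ((hC k).congr ha fun x hx hxa => foldedIntegrand_pow_mul hx
    (hfg x (mem_symInterval_of_pos hx hxa).1)
    (hfg (-x) (mem_symInterval_of_pos hx hxa).2) k).hasConvIntegral ha fun A hA hAa => ?_
  have hgA := hg.mono (Icc_subset_symInterval hAa)
  have hI : Set.Icc 0 A ⊆ Set.Icc (-A) A := Set.Icc_subset_Icc_left (by linarith)
  have hkm : (k : ℝ) + 1 ≤ m := by exact_mod_cast hk
  refine intervalIntegrable_div_rpow (h := fun x : ℝ =>
    (-1) ^ (k + m) * Complex.exp (-(Complex.I * Real.pi * ν)) * g (-x) - g x) (by linarith) hA ?_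
  exact (continuousOn_const.mul ((continuousOn_comp_neg_Icc hgA).mono hI)).sub (hgA.mono hI)

/-- Convergence of the integrals below the order of vanishing, for even `g`. -/
theorem hasConvIntegral_parity (hν : ν < 1) (ha : 0 < a)
    (hg : ContinuousOn g (symInterval a))
    (hfg : ∀ x ∈ symInterval a, f x = (x : ℂ) ^ m * g x)
    (hC : ∀ k, HasFinitePart (foldedIntegrand ν f k) a (C k)) {k : ℕ} (hk : k < m)
    {s : ℝ} (hs : s = (k : ℝ) - m + ν + 1) {α : ℂ} (hα : α ≠ 0)
    (hgα : ∀ x ∈ symInterval a,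
      (-1) ^ (k + m) * Complex.exp (-(Complex.I * Real.pi * ν)) * g (-x) - g x = α * g x) :
    HasConvIntegral (fun x : ℝ => g x / ((x ^ s : ℝ) : ℂ)) a (α⁻¹ * C k) := by
  refine (((hC k).const_mul α⁻¹).congr ha fun x hx hxa => ?_).hasConvIntegral ha
    fun A hA hAa => ?_
  · have hm := mem_symInterval_of_pos hx hxa
    rw [foldedIntegrand_pow_mul hx (hfg x hm.1) (hfg (-x) hm.2), hgα x hm.1, ← hs, mul_div_assoc,
      inv_mul_cancel_left₀ hα]
  · have hkm : (k : ℝ) + 1 ≤ m := by exact_mod_cast hk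
    exact intervalIntegrable_div_rpow (by linarith) hA
      ((hg.mono (Icc_subset_symInterval hAa)).mono (Set.Icc_subset_Icc_left (by linarith)))

theorem neg_one_pow_mul_exp_sub_of_even {j : ℕ} (hj : Even j) {x : ℝ} (h : g (-x) = g x) :
    (-1) ^ j * Complex.exp (-(Complex.I * Real.pi * ν)) * g (-x) - g x = evenFactor ν * g x := by
  rw [hj.neg_one_pow, h, ← branchPhase_sub_one, branchPhase]
  ring

theorem neg_one_pow_mul_exp_sub_of_odd {j : ℕ} (hj : Odd j) {x : ℝ} (h : g (-x) = g x) :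
    (-1) ^ j * Complex.exp (-(Complex.I * Real.pi * ν)) * g (-x) - g x = oddFactor ν * g x := by
  rw [hj.neg_one_pow, h, ← neg_branchPhase_sub_one, branchPhase]
  ring

end VanishingOrder

end

/-! ### The four formulas, all read off from one coefficient sequence -/

theorem theorem4p3 (ν : ℝ) (hν0 : 0 < ν) (hν1 : ν < 1)
    (a : WithTop ℝ) (ha : 0 < a) (f : ℝ → ℂ)
    (hf : IsComplexAnalyticOn f (symInterval a))
    -- for `a = ∞` the principal-value integrals are supposed to exist
    (hPV : a = ⊤ → ∀ ω : ℝ, ω ≠ 0 → ENNReal.ofReal |ω| < singularityDist f →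
      ∃ V : ℂ, HasPV (hilbertIntegrand f ν ω) ω a V) :
    -- `f(0) ≠ 0`
    (f 0 ≠ 0 →
      ∃ c : ℕ → ℂ,
        (∀ k : ℕ, HasFinitePart (fun x : ℝ =>
          (Complex.exp (-(Complex.I * Real.pi * ν)) * (-1) ^ k * f (-x) - f x) /
            ((x ^ ((k : ℝ) + ν + 1) : ℝ) : ℂ)) a (c k)) ∧
        ∀ ω : ℝ, ω ≠ 0 → ((|ω| : ℝ) : WithTop ℝ) < a →
          ENNReal.ofReal |ω| < singularityDist f →
          Summable (fun k : ℕ => (ω : ℂ) ^ k * c k) ∧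
          HasPV (hilbertIntegrand f ν ω) ω a
            ((∑' k : ℕ, (ω : ℂ) ^ k * c k) - Complex.I * Real.pi * (f ω * negPow ν ω))) ∧
    -- `f` even, `f(0) ≠ 0`
    (f 0 ≠ 0 → (∀ x ∈ symInterval a, f (-x) = f x) →
      ∃ c d : ℕ → ℂ,
        (∀ k : ℕ, HasFinitePart (fun x : ℝ =>
          f x / ((x ^ (2 * (k : ℝ) + ν + 1) : ℝ) : ℂ)) a (c k)) ∧
        (∀ k : ℕ, HasFinitePart (fun x : ℝ =>
          f x / ((x ^ (2 * (k : ℝ) + ν + 2) : ℝ) : ℂ)) a (d k)) ∧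
        ∀ ω : ℝ, ω ≠ 0 → ((|ω| : ℝ) : WithTop ℝ) < a →
          ENNReal.ofReal |ω| < singularityDist f →
          Summable (fun k : ℕ => (ω : ℂ) ^ (2 * k) * c k) ∧
          Summable (fun k : ℕ => (ω : ℂ) ^ (2 * k + 1) * d k) ∧
          HasPV (hilbertIntegrand f ν ω) ω a
            (-(2 * Complex.I * (Real.sin (Real.pi * ν / 2) : ℂ) *
                Complex.exp (-(Complex.I * Real.pi * ν / 2)) *
                ∑' k : ℕ, (ω : ℂ) ^ (2 * k) * c k)
              - 2 * (Real.cos (Real.pi * ν / 2) : ℂ) *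
                Complex.exp (-(Complex.I * Real.pi * ν / 2)) *
                (∑' k : ℕ, (ω : ℂ) ^ (2 * k + 1) * d k)
              - Complex.I * Real.pi * (f ω * negPow ν ω))) ∧
    -- `f(x) = x ^ m g(x)` with `g(0) ≠ 0`
    (∀ (m : ℕ) (g : ℝ → ℂ), 1 ≤ m → IsComplexAnalyticOn g (symInterval a) → g 0 ≠ 0 →
      (∀ x ∈ symInterval a, f x = (x : ℂ) ^ m * g x) →
      ∃ c e : ℕ → ℂ,
        (∀ k : ℕ, k < m → HasConvIntegral (fun x : ℝ =>
          ((-1) ^ (k + m) * Complex.exp (-(Complex.I * Real.pi * ν)) * g (-x) - g x) /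
            ((x ^ ((k : ℝ) - m + ν + 1) : ℝ) : ℂ)) a (e k)) ∧
        (∀ k : ℕ, HasFinitePart (fun x : ℝ =>
          ((-1) ^ k * Complex.exp (-(Complex.I * Real.pi * ν)) * g (-x) - g x) /
            ((x ^ ((k : ℝ) + ν + 1) : ℝ) : ℂ)) a (c k)) ∧
        ∀ ω : ℝ, ((|ω| : ℝ) : WithTop ℝ) < a → ENNReal.ofReal |ω| < singularityDist f →
          Summable (fun k : ℕ => (ω : ℂ) ^ (k + m) * c k) ∧
          HasPV (hilbertIntegrand f ν ω) ω a
            ((∑ k ∈ Finset.range m, (ω : ℂ) ^ k * e k)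
              + (∑' k : ℕ, (ω : ℂ) ^ (k + m) * c k)
              - Complex.I * Real.pi * ((ω : ℂ) ^ m * negPow ν ω * g ω))) ∧
    -- `f(x) = x ^ m g(x)` with `g(0) ≠ 0` and `g` even; the sums over `0 ≤ k ≤ ⌊(m-2)/2⌋` and
    -- `0 ≤ k ≤ ⌊(m-1)/2⌋` have `⌊m/2⌋` and `⌊(m+1)/2⌋` terms
    (∀ (m : ℕ) (g : ℝ → ℂ), 1 ≤ m → IsComplexAnalyticOn g (symInterval a) → g 0 ≠ 0 →
      (∀ x ∈ symInterval a, f x = (x : ℂ) ^ m * g x) →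
      (∀ x ∈ symInterval a, g (-x) = g x) →
      ∃ c d p q : ℕ → ℂ,
        (∀ k : ℕ, HasFinitePart (fun x : ℝ =>
          g x / ((x ^ (2 * (k : ℝ) + ν + 1) : ℝ) : ℂ)) a (c k)) ∧
        (∀ k : ℕ, HasFinitePart (fun x : ℝ =>
          g x / ((x ^ (2 * (k : ℝ) + ν + 2) : ℝ) : ℂ)) a (d k)) ∧
        (∀ k : ℕ, k < m / 2 → HasConvIntegral (fun x : ℝ =>
          g x / ((x ^ (2 * (k : ℝ) + ν - 1 - 2 * ((((m : ℤ) - 2) / 2 : ℤ) : ℝ)) : ℝ) : ℂ))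
          a (p k)) ∧
        (∀ k : ℕ, k < (m + 1) / 2 → HasConvIntegral (fun x : ℝ =>
          g x / ((x ^ (2 * (k : ℝ) + ν - 2 * ((((m : ℤ) - 1) / 2 : ℤ) : ℝ)) : ℝ) : ℂ))
          a (q k)) ∧
        ∀ ω : ℝ, ((|ω| : ℝ) : WithTop ℝ) < a → ENNReal.ofReal |ω| < singularityDist f →
          Summable (fun k : ℕ => (ω : ℂ) ^ (2 * k + m) * c k) ∧
          Summable (fun k : ℕ => (ω : ℂ) ^ (2 * k + m + 1) * d k) ∧
          HasPV (hilbertIntegrand f ν ω) ω a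
            (-(Complex.I * Real.pi * ((ω : ℂ) ^ m * negPow ν ω * g ω))
              - 2 * Complex.I * Complex.exp (-(Complex.I * Real.pi * ν / 2)) *
                (Real.sin (Real.pi * ν / 2) : ℂ) *
                (∑' k : ℕ, (ω : ℂ) ^ (2 * k + m) * c k)
              - 2 * Complex.exp (-(Complex.I * Real.pi * ν / 2)) *
                (Real.cos (Real.pi * ν / 2) : ℂ) *
                (∑' k : ℕ, (ω : ℂ) ^ (2 * k + m + 1) * d k)
              - 2 * Complex.I * Complex.exp (-(Complex.I * Real.pi * ν / 2)) *
                (Real.sin (Real.pi * ν / 2) : ℂ) *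
                (∑ k ∈ Finset.range (m / 2), (ω : ℂ) ^ (2 * k + 2 * ((m + 1) / 2) - m) * p k)
              - 2 * Complex.exp (-(Complex.I * Real.pi * ν / 2)) *
                (Real.cos (Real.pi * ν / 2) : ℂ) *
                (∑ k ∈ Finset.range ((m + 1) / 2),
                  (ω : ℂ) ^ (2 * k + 1 + 2 * (m / 2) - m) * q k))) := by
  obtain ⟨C, hC, hCω⟩ := exists_folded_coefficients hν0 hν1 ha hf hPV
  have hα := evenFactor_ne_zero hν0 hν1
  have hβ := oddFactor_ne_zero hν0 hν1
  have h0mem : (0 : ℝ) ∈ symInterval a := by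
    change ((|(0 : ℝ)| : ℝ) : WithTop ℝ) ≤ a
    rw [abs_zero]
    exact ha.le
  refine ⟨fun _ => ⟨C, hC, fun ω h0 hωa hωs => hCω ω (Or.inl h0) hωa hωs⟩, fun _ heven => ?_,
    fun m g hm hg _ hfg => ?_, fun m g hm hg _ hfg heven => ?_⟩
  · have hFP := hasFinitePart_even hν0 hν1 ha heven hC
    refine ⟨_, _, fun k => (hFP k).1, fun k => (hFP k).2, fun ω h0 hωa hωs => ?_⟩
    obtain ⟨hsum, hpv⟩ := hCω ω (Or.inl h0) hωa hωs
    have hse : Summable fun k : ℕ => (ω : ℂ) ^ (2 * k) * C (2 * k) :=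
      hsum.comp_injective (i := fun k : ℕ => 2 * k) fun a b h => by simpa using h
    have hso : Summable fun k : ℕ => (ω : ℂ) ^ (2 * k + 1) * C (2 * k + 1) :=
      hsum.comp_injective (i := fun k : ℕ => 2 * k + 1) fun a b h => by simpa using h
    have e1 : ∀ k : ℕ, (ω : ℂ) ^ (2 * k) * ((evenFactor ν)⁻¹ * C (2 * k)) =
        (evenFactor ν)⁻¹ * ((ω : ℂ) ^ (2 * k) * C (2 * k)) := fun k => mul_left_comm _ _ _
    have e2 : ∀ k : ℕ, (ω : ℂ) ^ (2 * k + 1) * ((oddFactor ν)⁻¹ * C (2 * k + 1)) =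
        (oddFactor ν)⁻¹ * ((ω : ℂ) ^ (2 * k + 1) * C (2 * k + 1)) := fun k => mul_left_comm _ _ _
    simp only [e1, e2, tsum_mul_left]
    refine ⟨hse.mul_left _, hso.mul_left _, ?_⟩
    rw [← tsum_even_add_odd (f := fun k => (ω : ℂ) ^ k * C k) hse hso] at hpv
    convert hpv using 1
    have c1 := mul_inv_cancel_left₀ hα (∑' k : ℕ, (ω : ℂ) ^ (2 * k) * C (2 * k))
    have c2 := mul_inv_cancel_left₀ hβ (∑' k : ℕ, (ω : ℂ) ^ (2 * k + 1) * C (2 * k + 1))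
    rw [evenFactor] at c1 ⊢
    rw [oddFactor] at c2 ⊢
    linear_combination c1 + c2
  · refine ⟨fun k => C (k + m), C,
      fun k hk => hasConvIntegral_factor hν1 ha hg.continuousOn hfg hC hk,
      fun k => (hasFinitePart_factor ha hfg hC k).congr ha fun x _ _ => ?_, fun ω hωa hωs => ?_⟩
    · rw [foldedIntegrand, mul_comm ((-1 : ℂ) ^ k)]
    -- As `m ≥ 1`, the function vanishes at `0`, which is what admits `ω = 0` in the general
    -- expansion.
    · have hf0 : f 0 = 0 := by
        rw [hfg 0 h0mem, Complex.ofReal_zero, zero_pow (by omega), zero_mul]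
      obtain ⟨hsum, hpv⟩ := hCω ω (Or.inr hf0) hωa hωs
      refine ⟨(summable_nat_add_iff m).2 hsum, ?_⟩
      rw [← hsum.sum_add_tsum_nat_add m, hfg ω hωa.le] at hpv
      convert hpv using 1
      ring
  · have hFP := hasFinitePart_even hν0 hν1 ha heven (hasFinitePart_factor ha hfg hC)
    refine ⟨_, _, fun k => (evenFactor ν)⁻¹ * C (2 * k + 2 * ((m + 1) / 2) - m),
      fun k => (oddFactor ν)⁻¹ * C (2 * k + 1 + 2 * (m / 2) - m), fun k => (hFP k).1,
      fun k => (hFP k).2, fun k hk => ?_, fun k hk => ?_, fun ω hωa hωs => ?_⟩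
    -- The index of this coefficient has the parity of `m`, so index plus `m` is even and the even
    -- factor appears; in the next case the sum is odd.
    · refine hasConvIntegral_parity hν1 ha hg.continuousOn hfg hC (by omega) ?_ hα fun x hx =>
        neg_one_pow_mul_exp_sub_of_even ⟨k + (m + 1) / 2, by omega⟩ (heven x hx)
      -- Exponents are matched over `ℤ`, where the floor of `(m - 2)/2` is one less than that of
      -- `m/2` even when `m = 1`, and then cast to `ℝ`.
      have h : ((2 * k + 2 * ((m + 1) / 2) - m : ℕ) : ℤ) - m + 2 =
          2 * k - 2 * (((m : ℤ) - 2) / 2) := by omega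
      have h' : ((2 * k + 2 * ((m + 1) / 2) - m : ℕ) : ℝ) - m + 2 =
          2 * k - 2 * ((((m : ℤ) - 2) / 2 : ℤ) : ℝ) := by exact_mod_cast h
      linarith
    · refine hasConvIntegral_parity hν1 ha hg.continuousOn hfg hC (by omega) ?_ hβ fun x hx =>
        neg_one_pow_mul_exp_sub_of_odd ⟨k + m / 2, by omega⟩ (heven x hx)
      have h : ((2 * k + 1 + 2 * (m / 2) - m : ℕ) : ℤ) - m + 1 =
          2 * k - 2 * (((m : ℤ) - 1) / 2) := by omega
      have h' : ((2 * k + 1 + 2 * (m / 2) - m : ℕ) : ℝ) - m + 1 =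
          2 * k - 2 * ((((m : ℤ) - 1) / 2 : ℤ) : ℝ) := by exact_mod_cast h
      linarith
    · have hf0 : f 0 = 0 := by
        rw [hfg 0 h0mem, Complex.ofReal_zero, zero_pow (by omega), zero_mul]
      obtain ⟨hsum, hpv⟩ := hCω ω (Or.inr hf0) hωa hωs
      have hsm := (summable_nat_add_iff m).2 hsum
      have hse : Summable fun k : ℕ => (ω : ℂ) ^ (2 * k + m) * C (2 * k + m) :=
        hsm.comp_injective (i := fun k : ℕ => 2 * k) fun a b h => by simpa using h
      have hso : Summable fun k : ℕ => (ω : ℂ) ^ (2 * k + 1 + m) * C (2 * k + 1 + m) :=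
        hsm.comp_injective (i := fun k : ℕ => 2 * k + 1) fun a b h => by simpa using h
      have e1 : ∀ j k : ℕ, (ω : ℂ) ^ j * ((evenFactor ν)⁻¹ * C k) =
          (evenFactor ν)⁻¹ * ((ω : ℂ) ^ j * C k) := fun j k => mul_left_comm _ _ _
      have e2 : ∀ j k : ℕ, (ω : ℂ) ^ j * ((oddFactor ν)⁻¹ * C k) =
          (oddFactor ν)⁻¹ * ((ω : ℂ) ^ j * C k) := fun j k => mul_left_comm _ _ _
      simp only [e1, e2, tsum_mul_left, ← Finset.mul_sum, add_right_comm _ m 1]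
      refine ⟨hse.mul_left _, hso.mul_left _, ?_⟩
      -- The single series is cut at `m`: its head is split by parity relative to `m`, its tail by
      -- the parity of the shifted index. Each of the four pieces then carries one constant factor.
      rw [← hsum.sum_add_tsum_nat_add m,
        ← tsum_even_add_odd (f := fun k => (ω : ℂ) ^ (k + m) * C (k + m)) hse hso,
        sum_range_eq_sum_parity, hfg ω hωa.le] at hpv
      convert hpv using 1
      have c1 := mul_inv_cancel_left₀ hα (∑' k : ℕ, (ω : ℂ) ^ (2 * k + m) * C (2 * k + m))
      have c2 := mul_inv_cancel_left₀ hβ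
        (∑' k : ℕ, (ω : ℂ) ^ (2 * k + 1 + m) * C (2 * k + 1 + m))
      have c3 := mul_inv_cancel_left₀ hα (∑ k ∈ Finset.range (m / 2),
        (ω : ℂ) ^ (2 * k + 2 * ((m + 1) / 2) - m) * C (2 * k + 2 * ((m + 1) / 2) - m))
      have c4 := mul_inv_cancel_left₀ hβ (∑ k ∈ Finset.range ((m + 1) / 2),
        (ω : ℂ) ^ (2 * k + 1 + 2 * (m / 2) - m) * C (2 * k + 1 + 2 * (m / 2) - m))
      rw [evenFactor] at c1 c3 ⊢
      rw [oddFactor] at c2 c4 ⊢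
      linear_combination c1 + c2 + c3 + c4
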